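/- A domain in the Riemann sphere $\widehat{\mathbb C}$ is a non-empty connected open set, and a circle domain is a domain each of whose boundary components is a geometric circle or a point. A conformal map is an injective holomorphic map. For a bounded domain $D\subset\mathbb C$ let $$k_D(x,y)=\inf_\gamma\int_\gamma \frac{ds}{\operatorname{dist}(\cdot,\partial D)},$$ the infimum being over the rectifiable paths $\gamma\subset D$ from $x$ to $y$. A domain $\Omega\ni\infty$ satisfies the quasihyperbolic condition if there are a ball $B(0,R)$ containing $\widehat{\mathbb C}\setminus\Omega$ and a point $x_0\in D:=B(0,R)\cap\Omega$ with $\int_D k_D(x,x_0)^2\,dx<\infty$. Sets in a family are uniformly fat if there is $c>0$ such that every set $B\subset\mathbb C$ of the family is measurable and $\operatorname{Area}(B\cap B(z,r))\ge c r^2$ for all $z\in B$ and $0<r\le\operatorname{diam}B$ (so one-point sets are allowed). Let $\Omega$ be a circle domain with $\infty\in\Omega$, and let $f$ be a conformal map of $\Omega$ onto a domain $\Omega^*$ with $f(\infty)=\infty\in\Omega^*$. Suppose that $\Omega$ satisfies the quasihyperbolic condition and that the connected components of $\widehat{\mathbb C}\setminus\Omega^*$ are uniformly fat. 1. If $E\subset\partial\Omega$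 is a non-degenerate continuum (a compact connected set with more than one point), then the cluster set $$\operatorname{Clu}(f;E)=\bigcap_{\varepsilon>0}\overline{f(N_\varepsilon(E)\cap\Omega)},$$ where $N_\varepsilon(E)$ is the open $\varepsilon$-neighbourhood of $E$, is contained in $\partial\Omega^*$ and is not a single point. 2. For a boundary component $b$ of $\Omega$, let $f^*(b)$ be the boundary component $b^*$ of $\Omega^*$ such that $f(z_n)$ accumulates at $b^*$ whenever $(z_n)$ is a sequence in $\Omega$ accumulating at $b$. If $b$ is a circle, then $f^*(b)$ is not a single point. -/

import Mathlib

open Set Filter Topology MeasureTheory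

namespace CircleDomain

/-- The Riemann sphere. -/
abbrev Sphere : Type := OnePoint ℂ

/-- The standard coordinate `z` on the finite plane (with value `0` at infinity). -/
def finiteCoord (p : Sphere) : ℂ := p.elim 0 id

/-- The involution `z ↦ 1 / z` of the Riemann sphere, exchanging `0` and `∞`. -/
noncomputable def inversion (p : Sphere) : Sphere :=
  open Classical in
  p.elim ((0 : ℂ) : Sphere) (fun z => if z = 0 then OnePoint.infty else ((z⁻¹ : ℂ) : Sphere))

/-- The identity if `p` is finite, and `z ↦ 1 / z` if `p = ∞`; it sends `p` into the plane. -/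
noncomputable def chartMap (p : Sphere) : Sphere → Sphere :=
  open Classical in
  if p = OnePoint.infty then inversion else id

/-- The holomorphic coordinate around `p`: `z` if `p` is finite, `1 / z` if `p = ∞`. -/
noncomputable def localCoord (p : Sphere) (q : Sphere) : ℂ := finiteCoord (chartMap p q)

/-- The inverse of `localCoord p`. -/
noncomputable def localParam (p : Sphere) (z : ℂ) : Sphere := chartMap p (z : Sphere)

/-- Complex differentiability at a point for self-maps of the Riemann sphere, in coordinates. -/
def SphereDifferentiableAt (f : Sphere → Sphere) (p : Sphere) : Prop :=
  ContinuousAt f p ∧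
    DifferentiableAt ℂ (fun z : ℂ => localCoord (f p) (f (localParam p z))) (localCoord p p)

/-- A domain: a non-empty connected open subset of the Riemann sphere. -/
def IsSphereDomain (Ω : Set Sphere) : Prop := IsOpen Ω ∧ IsConnected Ω

/-- `f` restricts to a conformal map of the open set `Ω` onto `Ω'`: an injective holomorphic map
on `Ω` with image `Ω'`. The values of `f` outside `Ω` play no role. -/
structure IsConformalMapOnto (f : Sphere → Sphere) (Ω Ω' : Set Sphere) : Prop where
  holomorphic : ∀ p ∈ Ω, SphereDifferentiableAt f p
  injOn : InjOn f Ω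
  image_eq : f '' Ω = Ω'

/-- `b` is a connected component of the set `A`. -/
def IsComponentOf (b A : Set Sphere) : Prop := ∃ x ∈ A, b = connectedComponentIn A x

/-- A geometric circle in the Riemann sphere: a Euclidean circle, or a line together with `∞`. -/
def IsGeometricCircle (b : Set Sphere) : Prop :=
  (∃ (a : ℂ) (r : ℝ), 0 < r ∧ b = (fun z : ℂ => (z : Sphere)) '' Metric.sphere a r) ∨
  (∃ a v : ℂ, v ≠ 0 ∧
    b = insert OnePoint.infty (range fun t : ℝ => ((a + (t : ℂ) * v : ℂ) : Sphere)))

/-- A circle domain: a domain all of whose boundary components are circles or points. -/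
def IsCircleDomain (Ω : Set Sphere) : Prop :=
  IsSphereDomain Ω ∧
    ∀ b, IsComponentOf b (frontier Ω) → IsGeometricCircle b ∨ ∃ p, b = {p}

/-- The quasihyperbolic distance in `D`: the infimum of `∫_γ ds / dist(·, ∂D)` over the rectifiable
paths `γ` in `D` from `x` to `y`. Each rectifiable path is given by its parametrization by arc
length, `L` being its length; such a `γ` is automatically continuous (indeed `1`-Lipschitz). -/
noncomputable def quasihyperbolicDist (D : Set ℂ) (x y : ℂ) : ENNReal :=
  ⨅ (L : ℝ) (γ : ℝ → ℂ) (_ : 0 ≤ L) (_ : HasUnitSpeedOn γ (Icc 0 L))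
    (_ : MapsTo γ (Icc 0 L) D) (_ : γ 0 = x) (_ : γ L = y),
    ∫⁻ s in Icc 0 L, (Metric.infEDist (γ s) (frontier D))⁻¹

/-- The bounded region `B(0, R) ∩ Ω`, as a subset of the plane. -/
def truncation (Ω : Set Sphere) (R : ℝ) : Set ℂ :=
  Metric.ball 0 R ∩ (fun z : ℂ => (z : Sphere)) ⁻¹' Ω

/-- The quasihyperbolic condition, for a domain `Ω` containing `∞`: for some ball `B(0, R)`
containing the complement of `Ω` and some `x₀ ∈ D = B(0, R) ∩ Ω`, the function `k_D(·, x₀)` is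
square integrable on `D`. -/
def QuasihyperbolicCondition (Ω : Set Sphere) : Prop :=
  ∃ (R : ℝ) (x₀ : ℂ),
    Ωᶜ ⊆ (fun z : ℂ => (z : Sphere)) '' Metric.ball 0 R ∧
    x₀ ∈ truncation Ω R ∧
    ∫⁻ x in truncation Ω R, quasihyperbolicDist (truncation Ω R) x x₀ ^ 2 < ⊤

/-- A measurable planar set `B` is `c`-fat if `Area (B ∩ B(z, r)) ≥ c r ^ 2` for all `z ∈ B` and
`0 < r ≤ diam B`. In particular a one-point set is `c`-fat. -/
def IsFat (c : ℝ) (B : Set ℂ) : Prop :=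
  MeasurableSet B ∧ ∀ z ∈ B, ∀ r : ℝ, 0 < r → ENNReal.ofReal r ≤ Metric.ediam B →
    ENNReal.ofReal (c * r ^ 2) ≤ volume (B ∩ Metric.ball z r)

/-- The complementary components of `Ω` (a domain containing `∞`) are uniformly fat. -/
def HasUniformlyFatComplement (Ω : Set Sphere) : Prop :=
  ∃ c : ℝ, 0 < c ∧ ∀ B, IsComponentOf B Ωᶜ → IsFat c ((fun z : ℂ => (z : Sphere)) ⁻¹' B)

/-- The Euclidean open `ε`-neighbourhood of a set `E` of finite points. -/
def openNeighbourhood (ε : ℝ) (E : Set Sphere) : Set Sphere :=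
  (fun z : ℂ => (z : Sphere)) '' Metric.thickening ε ((fun z : ℂ => (z : Sphere)) ⁻¹' E)

/-- The cluster set of `f` at `E` with respect to `Ω`. -/
def clusterSet (f : Sphere → Sphere) (Ω E : Set Sphere) : Set Sphere :=
  ⋂ (ε : ℝ) (_ : 0 < ε), closure (f '' (openNeighbourhood ε E ∩ Ω))

/-- The boundary correspondence `f^*(b) = b'`: `b` and `b'` are boundary components of `Ω` and
`Ω'`, and `f (z n)` accumulates at `b'` whenever the sequence `z n` in `Ω` accumulates at `b`. -/
structure BoundaryCorrespondence (f : Sphere → Sphere) (Ω Ω' b b' : Set Sphere) : Prop where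
  source : IsComponentOf b (frontier Ω)
  target : IsComponentOf b' (frontier Ω')
  accumulates : ∀ z : ℕ → Sphere, (∀ n, z n ∈ Ω) →
    Tendsto z atTop (𝓝ˢ b) → Tendsto (fun n => f (z n)) atTop (𝓝ˢ b')

end CircleDomain

/-!
Working in the plane, let `U` and `U'` be the finite parts of `Ω` and `Ω'`, and `F : U → U'` the
conformal map. It extends to a bijection `q ↦ K q` between the components of the complements
(`ProperHomeo.exists_component`, `ProperHomeo.component_injective`): values of `F` near `q`
accumulate only at `K q`. For a circle domain every `q` is a closed disk or a point
(`exists_component_eq_closedBall`). Both facts rest on the unicoherence of the plane, which is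
proved by lifting circle-valued maps.

Suppose that the cluster set at a continuum `E` in the boundary is a single point `w`. Then `E` is
an arc of the boundary circle of a disk `q₀`, the map `F` tends to `w` along `E`, and `w ∈ K q₀`.
Consider the parallel rays that leave `q₀` at the points of a part of `E` with a projection of
positive length (`exists_projection_pos`). Along such a ray the distance from `w` goes from `0` to
`∞`, so by connectedness every value in `(r / 2, r)` is attained on the image of the ray in `U`, or
on one of the sets `K q` with `q ≠ q₀` met by the ray (`IsComponentMap.exists_mem_ray`). The latter
are of two types.

* If `K q` has more than one point, it is fat, and the measure `m q` of the set of distances it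
  contributes satisfies `∑ (m q) ^ 2 ≤ C r ^ 2`, since the sets `K q` are disjoint.
* If `K q` is a point, it is a limit of `F` at a boundary point on the ray. On almost every line the
  set of distances from `w` of such limits is null (`ae_volume_boundary_limits_eq_zero`). This is
  the only use of the quasihyperbolic condition. A maximal Whitney-separated net is made into a
  forest, the parent of a node being a nearby node at a smaller quasihyperbolic distance from the
  base point (`exists_forest`). Square integrability of `k_D` and a Hardy inequality on the forest
  (`exists_path_bound`) bound the sum of the squares of the diameters of the shadows of the nodes,
  while the squares of the increments of `F` along the edges have a sum bounded by the area of the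
  image. Since `2ab ≤ a ^ 2 + b ^ 2`, on almost every line the increments over the shadows meeting
  the line are summable, and the limits along the branches staying in such a family of nodes form a
  set of linear measure zero (`volume_image_branch_limits`).

Integrating over the rays, with the length–area inequality for `|F'|` and the Cauchy–Schwarz
inequality for `∑ diam q * m q`, bounds the projection of `E` by quantities depending on the area
of `F⁻¹ (B(w, r))` and of the disks `q ≠ q₀` for which `K q` meets `B(w, r)`
(`IsComponentMap.volume_le`). Both areas tend to zero with `r`, because `w ∈ K q₀`, a contradiction
(`IsComponentMap.volume_eq_zero`). The statement about `f^*` follows, since the cluster set at `b`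
is contained in `f^*(b)`.
-/

namespace CircleDomain

/-! ### Unicoherence of the plane -/

/-- Every continuous map from the plane to the circle has a continuous real logarithm. -/
theorem exists_continuous_circle_lift {g : ℂ → Circle} (hg : Continuous g) :
    ∃ θ : ℂ → ℝ, Continuous θ ∧ ∀ z, Circle.exp (θ z) = g z := by
  obtain ⟨e, he⟩ := Circle.exp_surjective (g 0)
  obtain ⟨F, ⟨-, hF⟩, -⟩ :=
    Circle.isCoveringMap_exp.existsUnique_continuousMap_lifts (⟨g, hg⟩ : C(ℂ, Circle)) 0 e he
  exact ⟨F, F.continuous, fun z => congrFun hF z⟩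

/-- A continuous function on a connected set is constant if its values are multiples of `2π`. -/
theorem eq_of_circle_exp_eq_one {A : Set ℂ} (hA : IsPreconnected A) {φ : ℂ → ℝ}
    (hφ : ContinuousOn φ A) (h1 : ∀ z ∈ A, Circle.exp (φ z) = 1) {x y : ℂ} (hx : x ∈ A)
    (hy : y ∈ A) : φ x = φ y := by
  by_contra hne
  wlog hlt : φ x < φ y generalizing x y
  · exact this hy hx (Ne.symm hne) (lt_of_le_of_ne (not_lt.1 hlt) (Ne.symm hne))
  have key : ∀ z ∈ A, ∃ m : ℤ, φ z = m * (2 * Real.pi) := by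
    intro z hz
    have := h1 z hz
    rw [← Circle.exp_zero, Circle.exp_eq_exp] at this
    simpa using this
  obtain ⟨m, hm⟩ := key x hx
  obtain ⟨n, hn⟩ := key y hy
  have hpi := Real.pi_pos
  have hmn : m + 1 ≤ n := by
    have : (m : ℝ) < n := by
      rw [hm, hn] at hlt
      exact lt_of_mul_lt_mul_right hlt (by positivity)
    exact_mod_cast this
  have hmn' : (m : ℝ) + 1 ≤ n := by exact_mod_cast hmn
  have hmem : φ x + Real.pi ∈ φ '' A :=
    (hA.image φ hφ).ordConnected.out (mem_image_of_mem _ hx) (mem_image_of_mem _ hy)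
      ⟨by linarith, by rw [hm, hn]; nlinarith⟩
  obtain ⟨z, hz, hzz⟩ := hmem
  obtain ⟨k, hk⟩ := key z hz
  rw [hk, hm] at hzz
  have h2 : (2 * k : ℝ) = 2 * m + 1 := by
    have : (2 * k - (2 * m + 1) : ℝ) * Real.pi = 0 := by linarith
    rcases mul_eq_zero.1 this with h | h
    · linarith
    · exact absurd h hpi.ne'
  have h3 : 2 * k = 2 * m + 1 := by exact_mod_cast h2
  omega

/-- Two local logarithms of a globally defined circle-valued map, defined on connected sets, have
the same difference at any two common points. -/
theorem sub_eq_sub_of_circle_exp {g : ℂ → Circle} (hg : Continuous g) {A B : Set ℂ}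
    (hA : IsPreconnected A) (hB : IsPreconnected B) {α β : ℂ → ℝ} (hα : ContinuousOn α A)
    (hβ : ContinuousOn β B) (hαg : ∀ z ∈ A, Circle.exp (α z) = g z)
    (hβg : ∀ z ∈ B, Circle.exp (β z) = g z) {x y : ℂ} (hx : x ∈ A ∩ B) (hy : y ∈ A ∩ B) :
    α x - β x = α y - β y := by
  obtain ⟨θ, hθ, hθg⟩ := exists_continuous_circle_lift hg
  have h1 := eq_of_circle_exp_eq_one hA (φ := fun z => θ z - α z) (hθ.continuousOn.sub hα)
    (fun z hz => by rw [Circle.exp_sub, hθg, hαg z hz, div_self']) hx.1 hy.1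
  have h2 := eq_of_circle_exp_eq_one hB (φ := fun z => θ z - β z) (hθ.continuousOn.sub hβ)
    (fun z hz => by rw [Circle.exp_sub, hθg, hβg z hz, div_self']) hx.2 hy.2
  linarith

theorem circle_exp_neg_pi : Circle.exp (-Real.pi) = Circle.exp Real.pi :=
  Circle.exp_eq_exp.2 ⟨-1, by push_cast; ring⟩

/-- Unicoherence of the plane, for closed sets. -/
theorem isPreconnected_inter_of_isClosed {A B : Set ℂ} (hA : IsClosed A) (hB : IsClosed B)
    (hAc : IsPreconnected A) (hBc : IsPreconnected B) (hAB : A ∪ B = univ) :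
    IsPreconnected (A ∩ B) := by
  classical
  rw [isPreconnected_iff_subset_of_fully_disjoint_closed (hA.inter hB)]
  intro P Q hP hQ hPQ hdisj
  by_contra hcon
  push Not at hcon
  obtain ⟨x, hx, hxP⟩ := not_subset.1 hcon.1
  obtain ⟨y, hy, hyQ⟩ := not_subset.1 hcon.2
  have hxQ : x ∈ Q := (hPQ hx).resolve_left hxP
  have hyP : y ∈ P := (hPQ hy).resolve_right hyQ
  obtain ⟨lam, h0, h1, -⟩ := exists_continuous_zero_one_of_isClosed hP hQ hdisj
  -- If `A ∩ B` splits into `P` and `Q`, take `lam = 0` on `P` and `lam = 1` on `Q`: the maps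
  -- `exp (iπ lam)` on `A` and `exp (-iπ lam)` on `B` agree on `A ∩ B`, and their logarithms `π lam`
  -- and `-π lam` have the difference `0` on `P` and `2π` on `Q`.
  have hglue : Continuous (A.piecewise (fun z => Circle.exp (Real.pi * lam z))
      (fun z => Circle.exp (-(Real.pi * lam z)))) := by
    have hc1 : Continuous fun z => Circle.exp (Real.pi * lam z) := by fun_prop
    have hc2 : Continuous fun z => Circle.exp (-(Real.pi * lam z)) := by fun_prop
    refine continuous_piecewise ?_ hc1.continuousOn hc2.continuousOn
    intro z hz
    have hzA : z ∈ A := hA.frontier_subset hz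
    have hzB : z ∈ B := by
      have : Aᶜ ⊆ B := fun t ht => ((hAB ▸ mem_univ t : t ∈ A ∪ B)).resolve_left ht
      exact closure_minimal this hB (frontier_subset_closure (frontier_compl A ▸ hz))
    rcases hPQ ⟨hzA, hzB⟩ with h | h
    · simp [h0 h]
    · have : lam z = 1 := h1 h
      simp only [this, mul_one, circle_exp_neg_pi]
  have := sub_eq_sub_of_circle_exp hglue hAc hBc (α := fun z => Real.pi * lam z)
    (β := fun z => -(Real.pi * lam z)) (by fun_prop) (by fun_prop)
    (fun z hz => by simp [hz]) (fun z hz => by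
      by_cases hzA : z ∈ A
      · rcases hPQ ⟨hzA, hz⟩ with h | h
        · simp [h0 h, hzA]
        · have : lam z = 1 := h1 h
          simp only [this, mul_one, circle_exp_neg_pi, hzA, piecewise_eq_of_mem]
      · simp [hzA]) hx hy
  have hl1 : lam x = 1 := h1 hxQ
  have hl0 : lam y = 0 := h0 hyP
  simp only [hl1, hl0] at this
  linarith [Real.pi_pos]

/-- Unicoherence of the plane, for open sets. -/
theorem isPreconnected_inter_of_isOpen {A B : Set ℂ} (hA : IsOpen A) (hB : IsOpen B)
    (hAc : IsPreconnected A) (hBc : IsPreconnected B) (hAB : A ∪ B = univ) :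
    IsPreconnected (A ∩ B) := by
  classical
  rw [isPreconnected_iff_subset_of_disjoint]
  intro P' Q' hP' hQ' hPQ' hdisj'
  by_contra hcon
  push Not at hcon
  obtain ⟨x, hx, hxP⟩ := not_subset.1 hcon.1
  obtain ⟨y, hy, hyQ⟩ := not_subset.1 hcon.2
  set Q := A ∩ B ∩ Q' with hQdef
  have hQo : IsOpen Q := (hA.inter hB).inter hQ'
  have hPo : IsOpen (A ∩ B ∩ P') := (hA.inter hB).inter hP'
  have hxQ : x ∈ Q := ⟨hx, (hPQ' hx).resolve_left hxP⟩
  have hyQ : y ∉ Q := fun h => hyQ h.2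
  -- frontier points of `Q` are outside `A ∩ B`
  have hfr : ∀ z ∈ frontier Q, z ∉ A ∩ B := by
    intro z hz hzAB
    rcases hPQ' hzAB with h | h
    · have hzc : z ∈ closure Q := frontier_subset_closure hz
      obtain ⟨t, ht1, ht2⟩ := mem_closure_iff.1 hzc _ hPo ⟨hzAB, h⟩
      have : t ∈ A ∩ B ∩ (P' ∩ Q') := ⟨ht1.1, ht1.2, ht2.2⟩
      rw [hdisj'] at this
      exact this
    · have : z ∈ Q ∩ frontier Q := ⟨⟨hzAB, h⟩, hz⟩
      rw [hQo.inter_frontier_eq] at this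
      exact this
  have hdisj : Disjoint Bᶜ Aᶜ := by
    rw [disjoint_left]
    intro z h1 h2
    exact (hAB ▸ mem_univ z : z ∈ A ∪ B).elim h2 h1
  obtain ⟨lam, h0, h1, -⟩ :=
    exists_continuous_zero_one_of_isClosed hB.isClosed_compl hA.isClosed_compl hdisj
  -- With `lam = 0` off `B` and `lam = 1` off `A`, the map equal to `exp (2πi lam)` on `Q` and to `1`
  -- elsewhere is continuous. Its logarithms on `A` and `B` below differ by `2π` on `Q` and by `0` on
  -- the rest of `A ∩ B`.
  have hg : Continuous (Q.piecewise (fun z => Circle.exp (2 * Real.pi * lam z)) fun _ => 1) := by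
    have hc1 : Continuous fun z => Circle.exp (2 * Real.pi * lam z) := by fun_prop
    refine continuous_piecewise ?_ hc1.continuousOn continuousOn_const
    intro z hz
    by_cases hzA : z ∈ A
    · have : lam z = 0 := h0 (fun hzB => hfr z hz ⟨hzA, hzB⟩)
      simp [this]
    · have : lam z = 1 := h1 hzA
      simp [this]
  have hα : ContinuousOn (Q.piecewise (fun z => 2 * Real.pi * lam z) fun _ => 0) A := by
    have hc1 : Continuous fun z => 2 * Real.pi * lam z := by fun_prop
    refine ContinuousOn.piecewise ?_ hc1.continuousOn continuousOn_const
    intro z hz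
    have : lam z = 0 := h0 (fun hzB => hfr z hz.2 ⟨hz.1, hzB⟩)
    simp [this]
  have hβ : ContinuousOn (Q.piecewise (fun z => 2 * Real.pi * (lam z - 1)) fun _ => 0) B := by
    have hc1 : Continuous fun z => 2 * Real.pi * (lam z - 1) := by fun_prop
    refine ContinuousOn.piecewise ?_ hc1.continuousOn continuousOn_const
    intro z hz
    have : lam z = 1 := h1 (fun hzA => hfr z hz.2 ⟨hzA, hz.1⟩)
    simp [this]
  have := sub_eq_sub_of_circle_exp hg hAc hBc hα hβ
    (fun z _ => by by_cases hz : z ∈ Q <;> simp [hz])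
    (fun z _ => by
      by_cases hz : z ∈ Q
      · simp [hz, mul_sub, Circle.exp_sub]
      · simp [hz]) hx hy
  simp only [hxQ, hyQ, piecewise_eq_of_mem, piecewise_eq_of_notMem, not_false_eq_true] at this
  linarith [Real.pi_pos]

/-! ### Components of compact plane sets -/

/-- A component of a compact set has arbitrarily small relatively clopen neighbourhoods. -/
theorem exists_clopen_split {F V : Set ℂ} (hF : IsCompact F) {y : ℂ} (hy : y ∈ F)
    (hV : IsOpen V) (hyV : connectedComponentIn F y ⊆ V) :
    ∃ G₁ G₂ : Set ℂ, IsCompact G₁ ∧ IsCompact G₂ ∧ Disjoint G₁ G₂ ∧ G₁ ∪ G₂ = F ∧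
      connectedComponentIn F y ⊆ G₁ ∧ G₁ ⊆ V := by
  have : CompactSpace F := isCompact_iff_compactSpace.1 hF
  rw [connectedComponentIn_eq_image hy] at hyV ⊢
  have hsub : connectedComponent (⟨y, hy⟩ : F) ⊆ Subtype.val ⁻¹' V := image_subset_iff.1 hyV
  have hVo : IsOpen (Subtype.val ⁻¹' V : Set F) := hV.preimage continuous_subtype_val
  rw [connectedComponent_eq_iInter_isClopen] at hsub
  have : Nonempty { s : Set F // IsClopen s ∧ (⟨y, hy⟩ : F) ∈ s } :=
    ⟨⟨univ, isClopen_univ, mem_univ _⟩⟩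
  obtain ⟨⟨Z, hZ, hyZ⟩, hZV⟩ := exists_subset_nhds_of_isCompact'
    (V := fun s : { s : Set F // IsClopen s ∧ (⟨y, hy⟩ : F) ∈ s } => (s : Set F))
    (hV := by
      rintro ⟨s, hs, hs'⟩ ⟨t, ht, ht'⟩
      exact ⟨⟨s ∩ t, hs.inter ht, hs', ht'⟩, inter_subset_left, inter_subset_right⟩)
    (hV_cpct := fun s => s.2.1.isClosed.isCompact) (hV_closed := fun s => s.2.1.isClosed)
    (hU := fun x hx => hVo.mem_nhds (hsub hx))
  refine ⟨Subtype.val '' Z, Subtype.val '' Zᶜ, hZ.isClosed.isCompact.image continuous_subtype_val,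
    hZ.compl.isClosed.isCompact.image continuous_subtype_val,
    (disjoint_image_iff Subtype.val_injective).2 disjoint_compl_right, ?_, ?_, ?_⟩
  · rw [← image_union, union_compl_self, image_univ, Subtype.range_coe]
  · exact image_mono (hZ.connectedComponent_subset hyZ)
  · exact image_subset_iff.2 hZV

/-- A compact subset of a plane domain lies in a compact connected subset of the domain. -/
theorem exists_compact_connected_superset {U C : Set ℂ} (hU : IsOpen U) (hUc : IsConnected U)
    (hC : IsCompact C) (hCU : C ⊆ U) :
    ∃ C', IsCompact C' ∧ IsConnected C' ∧ C ⊆ C' ∧ C' ⊆ U := by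
  have hpath := hU.isConnected_iff_isPathConnected.1 hUc
  obtain ⟨x₀, hx₀, hjoin⟩ := hpath
  have hball : ∀ x ∈ C, ∃ r : ℝ, 0 < r ∧ Metric.closedBall x r ⊆ U := fun x hx =>
    Metric.nhds_basis_closedBall.mem_iff.1 (hU.mem_nhds (hCU hx))
  choose! r hr hrU using hball
  obtain ⟨t, ht⟩ := hC.elim_nhds_subcover' (fun x _ => Metric.closedBall x (r x))
    (fun x hx => Metric.closedBall_mem_nhds x (hr x hx))
  have hγ : ∀ x : C, ∃ K : Set ℂ, IsCompact K ∧ IsPreconnected K ∧ x₀ ∈ K ∧ (x : ℂ) ∈ K ∧ K ⊆ U := by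
    intro x
    have hj := hjoin (hCU x.2)
    refine ⟨range hj.somePath, isCompact_range hj.somePath.continuous,
      isPreconnected_range hj.somePath.continuous, ⟨0, by simp⟩, ⟨1, by simp⟩, ?_⟩
    rintro _ ⟨s, rfl⟩
    exact hj.somePath_mem s
  choose K hKc hKp hK0 hKx hKU using hγ
  refine ⟨{x₀} ∪ ⋃ x ∈ t, (Metric.closedBall (x : ℂ) (r x) ∪ K x), ?_, ⟨⟨x₀, by simp⟩, ?_⟩, ?_, ?_⟩
  · exact isCompact_singleton.union (t.isCompact_biUnion fun x _ =>
      (isCompact_closedBall _ _).union (hKc x))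
  · have : ({x₀} ∪ ⋃ x ∈ t, (Metric.closedBall (x : ℂ) (r x) ∪ K x)) =
        ⋃₀ (insert {x₀} ((fun x : C => Metric.closedBall (x : ℂ) (r x) ∪ K x) '' t)) := by
      rw [sUnion_insert, sUnion_image]
      rfl
    rw [this]
    refine isPreconnected_sUnion x₀ _ ?_ ?_
    · rintro s (rfl | ⟨x, -, rfl⟩)
      · exact mem_singleton _
      · exact Or.inr (hK0 x)
    · rintro s (rfl | ⟨x, -, rfl⟩)
      · exact isPreconnected_singleton
      · exact IsPreconnected.union (x : ℂ) (Metric.mem_closedBall_self (hr x x.2).le) (hKx x)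
          (Metric.isPreconnected_closedBall) (hKp x)
  · refine ht.trans (subset_union_of_subset_right ?_ _)
    exact iUnion₂_mono fun x _ => subset_union_left
  · refine union_subset (singleton_subset_iff.2 hx₀) (iUnion₂_subset fun x _ => ?_)
    exact union_subset (hrU x x.2) (hKU x)

/-- The complement of a component `W` of the complement of a compact connected set is
connected. -/
theorem isPreconnected_compl_component {C : Set ℂ} (hC : IsClosed C) (hCc : IsConnected C) {x : ℂ} :
    IsPreconnected (connectedComponentIn Cᶜ x)ᶜ := by
  have key : (connectedComponentIn Cᶜ x)ᶜ =
      C ∪ ⋃ y ∈ Cᶜ \ connectedComponentIn Cᶜ x, (C ∪ connectedComponentIn Cᶜ y) := by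
    ext z
    constructor
    · intro hz
      by_cases hzC : z ∈ C
      · exact Or.inl hzC
      · exact Or.inr (mem_iUnion₂.2 ⟨z, ⟨hzC, hz⟩, Or.inr (mem_connectedComponentIn hzC)⟩)
    · rintro (hz | hz)
      · exact fun h => connectedComponentIn_subset _ _ h hz
      · obtain ⟨y, ⟨hyC, hyx⟩, hz⟩ := mem_iUnion₂.1 hz
        rcases hz with hz | hz
        · exact fun h => connectedComponentIn_subset _ _ h hz
        · intro h
          have e1 := connectedComponentIn_eq h
          have e2 := connectedComponentIn_eq hz
          exact hyx (by rw [e1, ← e2]; exact mem_connectedComponentIn hyC)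
  obtain ⟨c, hc⟩ := hCc.nonempty
  rw [key]
  have hun : C ∪ ⋃ y ∈ Cᶜ \ connectedComponentIn Cᶜ x, (C ∪ connectedComponentIn Cᶜ y) =
      ⋃₀ (insert C ((fun y => C ∪ connectedComponentIn Cᶜ y) ''
        (Cᶜ \ connectedComponentIn Cᶜ x))) := by
    rw [sUnion_insert, sUnion_image]
  rw [hun]
  refine isPreconnected_sUnion c _ ?_ ?_
  · rintro s (rfl | ⟨y, -, rfl⟩)
    · exact hc
    · exact Or.inl hc
  · rintro s (rfl | ⟨y, hy, rfl⟩)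
    · exact hCc.isPreconnected
    · -- the closure of the component of `y` meets `C`, since the plane is connected
      have hne : (frontier (connectedComponentIn Cᶜ y)).Nonempty := by
        rw [nonempty_frontier_iff]
        exact ⟨⟨y, mem_connectedComponentIn hy.1⟩, fun h =>
          connectedComponentIn_subset Cᶜ y (h ▸ mem_univ c) hc⟩
      obtain ⟨z, hz⟩ := hne
      have hWo : IsOpen (connectedComponentIn Cᶜ y) := hC.isOpen_compl.connectedComponentIn
      have hzcl : z ∈ closure (connectedComponentIn Cᶜ y) := frontier_subset_closure hz
      have hpre : IsPreconnected (insert z (connectedComponentIn Cᶜ y)) :=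
        isPreconnected_connectedComponentIn.subset_closure (subset_insert _ _)
          (insert_subset hzcl subset_closure)
      have hzC : z ∈ C := by
        by_contra hzC
        have : insert z (connectedComponentIn Cᶜ y) ⊆ connectedComponentIn Cᶜ y :=
          hpre.subset_connectedComponentIn (mem_insert_of_mem _ (mem_connectedComponentIn hy.1))
            (insert_subset hzC (connectedComponentIn_subset _ _))
        have hmem : z ∈ connectedComponentIn Cᶜ y ∩ frontier (connectedComponentIn Cᶜ y) :=
          ⟨this (mem_insert _ _), hz⟩
        rw [hWo.inter_frontier_eq] at hmem
        exact hmem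
      have heq : C ∪ connectedComponentIn Cᶜ y = C ∪ insert z (connectedComponentIn Cᶜ y) := by
        rw [insert_eq, ← union_assoc, union_eq_self_of_subset_right (singleton_subset_iff.2 hzC)]
      simp only
      rw [heq]
      exact IsPreconnected.union z hzC (mem_insert _ _) hCc.isPreconnected hpre


theorem isClosed_connectedComponentIn {F : Set ℂ} (hF : IsClosed F) (x : ℂ) :
    IsClosed (connectedComponentIn F x) := by
  by_cases hx : x ∈ F
  · refine isClosed_of_closure_subset ?_
    refine (isPreconnected_connectedComponentIn.closure).subset_connectedComponentIn
      (subset_closure (mem_connectedComponentIn hx))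
      (closure_minimal (connectedComponentIn_subset _ _) hF)
  · rw [connectedComponentIn_eq_empty hx]
    exact isClosed_empty

theorem frontier_component_subset {U : Set ℂ} (hU : IsOpen U) (x : ℂ) :
    frontier (connectedComponentIn Uᶜ x) ⊆ frontier U := by
  intro z hz
  have hzq : z ∈ connectedComponentIn Uᶜ x :=
    (isClosed_connectedComponentIn hU.isClosed_compl x).frontier_subset hz
  have hzU : z ∉ U := connectedComponentIn_subset _ _ hzq
  rw [hU.frontier_eq]
  refine ⟨?_, hzU⟩
  by_contra hcl
  rw [mem_closure_iff_nhds_basis Metric.nhds_basis_ball] at hcl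
  push Not at hcl
  obtain ⟨ε, hε, hball⟩ := hcl
  have hsub : Metric.ball z ε ⊆ connectedComponentIn Uᶜ x := by
    rw [connectedComponentIn_eq hzq]
    exact Metric.isPreconnected_ball.subset_connectedComponentIn (Metric.mem_ball_self hε)
      fun t ht htU => hball t htU ht
  exact hz.2 (mem_interior.2 ⟨_, hsub, Metric.isOpen_ball, Metric.mem_ball_self hε⟩)

theorem frontier_nonempty_of_isCompact {q : Set ℂ} (hq : IsCompact q) (hne : q.Nonempty) :
    (frontier q).Nonempty :=
  nonempty_frontier_iff.2 ⟨hne, hq.ne_univ⟩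

/-- A homeomorphism `f` with inverse `g` between two plane domains with bounded complements, which
preserves the end at infinity. -/
structure ProperHomeo (f g : ℂ → ℂ) (U U' : Set ℂ) : Prop where
  isOpen_left : IsOpen U
  isOpen_right : IsOpen U'
  isConnected_left : IsConnected U
  isConnected_right : IsConnected U'
  compl_left : Bornology.IsBounded Uᶜ
  compl_right : Bornology.IsBounded U'ᶜ
  continuousOn_left : ContinuousOn f U
  continuousOn_right : ContinuousOn g U'
  mapsTo_left : MapsTo f U U'
  mapsTo_right : MapsTo g U' U
  leftInv : ∀ z ∈ U, g (f z) = z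
  rightInv : ∀ z ∈ U', f (g z) = z
  bounded_left : ∀ B, Bornology.IsBounded B → Bornology.IsBounded (f '' (B ∩ U))
  bounded_right : ∀ B, Bornology.IsBounded B → Bornology.IsBounded (g '' (B ∩ U'))

namespace ProperHomeo

variable {f g : ℂ → ℂ} {U U' : Set ℂ}

theorem symm (h : ProperHomeo f g U U') : ProperHomeo g f U' U :=
  ⟨h.2, h.1, h.4, h.3, h.6, h.5, h.8, h.7, h.10, h.9, h.12, h.11, h.14, h.13⟩

theorem isCompact_compl (h : ProperHomeo f g U U') : IsCompact Uᶜ :=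
  Metric.isCompact_of_isClosed_isBounded h.isOpen_left.isClosed_compl h.compl_left

theorem isCompact_component (h : ProperHomeo f g U U') (x : ℂ) :
    IsCompact (connectedComponentIn Uᶜ x) :=
  h.isCompact_compl.of_isClosed_subset
    (isClosed_connectedComponentIn h.isOpen_left.isClosed_compl x) (connectedComponentIn_subset _ _)

/-- A proper homeomorphism of plane domains maps the points near a component of the complement of
the source to points near a single component of the complement of the target. -/
theorem exists_component (h : ProperHomeo f g U U') {x : ℂ} (hx : x ∉ U) :
    ∃ y, y ∉ U' ∧ ∀ V, IsOpen V → connectedComponentIn U'ᶜ y ⊆ V →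
      ∃ N, IsOpen N ∧ connectedComponentIn Uᶜ x ⊆ N ∧ MapsTo f (N ∩ U) V := by
  have hq := h.isCompact_component x
  obtain ⟨z, hz⟩ := frontier_nonempty_of_isCompact hq ⟨x, mem_connectedComponentIn hx⟩
  have hzq : z ∈ connectedComponentIn Uᶜ x := hq.isClosed.frontier_subset hz
  have hzU : z ∉ U := connectedComponentIn_subset _ _ hzq
  have hzfr := frontier_component_subset h.isOpen_left x hz
  have : (𝓝[U] z).NeBot := mem_closure_iff_nhdsWithin_neBot.1 (frontier_subset_closure hzfr)
  have hbd := h.bounded_left _ (Metric.isBounded_ball (x := z) (r := 1))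
  obtain ⟨y, -, hy⟩ := (hbd.isCompact_closure).exists_mapClusterPt (f := 𝓝[U] z) (u := f) (by
    rw [le_principal_iff, mem_map]
    filter_upwards [self_mem_nhdsWithin, nhdsWithin_le_nhds (Metric.ball_mem_nhds z one_pos)]
      with t ht1 ht2
    exact subset_closure (mem_image_of_mem f ⟨ht2, ht1⟩))
  have hyU' : y ∉ U' := by
    intro hyU'
    have hc : ContinuousAt g y := h.continuousOn_right.continuousAt (h.isOpen_right.mem_nhds hyU')
    have h1 : MapClusterPt (g y) (𝓝[U] z) (g ∘ f) := hy.continuousAt_comp hc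
    have h2 : Tendsto (g ∘ f) (𝓝[U] z) (𝓝 z) := by
      have : (g ∘ f) =ᶠ[𝓝[U] z] id := by
        filter_upwards [self_mem_nhdsWithin] with t ht using h.leftInv t ht
      exact (tendsto_congr' this).2 (tendsto_id.mono_left nhdsWithin_le_nhds)
    have h3 : g y = z := by
      have : ClusterPt (g y) (𝓝 z) := h1.clusterPt.mono h2
      exact (eq_of_nhds_neBot this)
    exact hzU (h3 ▸ h.mapsTo_right hyU')
  refine ⟨y, hyU', fun V hV hyV => ?_⟩
  obtain ⟨G₁, G₂, hG₁, hG₂, hdisj, hunion, hyG₁, hG₁V⟩ :=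
    exists_clopen_split h.symm.isCompact_compl (mem_compl hyU') hV hyV
  obtain ⟨V₁', V₂', hV₁', hV₂', hGV₁, hGV₂, hVd⟩ := SeparatedNhds.of_isCompact_isCompact hG₁ hG₂ hdisj
  obtain ⟨R, hR⟩ := (Metric.isBounded_iff_subset_ball 0).1 h.compl_right
  set V₁ := V₁' ∩ V ∩ Metric.ball 0 R
  set V₂ := V₂' ∪ (Metric.closedBall 0 R)ᶜ
  have hV₁ : IsOpen V₁ := (hV₁'.inter hV).inter Metric.isOpen_ball
  have hV₂ : IsOpen V₂ := hV₂'.union Metric.isClosed_closedBall.isOpen_compl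
  have hV₁₂ : Disjoint V₁ V₂ := by
    rw [disjoint_left]
    rintro t ⟨⟨ht1, -⟩, ht2⟩ (ht | ht)
    · exact disjoint_left.1 hVd ht1 ht
    · exact ht (Metric.ball_subset_closedBall ht2)
  have hcov : U'ᶜ ⊆ V₁ ∪ V₂ := by
    intro t ht
    rcases (hunion ▸ ht : t ∈ G₁ ∪ G₂) with h' | h'
    · exact Or.inl ⟨⟨hGV₁ h', hG₁V h'⟩, hR ht⟩
    · exact Or.inr (Or.inl (hGV₂ h'))
  -- a compact set separating the two parts of the complement
  set C₁ := (V₁ ∪ V₂)ᶜ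
  have hC₁cl : IsClosed C₁ := (hV₁.union hV₂).isClosed_compl
  have hC₁U' : C₁ ⊆ U' := compl_subset_comm.1 hcov
  have hC₁ : IsCompact C₁ := by
    refine (isCompact_closedBall (0 : ℂ) R).of_isClosed_subset hC₁cl ?_
    intro t ht
    by_contra h'
    exact ht (Or.inr (Or.inr h'))
  obtain ⟨C, hC, hCc, hgC, hCU⟩ := exists_compact_connected_superset h.isOpen_left
    h.isConnected_left (hC₁.image_of_continuousOn (h.continuousOn_right.mono hC₁U'))
    ((h.mapsTo_right.mono_left hC₁U').image_subset)
  -- `W` contains the component of `x` and avoids `C ⊇ g '' C₁`, so `f` maps `W ∩ U` into `V₁ ∪ V₂`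
  have hqC : connectedComponentIn Uᶜ x ⊆ Cᶜ := fun t ht htC =>
    connectedComponentIn_subset _ _ ht (hCU htC)
  have hxC : x ∈ Cᶜ := fun h' => hx (hCU h')
  set W := connectedComponentIn Cᶜ x with hW
  have hWo : IsOpen W := hC.isClosed.isOpen_compl.connectedComponentIn
  have hqW : connectedComponentIn Uᶜ x ⊆ W :=
    isPreconnected_connectedComponentIn.subset_connectedComponentIn (mem_connectedComponentIn hx) hqC
  -- the part of the component `W` inside `U` is connected, by unicoherence of the plane
  have hWU : IsPreconnected (W ∩ U) := by
    have hfrW : closure W ⊆ W ∪ U := by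
      intro t ht
      by_cases htC : t ∈ C
      · exact Or.inr (hCU htC)
      · left
        have hpre : IsPreconnected (insert t W) :=
          isPreconnected_connectedComponentIn.subset_closure (subset_insert _ _)
            (insert_subset ht subset_closure)
        exact hpre.subset_connectedComponentIn (mem_insert_of_mem _ (mem_connectedComponentIn hxC))
          (insert_subset htC (connectedComponentIn_subset _ _)) (mem_insert _ _)
    have hBo : IsOpen (Wᶜ ∪ U) := by
      have : Wᶜ ∪ U = (closure W)ᶜ ∪ U := by
        ext t
        constructor
        · rintro (ht | ht)
          · by_cases htU : t ∈ U
            · exact Or.inr htU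
            · exact Or.inl fun h' => (hfrW h').elim ht htU
          · exact Or.inr ht
        · rintro (ht | ht)
          · exact Or.inl fun h' => ht (subset_closure h')
          · exact Or.inr ht
      rw [this]
      exact isClosed_closure.isOpen_compl.union h.isOpen_left
    obtain ⟨c, hc⟩ := hCc.nonempty
    have hB : IsPreconnected (Wᶜ ∪ U) :=
      IsPreconnected.union c (fun h' => connectedComponentIn_subset _ _ h' hc) (hCU hc)
        (isPreconnected_compl_component hC.isClosed hCc) h.isConnected_left.isPreconnected
    have := isPreconnected_inter_of_isOpen hWo hBo isPreconnected_connectedComponentIn hB (by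
      rw [← union_assoc, union_compl_self, univ_union])
    rwa [inter_union_distrib_left, inter_compl_self, empty_union] at this
  have himg : IsPreconnected (f '' (W ∩ U)) := hWU.image f (h.continuousOn_left.mono inter_subset_right)
  have hsub : f '' (W ∩ U) ⊆ V₁ ∪ V₂ := by
    rintro _ ⟨t, ⟨htW, htU⟩, rfl⟩
    by_contra hcon
    have : t ∈ C := by
      have h1 : g (f t) ∈ g '' C₁ := mem_image_of_mem g hcon
      rw [h.leftInv t htU] at h1
      exact hgC h1
    exact connectedComponentIn_subset _ _ htW this
  have hmeet : ((f '' (W ∩ U)) ∩ V₁).Nonempty := by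
    have hyV₁ : y ∈ V₁ := by
      have h1 : y ∈ G₁ := hyG₁ (mem_connectedComponentIn hyU')
      exact ⟨⟨hGV₁ h1, hG₁V h1⟩, hR hyU'⟩
    have h1 := mapClusterPt_iff_frequently.1 hy _ (hV₁.mem_nhds hyV₁)
    have h2 : ∀ᶠ t in 𝓝[U] z, t ∈ W ∩ U := by
      filter_upwards [self_mem_nhdsWithin, nhdsWithin_le_nhds (hWo.mem_nhds (hqW hzq))]
        with t ht1 ht2 using ⟨ht2, ht1⟩
    obtain ⟨t, ht1, ht2⟩ := (h1.and_eventually h2).exists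
    exact ⟨f t, mem_image_of_mem f ht2, ht1⟩
  have hfin := himg.subset_left_of_subset_union hV₁ hV₂ hV₁₂ hsub hmeet
  exact ⟨W, hWo, hqW, fun t ht => (hfin (mem_image_of_mem f ht)).1.2⟩

/-- Distinct complementary components of the source correspond to distinct complementary components
of the target. -/
theorem component_injective (h : ProperHomeo f g U U') {x₁ x₂ y : ℂ} (hx₁ : x₁ ∉ U) (hx₂ : x₂ ∉ U)
    (hy : y ∉ U')
    (h₁ : ∀ V, IsOpen V → connectedComponentIn U'ᶜ y ⊆ V →
      ∃ N, IsOpen N ∧ connectedComponentIn Uᶜ x₁ ⊆ N ∧ MapsTo f (N ∩ U) V)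
    (h₂ : ∀ V, IsOpen V → connectedComponentIn U'ᶜ y ⊆ V →
      ∃ N, IsOpen N ∧ connectedComponentIn Uᶜ x₂ ⊆ N ∧ MapsTo f (N ∩ U) V) :
    connectedComponentIn Uᶜ x₁ = connectedComponentIn Uᶜ x₂ := by
  obtain ⟨x, hx, hgx⟩ := h.symm.exists_component hy
  have key : ∀ x', x' ∉ U → (∀ V, IsOpen V → connectedComponentIn U'ᶜ y ⊆ V →
      ∃ N, IsOpen N ∧ connectedComponentIn Uᶜ x' ⊆ N ∧ MapsTo f (N ∩ U) V) →
      connectedComponentIn Uᶜ x' = connectedComponentIn Uᶜ x := by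
    intro x' hx' h'
    by_contra hne
    have hdisj : Disjoint (connectedComponentIn Uᶜ x') (connectedComponentIn Uᶜ x) := by
      rw [disjoint_left]
      intro t ht1 ht2
      exact hne ((connectedComponentIn_eq ht1).trans (connectedComponentIn_eq ht2).symm)
    obtain ⟨O₁, O₂, hO₁, hO₂, hs₁, hs₂, hd⟩ := SeparatedNhds.of_isCompact_isCompact
      (h.isCompact_component x') (h.isCompact_component x) hdisj
    obtain ⟨M, hMo, hKM, hgM⟩ := hgx O₂ hO₂ hs₂
    obtain ⟨N, hNo, hqN, hfN⟩ := h' M hMo hKM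
    obtain ⟨z, hz⟩ := frontier_nonempty_of_isCompact (h.isCompact_component x')
      ⟨x', mem_connectedComponentIn hx'⟩
    have hzq := (h.isCompact_component x').isClosed.frontier_subset hz
    have hzcl : z ∈ closure U :=
      frontier_subset_closure (frontier_component_subset h.isOpen_left x' hz)
    obtain ⟨t, ⟨htN, htO⟩, htU⟩ :=
      mem_closure_iff.1 hzcl (N ∩ O₁) (hNo.inter hO₁) ⟨hqN hzq, hs₁ hzq⟩
    have := hgM ⟨hfN ⟨htN, htU⟩, h.mapsTo_left htU⟩
    rw [h.leftInv t htU] at this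
    exact disjoint_left.1 hd htO this
  rw [key x₁ hx₁ h₁, key x₂ hx₂ h₂]

end ProperHomeo


/-! ### Complementary components of a circle domain -/

theorem isPreconnected_compl_closedBall (a : ℂ) {r : ℝ} (hr : 0 ≤ r) :
    IsPreconnected (Metric.closedBall a r)ᶜ := by
  have h1 : IsPreconnected (Metric.sphere (0 : ℂ) 1) :=
    (isConnected_sphere (by simp) 0 zero_le_one).isPreconnected
  have h2 := (isPreconnected_Ioi (a := r)).prod h1
  have h3 := h2.image (fun p : ℝ × ℂ => a + p.1 * p.2) (by fun_prop)
  convert h3 using 1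
  ext z
  simp only [mem_compl_iff, Metric.mem_closedBall, not_le, mem_image, mem_prod, mem_Ioi,
    mem_sphere_iff_norm, sub_zero, Prod.exists]
  constructor
  · intro hz
    have hpos : (0 : ℝ) < ‖z - a‖ := by
      rw [← dist_eq_norm]
      exact hr.trans_lt hz
    have hne : ((‖z - a‖ : ℝ) : ℂ) ≠ 0 := by exact_mod_cast hpos.ne'
    refine ⟨‖z - a‖, (z - a) / ‖z - a‖, ⟨by rwa [← dist_eq_norm], ?_⟩, ?_⟩
    · rw [norm_div, Complex.norm_real, norm_norm, div_self hpos.ne']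
    · rw [mul_div_cancel₀ _ hne]
      ring
  · rintro ⟨s, v, ⟨hs, hv⟩, rfl⟩
    rw [dist_eq_norm, add_sub_cancel_left, norm_mul, hv, mul_one, Complex.norm_real]
    exact hs.trans_le (le_abs_self s)

theorem isPreconnected_union_component {U : Set ℂ} (hU : IsOpen U) (hUc : IsConnected U)
    (hb : IsCompact Uᶜ) {x : ℂ} (hx : x ∉ U) :
    IsPreconnected (U ∪ connectedComponentIn Uᶜ x) := by
  obtain ⟨z, hz⟩ := frontier_nonempty_of_isCompact
    (hb.of_isClosed_subset (isClosed_connectedComponentIn hU.isClosed_compl x)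
      (connectedComponentIn_subset _ _)) ⟨x, mem_connectedComponentIn hx⟩
  have hzq := (isClosed_connectedComponentIn hU.isClosed_compl x).frontier_subset hz
  have hzcl : z ∈ closure U := frontier_subset_closure (frontier_component_subset hU x hz)
  have hpre : IsPreconnected (insert z U) :=
    hUc.isPreconnected.subset_closure (subset_insert _ _) (insert_subset hzcl subset_closure)
  have : U ∪ connectedComponentIn Uᶜ x = insert z U ∪ connectedComponentIn Uᶜ x := by
    rw [insert_union, insert_eq_of_mem (show z ∈ U ∪ connectedComponentIn Uᶜ x from Or.inr hzq)]
  rw [this]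
  exact IsPreconnected.union z (mem_insert _ _) hzq hpre isPreconnected_connectedComponentIn

/-- A complementary component of a plane domain does not separate the plane. -/
theorem isPreconnected_compl_compl_component {U : Set ℂ} (hU : IsOpen U) (hUc : IsConnected U)
    (hb : IsCompact Uᶜ) {x : ℂ} (hx : x ∉ U) :
    IsPreconnected (connectedComponentIn Uᶜ x)ᶜ := by
  have key : (connectedComponentIn Uᶜ x)ᶜ =
      ⋃₀ (insert U ((fun y => U ∪ connectedComponentIn Uᶜ y) ''
        (Uᶜ \ connectedComponentIn Uᶜ x))) := by
    rw [sUnion_insert, sUnion_image]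
    ext z
    constructor
    · intro hz
      by_cases hzU : z ∈ U
      · exact Or.inl hzU
      · exact Or.inr (mem_iUnion₂.2 ⟨z, ⟨hzU, hz⟩, Or.inr (mem_connectedComponentIn hzU)⟩)
    · rintro (hz | hz)
      · exact fun h => connectedComponentIn_subset _ _ h hz
      · obtain ⟨y, ⟨hyC, hyx⟩, hz⟩ := mem_iUnion₂.1 hz
        rcases hz with hz | hz
        · exact fun h => connectedComponentIn_subset _ _ h hz
        · intro h
          have e1 := connectedComponentIn_eq h
          have e2 := connectedComponentIn_eq hz
          exact hyx (by rw [e1, ← e2]; exact mem_connectedComponentIn hyC)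
  obtain ⟨c, hc⟩ := hUc.nonempty
  rw [key]
  refine isPreconnected_sUnion c _ ?_ ?_
  · rintro s (rfl | ⟨y, -, rfl⟩)
    · exact hc
    · exact Or.inl hc
  · rintro s (rfl | ⟨y, hy, rfl⟩)
    · exact hUc.isPreconnected
    · exact isPreconnected_union_component hU hUc hb hy.1

/-- The boundary of a complementary component of a plane domain is connected. -/
theorem isPreconnected_frontier_component {U : Set ℂ} (hU : IsOpen U) (hUc : IsConnected U)
    (hb : IsCompact Uᶜ) {x : ℂ} (hx : x ∉ U) :
    IsPreconnected (frontier (connectedComponentIn Uᶜ x)) := by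
  have hcl := isClosed_connectedComponentIn hU.isClosed_compl x
  rw [frontier_eq_closure_inter_closure, hcl.closure_eq]
  refine isPreconnected_inter_of_isClosed hcl isClosed_closure isPreconnected_connectedComponentIn
    (isPreconnected_compl_compl_component hU hUc hb hx).closure ?_
  exact eq_univ_of_univ_subset ((union_compl_self _).symm.subset.trans
    (union_subset_union_right _ subset_closure))

theorem not_isBounded_compl_closedBall (a : ℂ) (r : ℝ) :
    ¬ Bornology.IsBounded (Metric.closedBall a r)ᶜ := fun h =>
  NormedSpace.unbounded_univ ℝ ℂ (by
    rw [← union_compl_self (Metric.closedBall a r)]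
    exact Metric.isBounded_closedBall.union h)

/-- A complementary component whose boundary component is a circle is the closed disk that it
bounds. Radius zero is allowed, the circle and the disk then being a point. -/
theorem component_eq_closedBall {U : Set ℂ} (hU : IsOpen U) (hUc : IsConnected U)
    (hb : IsCompact Uᶜ) {z a : ℂ} {r : ℝ} (hr : 0 ≤ r) (hz : z ∈ frontier U)
    (hzs : connectedComponentIn (frontier U) z = Metric.sphere a r) :
    connectedComponentIn Uᶜ z = Metric.closedBall a r := by
  have hzU : z ∉ U := (hU.frontier_eq ▸ hz : z ∈ closure U \ U).2
  have hfrU : frontier U ⊆ Uᶜ := fun t ht => (hU.frontier_eq ▸ ht : t ∈ closure U \ U).2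
  have hsU : Metric.sphere a r ⊆ Uᶜ := hzs ▸ (connectedComponentIn_subset _ _).trans hfrU
  have hUnb : ¬ Bornology.IsBounded U := fun h =>
    NormedSpace.unbounded_univ ℝ ℂ (by rw [← union_compl_self U]; exact h.union hb.isBounded)
  -- `U` is connected, unbounded and disjoint from the circle, hence lies outside it
  have hUext : U ⊆ (Metric.closedBall a r)ᶜ := by
    refine hUc.isPreconnected.subset_right_of_subset_union Metric.isOpen_ball
      Metric.isClosed_closedBall.isOpen_compl
      (disjoint_compl_right_iff_subset.2 Metric.ball_subset_closedBall) ?_ ?_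
    · intro t ht
      rcases lt_or_ge (dist t a) r with h | h
      · exact Or.inl h
      · refine Or.inr fun h' => hsU ?_ ht
        exact le_antisymm h' h
    · by_contra hcon
      rw [not_nonempty_iff_eq_empty] at hcon
      refine hUnb ((Metric.isBounded_closedBall (x := a) (r := r)).subset ?_)
      intro t ht
      by_contra h'
      exact notMem_empty t (hcon ▸ ⟨ht, h'⟩)
  have hzsph : z ∈ Metric.sphere a r := hzs ▸ mem_connectedComponentIn hz
  have hsub : Metric.closedBall a r ⊆ connectedComponentIn Uᶜ z :=
    Metric.isPreconnected_closedBall.subset_connectedComponentIn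
      (Metric.sphere_subset_closedBall hzsph) (subset_compl_comm.1 hUext)
  refine Subset.antisymm ?_ hsub
  have hzfr : z ∈ frontier (connectedComponentIn Uᶜ z) := by
    rw [(isClosed_connectedComponentIn hU.isClosed_compl z).frontier_eq]
    refine ⟨mem_connectedComponentIn hzU, fun h => ?_⟩
    obtain ⟨t, ht, htU⟩ :=
      mem_closure_iff.1 (frontier_subset_closure hz) _ isOpen_interior h
    exact connectedComponentIn_subset _ _ (interior_subset ht) htU
  have hfr : frontier (connectedComponentIn Uᶜ z) ⊆ Metric.sphere a r := by
    rw [← hzs]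
    exact (isPreconnected_frontier_component hU hUc hb hzU).subset_connectedComponentIn hzfr
      (frontier_component_subset hU z)
  have hcl := isClosed_connectedComponentIn hU.isClosed_compl z
  -- the boundary of the component lies on the circle, so the exterior of the disk cannot enter it
  have hext : (Metric.closedBall a r)ᶜ ⊆ (connectedComponentIn Uᶜ z)ᶜ := by
    refine (isPreconnected_compl_closedBall a hr).subset_right_of_subset_union
      (isOpen_interior (s := connectedComponentIn Uᶜ z)) hcl.isOpen_compl
      (disjoint_compl_right_iff_subset.2 interior_subset) ?_ ?_
    · intro t ht
      by_cases h : t ∈ connectedComponentIn Uᶜ z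
      · left
        by_contra h'
        exact ht (Metric.sphere_subset_closedBall (hfr (hcl.frontier_eq ▸ ⟨h, h'⟩)))
      · exact Or.inr h
    · by_contra hcon
      rw [not_nonempty_iff_eq_empty] at hcon
      refine not_isBounded_compl_closedBall a r ((hb.isBounded).subset ?_)
      intro t ht
      by_contra h'
      exact notMem_empty t (hcon ▸ ⟨ht, fun h => h' (connectedComponentIn_subset _ _ h)⟩)
  exact compl_subset_compl.1 hext

/-- The complementary components of a plane domain whose boundary components are circles or points
are closed disks or points. -/
theorem exists_component_eq_closedBall {U : Set ℂ} (hU : IsOpen U) (hUc : IsConnected U)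
    (hb : IsCompact Uᶜ)
    (hcirc : ∀ z ∈ frontier U, ∃ (a : ℂ) (r : ℝ), 0 ≤ r ∧
      connectedComponentIn (frontier U) z = Metric.sphere a r) {x : ℂ} (hx : x ∉ U) :
    ∃ (a : ℂ) (r : ℝ), 0 ≤ r ∧ connectedComponentIn Uᶜ x = Metric.closedBall a r := by
  have hcl := isClosed_connectedComponentIn hU.isClosed_compl x
  obtain ⟨z, hz⟩ := frontier_nonempty_of_isCompact
    (hb.of_isClosed_subset hcl (connectedComponentIn_subset _ _)) ⟨x, mem_connectedComponentIn hx⟩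
  have hzfr := frontier_component_subset hU x hz
  obtain ⟨a, r, hr, har⟩ := hcirc z hzfr
  exact ⟨a, r, hr, by
    rw [connectedComponentIn_eq (hcl.frontier_subset hz),
      component_eq_closedBall hU hUc hb hr hzfr har]⟩

/-! ### Passing from the sphere to the plane -/

theorem preimage_component {A : Set Sphere} (hA : OnePoint.infty ∉ A) (y : ℂ) :
    (fun z : ℂ => (z : Sphere)) ⁻¹' connectedComponentIn A (y : Sphere) =
      connectedComponentIn ((fun z : ℂ => (z : Sphere)) ⁻¹' A) y := by
  by_cases hy : (y : Sphere) ∈ A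
  · refine Subset.antisymm ?_ ?_
    · refine IsPreconnected.subset_connectedComponentIn ?_ (mem_connectedComponentIn hy)
        (preimage_mono (connectedComponentIn_subset _ _))
      rw [← OnePoint.isOpenEmbedding_coe.isInducing.isPreconnected_image,
        image_preimage_eq_of_subset]
      · exact isPreconnected_connectedComponentIn
      · intro p hp
        induction p using OnePoint.rec with
        | infty => exact absurd (connectedComponentIn_subset _ _ hp) hA
        | coe p => exact ⟨p, rfl⟩
    · rw [← image_subset_iff]
      refine IsPreconnected.subset_connectedComponentIn
        (isPreconnected_connectedComponentIn.image _ OnePoint.continuous_coe.continuousOn) ?_ ?_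
      · exact ⟨y, mem_connectedComponentIn hy, rfl⟩
      · rw [image_subset_iff]
        exact connectedComponentIn_subset _ _
  · rw [connectedComponentIn_eq_empty hy, connectedComponentIn_eq_empty (by exact hy), preimage_empty]

theorem isOpen_preimage_coe {Ω : Set Sphere} (hΩ : IsOpen Ω) :
    IsOpen ((fun z : ℂ => (z : Sphere)) ⁻¹' Ω) :=
  hΩ.preimage OnePoint.continuous_coe

theorem isCompact_compl_preimage_coe {Ω : Set Sphere} (hΩ : IsOpen Ω) (h : OnePoint.infty ∈ Ω) :
    IsCompact ((fun z : ℂ => (z : Sphere)) ⁻¹' Ω)ᶜ :=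
  ((OnePoint.isOpen_iff_of_mem h).1 hΩ).2

/-- Deleting infinity does not disconnect a domain, because the exterior of a large disk is
connected. -/
theorem isConnected_preimage_coe {Ω : Set Sphere} (hΩ : IsSphereDomain Ω)
    (h : OnePoint.infty ∈ Ω) : IsConnected ((fun z : ℂ => (z : Sphere)) ⁻¹' Ω) := by
  set U := (fun z : ℂ => (z : Sphere)) ⁻¹' Ω with hUdef
  have hUo : IsOpen U := isOpen_preimage_coe hΩ.1
  have hcpt : IsCompact Uᶜ := isCompact_compl_preimage_coe hΩ.1 h
  obtain ⟨R, hR0, hR⟩ : ∃ R : ℝ, 0 ≤ R ∧ Uᶜ ⊆ Metric.closedBall 0 R := by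
    obtain ⟨R, hR⟩ := (Metric.isBounded_iff_subset_closedBall 0).1 hcpt.isBounded
    exact ⟨max R 0, le_max_right _ _, hR.trans (Metric.closedBall_subset_closedBall (le_max_left _ _))⟩
  have hext : (Metric.closedBall (0 : ℂ) R)ᶜ ⊆ U := compl_subset_comm.1 hR
  have hne : ((Metric.closedBall (0 : ℂ) R)ᶜ).Nonempty := by
    by_contra hcon
    rw [not_nonempty_iff_eq_empty] at hcon
    exact not_isBounded_compl_closedBall 0 R (hcon ▸ Bornology.isBounded_empty)
  refine ⟨hne.mono hext, ?_⟩
  rw [isPreconnected_iff_subset_of_disjoint]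
  intro u v hu hv huv hdisj
  wlog hEu : (Metric.closedBall (0 : ℂ) R)ᶜ ⊆ u generalizing u v
  · have h1 := isPreconnected_iff_subset_of_disjoint.1 (isPreconnected_compl_closedBall 0 hR0) u v hu
      hv (hext.trans huv)
      (subset_eq_empty (inter_subset_inter_left _ hext) hdisj)
    have h2 := h1.resolve_left hEu
    exact (this v u hv hu (union_comm u v ▸ huv) (inter_comm u v ▸ hdisj) h2).symm
  -- the part of `U` containing the exterior of a large disk is completed by the point at infinity
  left
  set u' : Set Sphere := insert OnePoint.infty ((fun z : ℂ => (z : Sphere)) '' (u ∩ U))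
  set v' : Set Sphere := (fun z : ℂ => (z : Sphere)) '' (v ∩ U)
  have hu'pre : (fun z : ℂ => (z : Sphere)) ⁻¹' u' = u ∩ U := by
    ext z
    simp [u']
  have hu' : IsOpen u' := by
    rw [OnePoint.isOpen_iff_of_mem (mem_insert _ _)]
    change IsClosed ((fun z : ℂ => (z : Sphere)) ⁻¹' u')ᶜ ∧
      IsCompact ((fun z : ℂ => (z : Sphere)) ⁻¹' u')ᶜ
    rw [hu'pre]
    refine ⟨(hu.inter hUo).isClosed_compl, ?_⟩
    refine (isCompact_closedBall (0 : ℂ) R).of_isClosed_subset (hu.inter hUo).isClosed_compl ?_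
    exact compl_subset_comm.1 (subset_inter hEu hext)
  have hv' : IsOpen v' := OnePoint.isOpenEmbedding_coe.isOpenMap _ (hv.inter hUo)
  have := isPreconnected_iff_subset_of_disjoint.1 hΩ.2.isPreconnected u' v' hu' hv' (by
    intro p hp
    induction p using OnePoint.rec with
    | infty => exact Or.inl (mem_insert _ _)
    | coe p =>
      rcases huv (show p ∈ U from hp) with h' | h'
      · exact Or.inl (Or.inr ⟨p, ⟨h', hp⟩, rfl⟩)
      · exact Or.inr ⟨p, ⟨h', hp⟩, rfl⟩) (by
    rw [eq_empty_iff_forall_notMem]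
    rintro p ⟨-, (rfl | ⟨s, hs, rfl⟩), ⟨t, ht, hst⟩⟩
    · exact OnePoint.coe_ne_infty t hst
    · rw [OnePoint.coe_eq_coe] at hst
      subst hst
      exact notMem_empty t (hdisj ▸ ⟨hs.2, hs.1, ht.1⟩))
  rcases this with h' | h'
  · intro t ht
    have : t ∈ (fun z : ℂ => (z : Sphere)) ⁻¹' u' := h' ht
    rw [hu'pre] at this
    exact this.1
  · obtain ⟨t, -, ht⟩ := h' h
    exact absurd ht (OnePoint.coe_ne_infty t)

theorem infty_notMem_frontier {Ω : Set Sphere} (hΩ : IsOpen Ω) (h : OnePoint.infty ∈ Ω) :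
    OnePoint.infty ∉ frontier Ω := fun h' => (hΩ.frontier_eq ▸ h').2 h

theorem preimage_frontier (Ω : Set Sphere) :
    (fun z : ℂ => (z : Sphere)) ⁻¹' frontier Ω = frontier ((fun z : ℂ => (z : Sphere)) ⁻¹' Ω) :=
  OnePoint.isOpenEmbedding_coe.isOpenMap.preimage_frontier_eq_frontier_preimage
    OnePoint.continuous_coe Ω

/-- In the plane, the boundary components of a circle domain containing infinity are circles,
possibly of radius zero. -/
theorem IsCircleDomain.component_frontier {Ω : Set Sphere} (hΩ : IsCircleDomain Ω)
    (h : OnePoint.infty ∈ Ω) {z : ℂ}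
    (hz : z ∈ frontier ((fun z : ℂ => (z : Sphere)) ⁻¹' Ω)) :
    ∃ (a : ℂ) (r : ℝ), 0 ≤ r ∧
      connectedComponentIn (frontier ((fun z : ℂ => (z : Sphere)) ⁻¹' Ω)) z = Metric.sphere a r := by
  have hinf := infty_notMem_frontier hΩ.1.1 h
  rw [← preimage_frontier] at hz ⊢
  rw [← preimage_component hinf]
  rcases hΩ.2 _ ⟨z, hz, rfl⟩ with (⟨a, r, hr, hb⟩ | ⟨a, v, -, hb⟩) | ⟨p, hb⟩
  · exact ⟨a, r, hr.le, by rw [hb, preimage_image_eq _ OnePoint.coe_injective]⟩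
  · exact absurd (connectedComponentIn_subset _ _ (hb ▸ mem_insert _ _)) hinf
  · refine ⟨z, 0, le_rfl, ?_⟩
    have hp : (z : Sphere) ∈ ({p} : Set Sphere) := hb ▸ mem_connectedComponentIn hz
    rw [mem_singleton_iff] at hp
    rw [hb, ← hp, Metric.sphere_zero]
    ext t
    simp


/-- The restriction to the plane of a self-map of the sphere. -/
noncomputable def planeMap (f : Sphere → Sphere) (z : ℂ) : ℂ := finiteCoord (f z)

/-- The set of finite points of a subset of the sphere. -/
def finitePart (Ω : Set Sphere) : Set ℂ := (fun z : ℂ => (z : Sphere)) ⁻¹' Ω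

theorem finiteCoord_coe (z : ℂ) : finiteCoord (z : Sphere) = z := rfl

theorem coe_finiteCoord {p : Sphere} (hp : p ≠ OnePoint.infty) : (finiteCoord p : Sphere) = p := by
  induction p using OnePoint.rec with
  | infty => exact absurd rfl hp
  | coe p => rfl

section

variable {f : Sphere → Sphere} {Ω Ω' : Set Sphere}

theorem map_coe_ne_infty (hf : IsConformalMapOnto f Ω Ω') (hinf : OnePoint.infty ∈ Ω)
    (hfinf : f OnePoint.infty = OnePoint.infty) {z : ℂ} (hz : z ∈ finitePart Ω) :
    f z ≠ OnePoint.infty := fun h =>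
  OnePoint.coe_ne_infty z (hf.injOn hz hinf (h.trans hfinf.symm))

theorem coe_planeMap (hf : IsConformalMapOnto f Ω Ω') (hinf : OnePoint.infty ∈ Ω)
    (hfinf : f OnePoint.infty = OnePoint.infty) {z : ℂ} (hz : z ∈ finitePart Ω) :
    (planeMap f z : Sphere) = f z :=
  coe_finiteCoord (map_coe_ne_infty hf hinf hfinf hz)

theorem differentiableAt_planeMap (hf : IsConformalMapOnto f Ω Ω') (hinf : OnePoint.infty ∈ Ω)
    (hfinf : f OnePoint.infty = OnePoint.infty) {z : ℂ} (hz : z ∈ finitePart Ω) :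
    DifferentiableAt ℂ (planeMap f) z := by
  have h := (hf.holomorphic z hz).2
  have hne := map_coe_ne_infty hf hinf hfinf hz
  have e : (fun t : ℂ => localCoord (f z) (f (localParam z t))) = planeMap f := by
    funext t
    simp [localCoord, localParam, chartMap, hne, planeMap]
  rw [e] at h
  simpa [localCoord, chartMap, finiteCoord_coe] using h

theorem injOn_planeMap (hf : IsConformalMapOnto f Ω Ω') (hinf : OnePoint.infty ∈ Ω)
    (hfinf : f OnePoint.infty = OnePoint.infty) : InjOn (planeMap f) (finitePart Ω) := by
  intro x hx y hy hxy
  have : f x = f y := by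
    rw [← coe_planeMap hf hinf hfinf hx, ← coe_planeMap hf hinf hfinf hy, hxy]
  exact OnePoint.coe_injective (hf.injOn hx hy this)

theorem image_planeMap (hf : IsConformalMapOnto f Ω Ω') (hinf : OnePoint.infty ∈ Ω)
    (hfinf : f OnePoint.infty = OnePoint.infty) :
    planeMap f '' finitePart Ω = finitePart Ω' := by
  ext w
  constructor
  · rintro ⟨z, hz, rfl⟩
    change (planeMap f z : Sphere) ∈ Ω'
    rw [coe_planeMap hf hinf hfinf hz, ← hf.image_eq]
    exact mem_image_of_mem f hz
  · intro hw
    have : (w : Sphere) ∈ f '' Ω := hf.image_eq ▸ hw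
    obtain ⟨p, hp, hpw⟩ := this
    induction p using OnePoint.rec with
    | infty => exact absurd (hpw.symm.trans hfinf) (OnePoint.coe_ne_infty w)
    | coe p =>
      refine ⟨p, hp, ?_⟩
      simp only [planeMap, hpw]
      rfl

theorem isOpen_image_of_injOn {U : Set ℂ} {φ : ℂ → ℂ} (hU : IsOpen U) (hφ : DifferentiableOn ℂ φ U)
    (hinj : InjOn φ U) : IsOpen (φ '' U) := by
  rw [isOpen_iff_mem_nhds]
  rintro _ ⟨z, hz, rfl⟩
  obtain ⟨ε, hε, hball⟩ := Metric.isOpen_iff.1 hU z hz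
  have han : AnalyticOnNhd ℂ φ (Metric.ball z ε) :=
    (hφ.mono hball).analyticOnNhd Metric.isOpen_ball
  rcases han.is_constant_or_isOpen Metric.isPreconnected_ball with ⟨w, hw⟩ | h
  · exfalso
    have hz1 : z ∈ Metric.ball z ε := Metric.mem_ball_self hε
    have hz2 : z + (ε / 2 : ℝ) ∈ Metric.ball z ε := by
      rw [Metric.mem_ball, dist_eq_norm, add_sub_cancel_left, Complex.norm_real, Real.norm_eq_abs,
        abs_of_pos (half_pos hε)]
      linarith
    have := hinj (hball hz1) (hball hz2) ((hw _ hz1).trans (hw _ hz2).symm)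
    rw [left_eq_add] at this
    exact (half_pos hε).ne' (by exact_mod_cast this)
  · exact mem_of_superset ((h _ Subset.rfl Metric.isOpen_ball).mem_nhds
      (mem_image_of_mem _ (Metric.mem_ball_self hε))) (image_mono hball)

/-- A conformal map fixing infinity is bounded on bounded sets: by the open mapping theorem the image
of a neighbourhood of infinity is a neighbourhood of infinity, and the map is injective. -/
theorem isBounded_image_planeMap (hf : IsConformalMapOnto f Ω Ω') (hinf : OnePoint.infty ∈ Ω)
    (hΩ : IsOpen Ω) (hfinf : f OnePoint.infty = OnePoint.infty) {B : Set ℂ}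
    (hB : Bornology.IsBounded B) : Bornology.IsBounded (planeMap f '' (B ∩ finitePart Ω)) := by
  classical
  -- the map in the coordinate `1 / z` around infinity
  set G : ℂ → ℂ := fun t => localCoord (f OnePoint.infty) (f (localParam OnePoint.infty t)) with hG
  obtain ⟨M, hM⟩ := (Metric.isBounded_iff_subset_closedBall 0).1
    (hB.union (isCompact_compl_preimage_coe hΩ hinf).isBounded)
  obtain ⟨R, hR0, hR⟩ : ∃ R : ℝ, 0 < R ∧ B ∪ ((fun z : ℂ => (z : Sphere)) ⁻¹' Ω)ᶜ ⊆ Metric.closedBall 0 R :=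
    ⟨max M 1, lt_of_lt_of_le one_pos (le_max_right _ _),
      hM.trans (Metric.closedBall_subset_closedBall (le_max_left _ _))⟩
  have hmem : ∀ t ∈ Metric.ball (0 : ℂ) R⁻¹, t ≠ 0 → t⁻¹ ∉ Metric.closedBall (0 : ℂ) R := by
    intro t ht ht0
    rw [mem_ball_zero_iff] at ht
    rw [mem_closedBall_zero_iff, norm_inv, not_le]
    exact (lt_inv_comm₀ (norm_pos_iff.2 ht0) hR0).1 ht
  have hmemU : ∀ t ∈ Metric.ball (0 : ℂ) R⁻¹, t ≠ 0 → t⁻¹ ∈ finitePart Ω := by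
    intro t ht ht0
    by_contra hcon
    exact hmem t ht ht0 (hR (Or.inr hcon))
  have hG0 : G 0 = 0 := by
    simp [hG, localCoord, localParam, chartMap, inversion, hfinf, finiteCoord]
  have hGt : ∀ t ∈ Metric.ball (0 : ℂ) R⁻¹, t ≠ 0 → G t = (planeMap f t⁻¹)⁻¹ := by
    intro t ht ht0
    have h1 := coe_planeMap hf hinf hfinf (hmemU t ht ht0)
    simp only [hG, localCoord, localParam, chartMap, hfinf, if_true]
    have e : inversion (t : Sphere) = ((t⁻¹ : ℂ) : Sphere) := by
      simp [inversion, ht0]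
    rw [e, ← h1]
    by_cases h0 : planeMap f t⁻¹ = 0
    · simp [inversion, h0, finiteCoord]
    · simp [inversion, h0, finiteCoord]
  have hne0 : ∀ t ∈ Metric.ball (0 : ℂ) R⁻¹, G t = G 0 → t = 0 ∨ planeMap f t⁻¹ = 0 := by
    intro t ht h
    by_cases ht0 : t = 0
    · exact Or.inl ht0
    · rw [hGt t ht ht0, hG0, inv_eq_zero] at h
      exact Or.inr h
  have hcont0 : ContinuousAt G 0 := by
    have h := (hf.holomorphic _ hinf).2.continuousAt
    have e : localCoord OnePoint.infty OnePoint.infty = 0 := by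
      simp [localCoord, chartMap, inversion, finiteCoord]
    rwa [e] at h
  -- near infinity the map does not vanish
  obtain ⟨ε, hε, hεR, hnz⟩ : ∃ ε : ℝ, 0 < ε ∧ ε ≤ R⁻¹ ∧
      ∀ t ∈ Metric.ball (0 : ℂ) ε, t ≠ 0 → planeMap f t⁻¹ ≠ 0 := by
    by_cases hz : ∃ z₀ ∈ finitePart Ω, planeMap f z₀ = 0
    · obtain ⟨z₀, hz₀, hfz₀⟩ := hz
      refine ⟨min R⁻¹ (‖z₀‖ + 1)⁻¹, lt_min (by positivity) (by positivity), min_le_left _ _, ?_⟩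
      intro t ht ht0 h
      have ht1 : t ∈ Metric.ball (0 : ℂ) R⁻¹ := Metric.ball_subset_ball (min_le_left _ _) ht
      have := injOn_planeMap hf hinf hfinf (hmemU t ht1 ht0) hz₀ (h.trans hfz₀.symm)
      rw [mem_ball_zero_iff] at ht
      have h2 : ‖t‖ < (‖z₀‖ + 1)⁻¹ := ht.trans_le (min_le_right _ _)
      rw [← this, norm_inv] at h2
      have h3 : 0 < ‖t‖ := norm_pos_iff.2 ht0
      rw [lt_inv_comm₀ h3 (by positivity)] at h2
      linarith
    · push Not at hz
      exact ⟨R⁻¹, by positivity, le_rfl, fun t ht ht0 => hz _ (hmemU t ht ht0)⟩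
  have hsubR : Metric.ball (0 : ℂ) ε ⊆ Metric.ball (0 : ℂ) R⁻¹ := Metric.ball_subset_ball hεR
  have hdiff : DifferentiableOn ℂ G (Metric.ball 0 ε) := by
    intro t ht
    by_cases ht0 : t = 0
    · have h := (hf.holomorphic _ hinf).2
      have e : localCoord OnePoint.infty OnePoint.infty = 0 := by
        simp [localCoord, chartMap, inversion, finiteCoord]
      rw [e] at h
      rw [ht0]
      exact h.differentiableWithinAt
    · have h1 : DifferentiableAt ℂ (fun t => (planeMap f t⁻¹)⁻¹) t := by
        refine DifferentiableAt.inv ?_ (hnz t ht ht0)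
        exact (differentiableAt_planeMap hf hinf hfinf (hmemU t (hsubR ht) ht0)).comp t
          (differentiableAt_inv ht0)
      have hev : G =ᶠ[𝓝 t] fun t => (planeMap f t⁻¹)⁻¹ := by
        filter_upwards [Metric.isOpen_ball.mem_nhds ht, isOpen_ne.mem_nhds ht0] with s hs hs0
          using hGt s (hsubR hs) hs0
      exact (hev.differentiableAt_iff.2 h1).differentiableWithinAt
  have hinj : InjOn G (Metric.ball 0 ε) := by
    intro s hs t ht hst
    by_cases hs0 : s = 0
    · rcases hne0 t (hsubR ht) (by rw [← hst, hs0]) with h | h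
      · rw [hs0, h]
      · by_contra hne
        exact hnz t ht (fun h0 => hne (hs0.trans h0.symm)) h
    · by_cases ht0 : t = 0
      · rcases hne0 s (hsubR hs) (by rw [hst, ht0]) with h | h
        · exact absurd h hs0
        · exact absurd h (hnz s hs hs0)
      · rw [hGt s (hsubR hs) hs0, hGt t (hsubR ht) ht0, inv_inj] at hst
        exact inv_injective (injOn_planeMap hf hinf hfinf (hmemU s (hsubR hs) hs0)
          (hmemU t (hsubR ht) ht0) hst)
  have hopen := isOpen_image_of_injOn Metric.isOpen_ball hdiff hinj
  obtain ⟨η, hη, hηball⟩ := Metric.isOpen_iff.1 hopen 0 ⟨0, Metric.mem_ball_self hε, hG0⟩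
  refine (Metric.isBounded_closedBall (x := (0 : ℂ)) (r := η⁻¹)).subset ?_
  rintro _ ⟨z, ⟨hzB, hzΩ⟩, rfl⟩
  by_contra hcon
  rw [mem_closedBall_zero_iff, not_le] at hcon
  have hpos : 0 < ‖planeMap f z‖ := lt_trans (by positivity) hcon
  have hin : (planeMap f z)⁻¹ ∈ Metric.ball (0 : ℂ) η := by
    rw [mem_ball_zero_iff, norm_inv]
    exact inv_lt_of_inv_lt₀ hη hcon
  obtain ⟨t, ht, htz⟩ := hηball hin
  have ht0 : t ≠ 0 := by
    rintro rfl
    rw [hG0] at htz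
    exact norm_pos_iff.1 hpos (inv_eq_zero.1 htz.symm)
  rw [hGt t (hsubR ht) ht0, inv_inj] at htz
  have := injOn_planeMap hf hinf hfinf (hmemU t (hsubR ht) ht0) hzΩ htz
  exact hmem t (hsubR ht) ht0 (this ▸ hR (Or.inl hzB))

/-- The preimages of bounded sets under a conformal map fixing infinity are bounded. -/
theorem exists_norm_planeMap_gt (hf : IsConformalMapOnto f Ω Ω') (hinf : OnePoint.infty ∈ Ω)
    (hΩ : IsOpen Ω) (hfinf : f OnePoint.infty = OnePoint.infty) (M : ℝ) :
    ∃ R : ℝ, 0 < R ∧ ∀ z : ℂ, R < ‖z‖ → z ∈ finitePart Ω ∧ M < ‖planeMap f z‖ := by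
  have hc : ContinuousAt f OnePoint.infty := (hf.holomorphic _ hinf).1
  rw [ContinuousAt, hfinf] at hc
  set V : Set Sphere := insert OnePoint.infty
    ((fun z : ℂ => (z : Sphere)) '' (Metric.closedBall 0 M)ᶜ) with hVdef
  have hpre : (fun z : ℂ => (z : Sphere)) ⁻¹' V = (Metric.closedBall 0 M)ᶜ := by
    ext z
    simp [V]
  have hVo : IsOpen V := by
    rw [OnePoint.isOpen_iff_of_mem (mem_insert _ _)]
    change IsClosed ((fun z : ℂ => (z : Sphere)) ⁻¹' V)ᶜ ∧
      IsCompact ((fun z : ℂ => (z : Sphere)) ⁻¹' V)ᶜ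
    rw [hpre, compl_compl]
    exact ⟨Metric.isClosed_closedBall, isCompact_closedBall _ _⟩
  have hnhds := hc (hVo.mem_nhds (mem_insert _ _))
  obtain ⟨W, hWs, hWo, hWinf⟩ := mem_nhds_iff.1 (inter_mem hnhds (hΩ.mem_nhds hinf))
  have hcpt := isCompact_compl_preimage_coe hWo hWinf
  obtain ⟨R, hR⟩ := (Metric.isBounded_iff_subset_closedBall 0).1 hcpt.isBounded
  refine ⟨max R 1, lt_of_lt_of_le one_pos (le_max_right _ _), fun z hz => ?_⟩
  have hzW : (z : Sphere) ∈ W := by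
    by_contra hcon
    have := hR (show z ∈ ((fun z : ℂ => (z : Sphere)) ⁻¹' W)ᶜ from hcon)
    rw [mem_closedBall_zero_iff] at this
    exact absurd (lt_of_le_of_lt (le_max_left _ _) hz) (not_lt.2 this)
  obtain ⟨h1, h2⟩ := hWs hzW
  refine ⟨h2, ?_⟩
  have h3 : (planeMap f z : Sphere) ∈ V := by
    rw [coe_planeMap hf hinf hfinf h2]
    exact h1
  have h4 : planeMap f z ∈ (fun z : ℂ => (z : Sphere)) ⁻¹' V := h3
  rw [hpre, mem_compl_iff, mem_closedBall_zero_iff, not_le] at h4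
  exact h4

/-- The restriction to the plane of a conformal map fixing infinity is a proper homeomorphism. -/
theorem properHomeo_planeMap (hΩ : IsSphereDomain Ω) (hinf : OnePoint.infty ∈ Ω)
    (hΩ' : IsSphereDomain Ω') (hinf' : OnePoint.infty ∈ Ω') (hf : IsConformalMapOnto f Ω Ω')
    (hfinf : f OnePoint.infty = OnePoint.infty) :
    ProperHomeo (planeMap f) (Function.invFunOn (planeMap f) (finitePart Ω)) (finitePart Ω)
      (finitePart Ω') := by
  have hU : IsOpen (finitePart Ω) := isOpen_preimage_coe hΩ.1
  have hinj := injOn_planeMap hf hinf hfinf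
  have himg := image_planeMap hf hinf hfinf
  have hdiff : DifferentiableOn ℂ (planeMap f) (finitePart Ω) := fun z hz =>
    (differentiableAt_planeMap hf hinf hfinf hz).differentiableWithinAt
  have hg : ∀ w ∈ finitePart Ω', ∃ z ∈ finitePart Ω, planeMap f z = w ∧
      Function.invFunOn (planeMap f) (finitePart Ω) w = z := by
    rintro w hw
    rw [← himg] at hw
    obtain ⟨z, hz, rfl⟩ := hw
    exact ⟨z, hz, rfl, hinj.leftInvOn_invFunOn hz⟩
  refine ⟨hU, isOpen_preimage_coe hΩ'.1, isConnected_preimage_coe hΩ hinf,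
    isConnected_preimage_coe hΩ' hinf', (isCompact_compl_preimage_coe hΩ.1 hinf).isBounded,
    (isCompact_compl_preimage_coe hΩ'.1 hinf').isBounded, hdiff.continuousOn, ?_,
    himg ▸ mapsTo_image _ _, ?_, fun z hz => hinj.leftInvOn_invFunOn hz, ?_,
    fun B hB => isBounded_image_planeMap hf hinf hΩ.1 hfinf hB, ?_⟩
  · rw [continuousOn_iff' ]
    intro t ht
    refine ⟨planeMap f '' (t ∩ finitePart Ω), isOpen_image_of_injOn (ht.inter hU)
      (hdiff.mono inter_subset_right) (hinj.mono inter_subset_right), ?_⟩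
    ext w
    constructor
    · rintro ⟨h1, h2⟩
      obtain ⟨z, hz, hzw, hgz⟩ := hg w h2
      rw [mem_preimage, hgz] at h1
      exact ⟨⟨z, ⟨h1, hz⟩, hzw⟩, h2⟩
    · rintro ⟨⟨z, ⟨h1, hz⟩, rfl⟩, h2⟩
      refine ⟨?_, h2⟩
      rw [mem_preimage, hinj.leftInvOn_invFunOn hz]
      exact h1
  · intro w hw
    obtain ⟨z, hz, -, hgz⟩ := hg w hw
    rwa [hgz]
  · intro w hw
    obtain ⟨z, -, hzw, hgz⟩ := hg w hw
    rw [hgz, hzw]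
  · intro B hB
    obtain ⟨M, hM⟩ := (Metric.isBounded_iff_subset_closedBall 0).1 hB
    obtain ⟨R, -, hR⟩ := exists_norm_planeMap_gt hf hinf hΩ.1 hfinf M
    refine (Metric.isBounded_closedBall (x := (0 : ℂ)) (r := R)).subset ?_
    rintro _ ⟨w, ⟨hwB, hw⟩, rfl⟩
    obtain ⟨z, hz, hzw, hgz⟩ := hg w hw
    rw [hgz, mem_closedBall_zero_iff]
    by_contra hcon
    have h1 := (hR z (not_le.1 hcon)).2
    rw [hzw] at h1
    exact absurd (mem_closedBall_zero_iff.1 (hM hwB)) (not_le.2 h1)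

end


/-! ### Area and length estimates for conformal maps -/

theorem volume_ball_pos_ne_top (z : ℂ) {ρ : ℝ} (hρ : 0 < ρ) :
    volume (Metric.ball z ρ) ≠ 0 ∧ volume (Metric.ball z ρ) ≠ ⊤ :=
  ⟨(Metric.measure_ball_pos _ _ hρ).ne', measure_ball_lt_top.ne⟩

/-- Integration over a disk in polar coordinates around its centre. -/
theorem lintegral_ball_polar (z : ℂ) (ρ : ℝ) {F : ℂ → ENNReal} (hF : Measurable F) :
    ∫⁻ y in Metric.ball z ρ, F y = ∫⁻ s in Ioi (0 : ℝ), ∫⁻ θ in Ioo (-Real.pi) Real.pi,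
      ENNReal.ofReal s * (Metric.ball z ρ).indicator F (circleMap z s θ) := by
  have hm : Measurable ((Metric.ball z ρ).indicator F) := hF.indicator measurableSet_ball
  rw [← lintegral_indicator measurableSet_ball, ← lintegral_add_left_eq_self _ z,
    ← Complex.lintegral_comp_polarCoord_symm]
  have hcm : ∀ p : ℝ × ℝ, z + Complex.polarCoord.symm p = circleMap z p.1 p.2 := by
    intro p
    rw [Complex.polarCoord_symm_apply, circleMap, Complex.exp_mul_I]
    push_cast
    rfl
  simp only [hcm, smul_eq_mul]
  have ht : polarCoord.target = Ioi (0 : ℝ) ×ˢ Ioo (-Real.pi) Real.pi := rfl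
  rw [ht, Measure.volume_eq_prod, ← Measure.prod_restrict, lintegral_prod]
  refine Measurable.aemeasurable ?_
  refine (ENNReal.measurable_ofReal.comp measurable_fst).mul (hm.comp ?_)
  have : Continuous fun p : ℝ × ℝ => circleMap z p.1 p.2 := by
    unfold circleMap
    fun_prop
  exact this.measurable

/-- The sub-mean value property of the modulus of a holomorphic function on a disk. -/
theorem enorm_mul_volume_ball_le {g : ℂ → ℂ} {z : ℂ} {ρ : ℝ}
    (hg : DifferentiableOn ℂ g (Metric.ball z ρ)) :
    ‖g z‖ₑ * volume (Metric.ball z ρ) ≤ ∫⁻ y in Metric.ball z ρ, ‖g y‖ₑ := by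
  classical
  rcases le_or_gt ρ 0 with hρ | hρ
  · rw [Metric.ball_eq_empty.2 hρ]
    simp
  set G : ℂ → ℂ := (Metric.ball z ρ).piecewise g 0 with hG
  have hGm : Measurable G :=
    hg.continuousOn.measurable_piecewise continuous_zero.continuousOn measurableSet_ball
  have e1 : ∫⁻ y in Metric.ball z ρ, ‖g y‖ₑ = ∫⁻ y in Metric.ball z ρ, ‖G y‖ₑ :=
    setLIntegral_congr_fun measurableSet_ball fun y hy => by simp [hG, hy]
  have e2 : ‖g z‖ₑ * volume (Metric.ball z ρ) = ∫⁻ y in Metric.ball z ρ, ‖g z‖ₑ := by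
    rw [setLIntegral_const]
  rw [e1, e2, lintegral_ball_polar z ρ hGm.enorm, lintegral_ball_polar z ρ measurable_const]
  refine setLIntegral_mono' measurableSet_Ioi fun s hs => ?_
  rw [mem_Ioi] at hs
  have hmem : ∀ θ, circleMap z s θ ∈ Metric.ball z ρ ↔ s < ρ := by
    intro θ
    rw [Metric.mem_ball, dist_eq_norm, circleMap, add_sub_cancel_left, norm_mul,
      Complex.norm_exp_ofReal_mul_I, mul_one, Complex.norm_real, Real.norm_eq_abs, abs_of_pos hs]
  by_cases hsρ : s < ρ
  · have hi : ∀ (F : ℂ → ENNReal) θ, (Metric.ball z ρ).indicator F (circleMap z s θ) =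
        F (circleMap z s θ) := fun F θ => indicator_of_mem ((hmem θ).2 hsρ) F
    simp only [hi]
    rw [lintegral_const_mul' _ _ ENNReal.ofReal_ne_top, lintegral_const_mul' _ _ ENNReal.ofReal_ne_top]
    refine mul_le_mul' le_rfl ?_
    have hav : Real.circleAverage g z s = g z := by
      refine DiffContOnCl.circleAverage (R := s) ?_
      refine DifferentiableOn.diffContOnCl (hg.mono ?_)
      rw [abs_of_pos hs, closure_ball z hs.ne']
      exact Metric.closedBall_subset_ball hsρ
    rw [Real.circleAverage_eq_integral_add (-Real.pi),
      intervalIntegral.integral_comp_add_right (fun θ => g (circleMap z s θ))] at hav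
    have e3 : (0 + -Real.pi) = -Real.pi := by ring
    have e4 : (2 * Real.pi + -Real.pi) = Real.pi := by ring
    rw [e3, e4] at hav
    have h2pi : (0 : ℝ) < 2 * Real.pi := by positivity
    have hint : ∫ θ in (-Real.pi)..Real.pi, g (circleMap z s θ) = (2 * Real.pi) • g z := by
      rw [← hav, smul_smul, mul_inv_cancel₀ h2pi.ne', one_smul]
    have h5 : ∫⁻ _ in Ioo (-Real.pi) Real.pi, ‖g z‖ₑ = ‖(2 * Real.pi) • g z‖ₑ := by
      rw [setLIntegral_const, Real.volume_Ioo, enorm_smul, mul_comm]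
      congr 1
      rw [Real.enorm_eq_ofReal h2pi.le]
      congr 1
      ring
    rw [h5, ← hint, intervalIntegral.integral_of_le (by linarith [Real.pi_pos]),
      integral_Ioc_eq_integral_Ioo]
    refine (enorm_integral_le_lintegral_enorm _).trans (le_of_eq ?_)
    refine lintegral_congr fun θ => ?_
    simp [hG, (hmem θ).2 hsρ]
  · have hi : ∀ (F : ℂ → ENNReal) θ, (Metric.ball z ρ).indicator F (circleMap z s θ) = 0 :=
      fun F θ => indicator_of_notMem (fun h => hsρ ((hmem θ).1 h)) F
    simp only [hi, le_refl]

/-- The oscillation of a holomorphic map on a disk is controlled by the area, counted with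
multiplicity, of the image of a disk of twice the radius. -/
theorem edist_sq_le_lintegral_deriv {f : ℂ → ℂ} {x y : ℂ} {ρ : ℝ} (hρ : 0 < ρ)
    (hf : DifferentiableOn ℂ f (Metric.ball x ρ)) (hy : dist y x ≤ ρ / 2) :
    edist (f y) (f x) ^ 2 ≤ ∫⁻ z in Metric.ball x ρ, ‖deriv f z‖ₑ ^ 2 := by
  set A := ∫⁻ z in Metric.ball x ρ, ‖deriv f z‖ₑ ^ 2 with hA
  by_cases hAtop : A = ⊤
  · rw [hAtop]
    exact le_top
  have hd : DifferentiableOn ℂ (deriv f) (Metric.ball x ρ) := hf.deriv Metric.isOpen_ball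
  have key : ∀ u ∈ Metric.closedBall x (ρ / 2), ‖deriv f u‖ ≤ √A.toReal / (ρ / 2) := by
    intro u hu
    have hsub : Metric.ball u (ρ / 2) ⊆ Metric.ball x ρ := by
      refine Metric.ball_subset_ball' ?_
      have := Metric.mem_closedBall.1 hu
      linarith
    have h1 := enorm_mul_volume_ball_le (g := fun t => deriv f t ^ 2) ((hd.pow 2).mono hsub)
    simp only [enorm_pow] at h1
    have h2 : ‖deriv f u‖ₑ ^ 2 * volume (Metric.ball u (ρ / 2)) ≤ A :=
      h1.trans (lintegral_mono_set hsub)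
    rw [Complex.volume_ball] at h2
    have h3 := ENNReal.toReal_mono hAtop h2
    rw [ENNReal.toReal_mul, ENNReal.toReal_mul, ENNReal.toReal_pow, ENNReal.toReal_pow,
      toReal_enorm, ENNReal.toReal_ofReal (by positivity), ENNReal.coe_toReal,
      NNReal.coe_real_pi] at h3
    rw [le_div_iff₀ (by positivity)]
    refine Real.le_sqrt_of_sq_le ?_
    have : (‖deriv f u‖ * (ρ / 2)) ^ 2 * 1 ≤ (‖deriv f u‖ * (ρ / 2)) ^ 2 * Real.pi := by
      gcongr
      linarith [Real.pi_gt_three]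
    nlinarith
  have hle := (convex_closedBall x (ρ / 2)).norm_image_sub_le_of_norm_deriv_le (𝕜 := ℂ) (f := f)
    (fun u hu => (hf.differentiableAt (Metric.isOpen_ball.mem_nhds
      (Metric.closedBall_subset_ball (by linarith) hu)))) key
    (Metric.mem_closedBall_self (by positivity)) (Metric.mem_closedBall.2 hy)
  have h4 : ‖f y - f x‖ ≤ √A.toReal := by
    refine hle.trans ?_
    rw [div_mul_eq_mul_div]
    rw [div_le_iff₀ (by positivity), ← dist_eq_norm]
    gcongr
  have h5 : ‖f y - f x‖ ^ 2 ≤ A.toReal := by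
    calc ‖f y - f x‖ ^ 2 ≤ √A.toReal ^ 2 := by gcongr
      _ = A.toReal := Real.sq_sqrt ENNReal.toReal_nonneg
  rw [edist_dist, dist_eq_norm, ← ENNReal.ofReal_pow (norm_nonneg _)]
  exact (ENNReal.ofReal_le_ofReal h5).trans (ENNReal.ofReal_toReal_le)

/-- The area formula for conformal maps. -/
theorem lintegral_deriv_sq_eq_volume_image {f : ℂ → ℂ} {U s : Set ℂ} (hU : IsOpen U)
    (hf : DifferentiableOn ℂ f U) (hinj : InjOn f U) (hs : MeasurableSet s) (hsU : s ⊆ U) :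
    ∫⁻ z in s, ‖deriv f z‖ₑ ^ 2 = volume (f '' s) := by
  rw [← lintegral_abs_det_fderiv_eq_addHaar_image volume hs (f := f)
    (f' := fun z => (ContinuousLinearMap.toSpanSingleton ℂ (deriv f z)).restrictScalars ℝ)
    (fun z hz => ((hf.differentiableAt (hU.mem_nhds (hsU hz))).hasDerivAt.hasFDerivAt.restrictScalars
      ℝ).hasFDerivWithinAt) (hinj.mono hsU)]
  refine lintegral_congr fun z => ?_
  have : ((ContinuousLinearMap.toSpanSingleton ℂ (deriv f z)).restrictScalars ℝ).det =
      ‖deriv f z‖ ^ 2 := by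
    rw [ContinuousLinearMap.det, ContinuousLinearMap.coe_restrictScalars,
      LinearMap.det_restrictScalars]
    change Algebra.norm ℝ (ContinuousLinearMap.toSpanSingleton ℂ (deriv f z)).det = _
    rw [ContinuousLinearMap.det_toSpanSingleton, Algebra.norm_complex_apply, Complex.normSq_eq_norm_sq]
  rw [this, abs_of_nonneg (by positivity), ENNReal.ofReal_pow (norm_nonneg _), ofReal_norm]

/-- The total length of the values of `|f - w|` along part of a line, where `f ≠ w`. -/
theorem volume_image_norm_line_le {f : ℂ → ℂ} {U : Set ℂ} (hU : IsOpen U)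
    (hf : DifferentiableOn ℂ f U) {w : ℂ} (hw : ∀ z ∈ U, f z ≠ w) {p u : ℂ} (hu : ‖u‖ = 1)
    {P : Set ℝ} (hP : MeasurableSet P) (hPU : ∀ s ∈ P, p + s * u ∈ U) :
    volume ((fun s : ℝ => ‖f (p + s * u) - w‖) '' P) ≤ ∫⁻ s in P, ‖deriv f (p + s * u)‖ₑ := by
  set γ : ℝ → ℂ := fun s => f (p + s * u) - w
  have hγ : ∀ s ∈ P, HasDerivAt γ (deriv f (p + s * u) * u) s := by
    intro s hs
    have h1 := (hf.differentiableAt (hU.mem_nhds (hPU s hs))).hasDerivAt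
    have h2 : HasDerivAt (fun s : ℝ => p + s * u) u s := by
      simpa using ((Complex.ofRealCLM.hasDerivAt (x := s)).mul_const u).const_add p
    exact (h1.comp s h2).sub_const w
  have hn : ∀ v : ℂ, v ≠ 0 → HasFDerivAt (fun t : ℂ => ‖t‖) (fderiv ℝ (fun t : ℂ => ‖t‖) v) v :=
    fun v hv => (differentiableAt_id.norm ℝ hv).hasFDerivAt
  have hφ : ∀ s ∈ P, HasDerivWithinAt (fun s : ℝ => ‖γ s‖)
      (fderiv ℝ (fun t : ℂ => ‖t‖) (γ s) (deriv f (p + s * u) * u)) P s := by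
    intro s hs
    exact ((hn _ (sub_ne_zero.2 (hw _ (hPU s hs)))).comp_hasDerivAt s (hγ s hs)).hasDerivWithinAt
  refine (addHaar_image_le_lintegral_abs_det_fderiv volume hP
    (fun s hs => (hφ s hs).hasFDerivWithinAt)).trans ?_
  refine lintegral_mono fun s => ?_
  rw [ContinuousLinearMap.det_toSpanSingleton, ← Real.norm_eq_abs, ofReal_norm,
    enorm_le_iff_norm_le]
  refine (ContinuousLinearMap.le_opNorm _ _).trans ?_
  have h1 : ‖fderiv ℝ (fun t : ℂ => ‖t‖) (γ s)‖ ≤ (1 : NNReal) :=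
    norm_fderiv_le_of_lipschitz ℝ (lipschitzWith_one_norm)
  rw [norm_mul, hu, mul_one]
  calc _ ≤ (1 : ℝ) * ‖deriv f (p + s * u)‖ := by
        gcongr
        simpa using h1
    _ = _ := one_mul _


/-! ### The quasihyperbolic distance -/

theorem hasUnitSpeedOn_line (y : ℂ) {v : ℂ} (hv : ‖v‖ = 1) (s : Set ℝ) :
    HasUnitSpeedOn (fun t : ℝ => y + t * v) s := by
  have hiso : ∀ a b : ℝ, edist (y + a * v) (y + b * v) = edist a b := by
    intro a b
    rw [edist_dist, edist_dist, dist_eq_norm, Real.dist_eq]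
    congr 1
    rw [add_sub_add_left_eq_sub, ← sub_mul, norm_mul, hv, mul_one, ← Complex.ofReal_sub,
      Complex.norm_real, Real.norm_eq_abs]
  refine hasConstantSpeedOnWith_iff_ordered.2 fun a ha b hb hab => ?_
  have h1 : eVariationOn (fun t : ℝ => y + t * v) (s ∩ Icc a b) =
      eVariationOn (id : ℝ → ℝ) (s ∩ Icc a b) := by
    simp only [eVariationOn, hiso, id]
  rw [h1]
  refine le_antisymm ?_ ?_
  · simpa using ((monotoneOn_id (s := s)).eVariationOn_eq ha hb).le
  · refine le_trans (le_of_eq ?_) (eVariationOn.edist_le (id : ℝ → ℝ)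
      (show b ∈ s ∩ Icc a b from ⟨hb, hab, le_rfl⟩) (show a ∈ s ∩ Icc a b from ⟨ha, le_rfl, hab⟩))
    rw [edist_dist, Real.dist_eq, abs_of_nonneg (by simpa using hab)]
    simp

theorem hasUnitSpeedOn_congr {γ γ' : ℝ → ℂ} {s : Set ℝ} (h : HasUnitSpeedOn γ s)
    (he : EqOn γ' γ s) : HasUnitSpeedOn γ' s := fun a ha b hb => by
  rw [eVariationOn.congr (he.mono inter_subset_left)]
  exact h ha hb

theorem hasUnitSpeedOn_mono {γ : ℝ → ℂ} {a b c d : ℝ} (h : HasUnitSpeedOn γ (Icc a b))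
    (hac : a ≤ c) (hdb : d ≤ b) : HasUnitSpeedOn γ (Icc c d) := by
  refine hasConstantSpeedOnWith_iff_ordered.2 fun x hx y hy _ => ?_
  have hx' : x ∈ Icc a b := ⟨hac.trans hx.1, hx.2.trans hdb⟩
  have hy' : y ∈ Icc a b := ⟨hac.trans hy.1, hy.2.trans hdb⟩
  have := h hx' hy'
  rw [inter_eq_self_of_subset_right (Icc_subset_Icc hx'.1 hy'.2)] at this
  rwa [inter_eq_self_of_subset_right (Icc_subset_Icc hx.1 hy.2)]

theorem hasUnitSpeedOn_comp_add {γ : ℝ → ℂ} {a b : ℝ} (h : HasUnitSpeedOn γ (Icc a b)) (c : ℝ) :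
    HasUnitSpeedOn (fun t => γ (t + c)) (Icc (a - c) (b - c)) := by
  refine hasConstantSpeedOnWith_iff_ordered.2 fun x hx y hy _ => ?_
  have hx' : x + c ∈ Icc a b := ⟨by linarith [hx.1], by linarith [hx.2]⟩
  have hy' : y + c ∈ Icc a b := ⟨by linarith [hy.1], by linarith [hy.2]⟩
  have h1 := h hx' hy'
  have h2 := eVariationOn.comp_eq_of_monotoneOn γ (t := Icc x y) (fun t => t + c)
    (fun s _ t _ hst => by simpa using hst)
  rw [image_add_const_Icc] at h2
  rw [inter_eq_self_of_subset_right (Icc_subset_Icc hx.1 hy.2)]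
  rw [inter_eq_self_of_subset_right (Icc_subset_Icc hx'.1 hy'.2)] at h1
  change eVariationOn (γ ∘ fun t => t + c) (Icc x y) = _
  rw [h2, h1]
  congr 2
  ring

theorem dist_le_of_hasUnitSpeedOn {γ : ℝ → ℂ} {s : Set ℝ} (h : HasUnitSpeedOn γ s) {a b : ℝ}
    (ha : a ∈ s) (hb : b ∈ s) (hab : a ≤ b) : dist (γ a) (γ b) ≤ b - a := by
  have h1 := h ha hb
  have h2 := eVariationOn.edist_le γ (show a ∈ s ∩ Icc a b from ⟨ha, le_rfl, hab⟩)
    (show b ∈ s ∩ Icc a b from ⟨hb, hab, le_rfl⟩)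
  rw [h1, edist_dist, ENNReal.ofReal_le_ofReal_iff (by simpa using hab)] at h2
  simpa using h2

section

variable {D : Set ℂ}

/-- The distance to the boundary of `D`. -/
noncomputable def bdist (D : Set ℂ) (z : ℂ) : ℝ := Metric.infDist z (frontier D)

theorem bdist_le_add (D : Set ℂ) (x y : ℂ) : bdist D x ≤ bdist D y + dist x y :=
  Metric.infDist_le_infDist_add_dist

theorem bdist_nonneg (D : Set ℂ) (x : ℂ) : 0 ≤ bdist D x := Metric.infDist_nonneg

theorem bdist_pos (hD : IsOpen D) (hne : (frontier D).Nonempty) {z : ℂ} (hz : z ∈ D) :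
    0 < bdist D z := by
  refine (isClosed_frontier.notMem_iff_infDist_pos hne).1 fun h => ?_
  exact (hD.frontier_eq ▸ h).2 hz

theorem ball_bdist_subset (hD : IsOpen D) {z : ℂ} (hz : z ∈ D) :
    Metric.ball z (bdist D z) ⊆ D := by
  rcases le_or_gt (bdist D z) 0 with h0 | h0
  · rw [Metric.ball_eq_empty.2 h0]
    exact empty_subset _
  refine (Metric.isPreconnected_ball (x := z) (r := bdist D z)).subset_left_of_subset_union hD
    (isClosed_closure (s := D)).isOpen_compl (disjoint_compl_right_iff_subset.2 subset_closure) ?_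
    ⟨z, Metric.mem_ball_self h0, hz⟩
  intro t ht
  by_cases htD : t ∈ D
  · exact Or.inl htD
  · refine Or.inr fun htc => ?_
    have htf : t ∈ frontier D := hD.frontier_eq ▸ ⟨htc, htD⟩
    have := Metric.infDist_le_dist_of_mem (x := z) htf
    rw [Metric.mem_ball, dist_comm] at ht
    exact absurd ht (not_lt.2 this)

theorem infEDist_eq_ofReal (hne : (frontier D).Nonempty) (z : ℂ) :
    Metric.infEDist z (frontier D) = ENNReal.ofReal (bdist D z) :=
  (ENNReal.ofReal_toReal (Metric.infEDist_ne_top hne)).symm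

/-- Moving the starting point within a small disk changes the quasihyperbolic distance little. -/
theorem quasihyperbolicDist_le_add (hD : IsOpen D) (hne : (frontier D).Nonempty) {x y x₀ : ℂ}
    (hy : y ∈ D) {ε : ℝ} (hε : ε ≤ 1 / 2) (hxy : dist x y ≤ ε * bdist D y) :
    quasihyperbolicDist D y x₀ ≤ quasihyperbolicDist D x x₀ + ENNReal.ofReal (2 * ε) := by
  have hδ := bdist_pos hD hne hy
  have hε0 : 0 ≤ ε := by
    by_contra h
    push Not at h
    have := (dist_nonneg (x := x) (y := y)).trans hxy
    nlinarith
  rcases eq_or_ne x y with rfl | hxyne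
  · exact le_self_add
  set l := dist x y with hl
  have hl0 : 0 < l := dist_pos.2 hxyne
  rw [quasihyperbolicDist, quasihyperbolicDist, ENNReal.iInf_add]
  refine le_iInf fun L => ?_
  rw [ENNReal.iInf_add]
  refine le_iInf fun γ => ?_
  simp only [ENNReal.iInf_add]
  refine le_iInf fun hL => le_iInf fun hγ => le_iInf fun hγD => le_iInf fun hγ0 => le_iInf fun hγL => ?_
  set v : ℂ := (x - y) / l with hv
  have hlne : (l : ℂ) ≠ 0 := by exact_mod_cast hl0.ne'
  have hv1 : ‖v‖ = 1 := by
    rw [hv, norm_div, Complex.norm_real, ← dist_eq_norm, Real.norm_eq_abs, abs_of_pos hl0,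
      div_self hl0.ne']
  have hlv : y + l * v = x := by
    rw [hv, mul_div_cancel₀ _ hlne]
    ring
  classical
  -- a path starting at `x` is preceded by the segment from `y` to `x`
  set γ' : ℝ → ℂ := fun s => if s ≤ l then y + s * v else γ (s + -l) with hγ'
  have e1 : EqOn γ' (fun s : ℝ => y + s * v) (Icc 0 l) := fun s hs => if_pos hs.2
  have e2 : EqOn γ' (fun s => γ (s + -l)) (Icc l (l + L)) := by
    intro s hs
    rcases hs.1.eq_or_lt with h | h
    · subst h
      simp only [hγ', le_refl, if_true]
      rw [add_neg_cancel, hγ0, hlv]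
    · exact if_neg (not_le.2 h)
  have hsegD : ∀ s ∈ Icc 0 l, y + s * v ∈ D ∧ bdist D y / 2 ≤ bdist D (y + s * v) := by
    intro s hs
    have hd : dist (y + s * v) y ≤ l := by
      rw [dist_eq_norm, add_sub_cancel_left, norm_mul, hv1, mul_one, Complex.norm_real,
        Real.norm_eq_abs, abs_of_nonneg hs.1]
      exact hs.2
    have hl2 : l ≤ bdist D y / 2 := by nlinarith
    constructor
    · exact ball_bdist_subset hD hy (Metric.mem_ball.2 (by linarith))
    · have := bdist_le_add D y (y + s * v)
      rw [dist_comm] at this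
      linarith
  refine iInf_le_of_le (l + L) (iInf_le_of_le γ' (iInf_le_of_le (by positivity) (iInf_le_of_le ?_
    (iInf_le_of_le ?_ (iInf_le_of_le ?_ (iInf_le_of_le ?_ ?_))))))
  · refine HasUnitSpeedOn.Icc_Icc (y := l) (hasUnitSpeedOn_congr (hasUnitSpeedOn_line y hv1 _) e1) ?_
    have := hasUnitSpeedOn_comp_add hγ (-l)
    rw [zero_sub, neg_neg, sub_neg_eq_add, add_comm L] at this
    exact hasUnitSpeedOn_congr this e2
  · intro s hs
    rcases le_or_gt s l with h | h
    · rw [e1 ⟨hs.1, h⟩]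
      exact (hsegD s ⟨hs.1, h⟩).1
    · rw [e2 ⟨h.le, hs.2⟩]
      exact hγD ⟨by linarith, by linarith [hs.2]⟩
  · rw [e1 ⟨le_rfl, hl0.le⟩]
    simp
  · rw [e2 ⟨by linarith, le_rfl⟩]
    simp only [add_neg_cancel_comm, hγL]
  · have hsplit : Icc 0 (l + L) ⊆ Icc 0 l ∪ Icc l (l + L) := by
      intro s hs
      rcases le_total s l with h | h
      · exact Or.inl ⟨hs.1, h⟩
      · exact Or.inr ⟨h, hs.2⟩
    refine (lintegral_mono_set hsplit).trans ((lintegral_union_le _ _ _).trans ?_)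
    rw [add_comm]
    refine add_le_add ?_ ?_
    · have h1 : ∫⁻ s in Icc l (l + L), (Metric.infEDist (γ' s) (frontier D))⁻¹ =
          ∫⁻ s in Icc l (l + L), (Metric.infEDist (γ (s + -l)) (frontier D))⁻¹ :=
        setLIntegral_congr_fun measurableSet_Icc fun s hs => by rw [e2 hs]
      rw [h1]
      refine le_of_eq ?_
      rw [← lintegral_indicator measurableSet_Icc, ← lintegral_indicator measurableSet_Icc,
        ← lintegral_add_right_eq_self ((Icc 0 L).indicator _) (-l)]
      refine lintegral_congr fun s => ?_
      have : s ∈ Icc l (l + L) ↔ s + -l ∈ Icc 0 L := by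
        simp only [mem_Icc]
        constructor <;> rintro ⟨h1, h2⟩ <;> constructor <;> linarith
      by_cases hs : s ∈ Icc l (l + L)
      · rw [indicator_of_mem hs, indicator_of_mem (this.1 hs)]
      · rw [indicator_of_notMem hs, indicator_of_notMem (fun h => hs (this.2 h))]
    · calc ∫⁻ s in Icc 0 l, (Metric.infEDist (γ' s) (frontier D))⁻¹
          ≤ ∫⁻ _ in Icc 0 l, (ENNReal.ofReal (bdist D y / 2))⁻¹ := by
            refine setLIntegral_mono' measurableSet_Icc fun s hs => ?_
            rw [e1 hs, infEDist_eq_ofReal hne]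
            exact ENNReal.inv_le_inv.2 (ENNReal.ofReal_le_ofReal (hsegD s hs).2)
        _ = ENNReal.ofReal (l / (bdist D y / 2)) := by
            rw [setLIntegral_const, Real.volume_Icc, sub_zero,
              ENNReal.ofReal_div_of_pos (x := l) (y := bdist D y / 2) (by positivity),
              ENNReal.div_eq_inv_mul]
        _ ≤ ENNReal.ofReal (2 * ε) := by
            refine ENNReal.ofReal_le_ofReal ?_
            rw [div_le_iff₀ (by positivity)]
            linarith

/-- From a point at finite quasihyperbolic distance from `x₀` one can either reach `x₀` or come
closer to `x₀` by a definite amount within a short Euclidean step. -/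
theorem exists_step_towards (hD : IsOpen D) (hne : (frontier D).Nonempty) {x x₀ : ℂ} (hx : x ∈ D)
    (hfin : quasihyperbolicDist D x x₀ ≠ ⊤) :
    dist x x₀ ≤ bdist D x / 10 ∨ ∃ y ∈ D, dist x y ≤ bdist D x / 10 ∧
      quasihyperbolicDist D y x₀ + ENNReal.ofReal (1 / 12) ≤ quasihyperbolicDist D x x₀ := by
  have hδ := bdist_pos hD hne hx
  -- Follow an almost optimal path for the length `bdist D x / 10`: there the boundary is at distance
  -- at most `11 / 10 * bdist D x`, so this part costs at least `1 / 11`.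
  have hlt : quasihyperbolicDist D x x₀ <
      quasihyperbolicDist D x x₀ + ENNReal.ofReal (1 / 11 - 1 / 12) :=
    ENNReal.lt_add_right hfin (by simp; norm_num)
  conv_lhs at hlt => rw [quasihyperbolicDist]
  simp only [iInf_lt_iff] at hlt
  obtain ⟨L, γ, hL, hγ, hγD, hγ0, hγL, hcost⟩ := hlt
  set l := bdist D x / 10 with hl
  have hl0 : 0 < l := by positivity
  rcases le_or_gt L l with hLl | hLl
  · left
    have := dist_le_of_hasUnitSpeedOn hγ (a := 0) (b := L) ⟨le_rfl, hL⟩ ⟨hL, le_rfl⟩ hL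
    rw [hγ0, hγL] at this
    linarith
  right
  refine ⟨γ l, hγD ⟨hl0.le, hLl.le⟩, ?_, ?_⟩
  · have := dist_le_of_hasUnitSpeedOn hγ (a := 0) (b := l) ⟨le_rfl, hL⟩ ⟨hl0.le, hLl.le⟩ hl0.le
    rw [hγ0] at this
    linarith
  have htail : quasihyperbolicDist D (γ l) x₀ ≤
      ∫⁻ s in Ioc l L, (Metric.infEDist (γ s) (frontier D))⁻¹ := by
    rw [quasihyperbolicDist]
    refine iInf_le_of_le (L - l) (iInf_le_of_le (fun s => γ (s + l)) (iInf_le_of_le (by linarith)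
      (iInf_le_of_le ?_ (iInf_le_of_le ?_ (iInf_le_of_le ?_ (iInf_le_of_le ?_ ?_))))))
    · have := hasUnitSpeedOn_comp_add (hasUnitSpeedOn_mono hγ hl0.le le_rfl) l
      rwa [sub_self] at this
    · intro s hs
      exact hγD ⟨by linarith [hs.1], by linarith [hs.2]⟩
    · simp
    · simp [hγL]
    · rw [setLIntegral_congr (Ioc_ae_eq_Icc (a := (0 : ℝ)) (b := L - l)).symm]
      refine le_of_eq ?_
      rw [← lintegral_indicator measurableSet_Ioc, ← lintegral_indicator measurableSet_Ioc,
        ← lintegral_add_right_eq_self ((Ioc l L).indicator _) l]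
      refine lintegral_congr fun s => ?_
      have : s ∈ Ioc 0 (L - l) ↔ s + l ∈ Ioc l L := by
        simp only [mem_Ioc]
        constructor <;> rintro ⟨h1, h2⟩ <;> constructor <;> linarith
      by_cases hs : s ∈ Ioc 0 (L - l)
      · rw [indicator_of_mem hs, indicator_of_mem (this.1 hs)]
      · rw [indicator_of_notMem hs, indicator_of_notMem (fun h => hs (this.2 h))]
  have hhead : ENNReal.ofReal (1 / 11) ≤
      ∫⁻ s in Icc 0 l, (Metric.infEDist (γ s) (frontier D))⁻¹ := by
    calc ENNReal.ofReal (1 / 11) = ∫⁻ _ in Icc 0 l, (ENNReal.ofReal (11 / 10 * bdist D x))⁻¹ := by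
          rw [setLIntegral_const, Real.volume_Icc, sub_zero, ← ENNReal.div_eq_inv_mul,
            ← ENNReal.ofReal_div_of_pos (by positivity), hl]
          congr 1
          field_simp
      _ ≤ _ := by
          refine setLIntegral_mono' measurableSet_Icc fun s hs => ?_
          rw [infEDist_eq_ofReal hne]
          refine ENNReal.inv_le_inv.2 (ENNReal.ofReal_le_ofReal ?_)
          have h1 := dist_le_of_hasUnitSpeedOn hγ (a := 0) (b := s) ⟨le_rfl, hL⟩ ⟨hs.1, hs.2.trans hLl.le⟩ hs.1
          rw [hγ0, dist_comm] at h1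
          have h2 := bdist_le_add D (γ s) x
          have h3 := hs.2
          linarith
  have hsplit : ∫⁻ s in Icc 0 L, (Metric.infEDist (γ s) (frontier D))⁻¹ =
      (∫⁻ s in Icc 0 l, (Metric.infEDist (γ s) (frontier D))⁻¹) +
        ∫⁻ s in Ioc l L, (Metric.infEDist (γ s) (frontier D))⁻¹ := by
    rw [← Icc_union_Ioc_eq_Icc hl0.le hLl.le, lintegral_union measurableSet_Ioc]
    rw [disjoint_left]
    rintro s hs1 hs2
    exact absurd hs1.2 (not_le.2 hs2.1)
  rw [hsplit] at hcost
  have h1 : ENNReal.ofReal (1 / 11) + quasihyperbolicDist D (γ l) x₀ ≤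
      quasihyperbolicDist D x x₀ + ENNReal.ofReal (1 / 11 - 1 / 12) :=
    (add_le_add hhead htail).trans hcost.le
  have h2 : ENNReal.ofReal (1 / 11) =
      ENNReal.ofReal (1 / 12) + ENNReal.ofReal (1 / 11 - 1 / 12) := by
    rw [← ENNReal.ofReal_add (by norm_num) (by norm_num)]
    norm_num
  rw [h2, add_comm (ENNReal.ofReal (1 / 12)), add_assoc, add_comm (quasihyperbolicDist D x x₀)] at h1
  have h3 := (ENNReal.add_le_add_iff_left ENNReal.ofReal_ne_top).1 h1
  rwa [add_comm] at h3

end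


/-! ### Forests and a discrete Hardy inequality -/

section Tree

variable {ι : Type*}

/-- In the forest with parent map `p` and depth function `dep`, `j` is a descendant of `i`. -/
def IsDesc (p : ι → ι) (dep : ι → ℕ) (i j : ι) : Prop := dep i ≤ dep j ∧ p^[dep j - dep i] j = i

variable {p : ι → ι} {dep : ι → ℕ}

theorem dep_iterate (hdep : ∀ i, dep i ≠ 0 → dep (p i) + 1 = dep i) (j : ι) {m : ℕ}
    (hm : m ≤ dep j) : dep (p^[m] j) = dep j - m := by
  induction m with
  | zero => simp
  | succ m ih =>
    rw [Function.iterate_succ_apply']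
    have h1 := ih (by omega)
    have h2 := hdep (p^[m] j) (by omega)
    omega

theorem isDesc_iterate (hdep : ∀ i, dep i ≠ 0 → dep (p i) + 1 = dep i) {i j : ι}
    (h : IsDesc p dep i j) {m : ℕ} (hm : m ≤ dep j - dep i) : IsDesc p dep i (p^[m] j) := by
  have h1 := dep_iterate hdep j (m := m) (by omega)
  refine ⟨by have := h.1; omega, ?_⟩
  rw [← Function.iterate_add_apply, h1]
  have : dep j - m - dep i + m = dep j - dep i := by omega
  rw [this, h.2]

theorem isDesc_child (hdep : ∀ i, dep i ≠ 0 → dep (p i) + 1 = dep i) {i j : ι}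
    (h : IsDesc p dep i j) (hij : i ≠ j) :
    ∃ c, p c = i ∧ dep c = dep i + 1 ∧ IsDesc p dep c j := by
  have hlt : dep i < dep j := by
    rcases h.1.eq_or_lt with h1 | h1
    · exact absurd (by simpa [h1] using h.2.symm) hij
    · exact h1
  refine ⟨p^[dep j - dep i - 1] j, ?_, ?_, ?_, ?_⟩
  · rw [← Function.iterate_succ_apply' p]
    have : (dep j - dep i - 1).succ = dep j - dep i := by omega
    rw [this, h.2]
  · rw [dep_iterate hdep j (by omega)]
    omega
  · rw [dep_iterate hdep j (by omega)]
    omega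
  · rw [dep_iterate hdep j (by omega)]
    congr 1
    omega

/-- Every node has exactly one ancestor at each depth up to its own. -/
theorem tsum_isDesc (hdep : ∀ i, dep i ≠ 0 → dep (p i) + 1 = dep i) (A : ℕ → ENNReal) (j : ι)
    [∀ i j, Decidable (IsDesc p dep i j)] :
    ∑' i, (if IsDesc p dep i j then A (dep i) else 0) = ∑ n ∈ Finset.range (dep j + 1), A n := by
  classical
  set s : Finset ι := (Finset.range (dep j + 1)).image fun n => p^[dep j - n] j with hs
  have hdepn : ∀ n, n ≤ dep j → dep (p^[dep j - n] j) = n := by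
    intro n hn
    rw [dep_iterate hdep j (by omega)]
    omega
  rw [tsum_eq_sum (s := s)]
  · rw [hs, Finset.sum_image]
    · refine Finset.sum_congr rfl fun n hn => ?_
      have hn' : n ≤ dep j := by
        have := Finset.mem_range.1 hn
        omega
      have : IsDesc p dep (p^[dep j - n] j) j := by
        refine ⟨by rw [hdepn n hn']; exact hn', by rw [hdepn n hn']⟩
      rw [if_pos this, hdepn n hn']
    · intro n hn m hm hnm
      have h1 := hdepn n (by have := Finset.mem_range.1 hn; omega)
      have h2 := hdepn m (by have := Finset.mem_range.1 hm; omega)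
      simp only at hnm
      rw [← h1, ← h2, hnm]
  · intro i hi
    refine if_neg fun h => hi ?_
    rw [hs, Finset.mem_image]
    exact ⟨dep i, Finset.mem_range.2 (by have := h.1; omega), h.2⟩

/-- The weight `(n + 1)^(-1/2)` in Hardy's inequality. -/
noncomputable def hardyWeight (n : ℕ) : ℝ := 1 / √(n + 1)

theorem hardyWeight_pos (n : ℕ) : 0 < hardyWeight n := by
  unfold hardyWeight
  positivity

theorem hardyWeight_sub_pos (n : ℕ) : 0 < hardyWeight n - hardyWeight (n + 1) := by
  unfold hardyWeight
  rw [sub_pos]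
  refine one_div_lt_one_div_of_lt (by positivity) (Real.sqrt_lt_sqrt (by positivity) ?_)
  push_cast
  linarith

theorem sum_hardyWeight_le (n : ℕ) :
    ∑ k ∈ Finset.range (n + 1), hardyWeight k ≤ 2 * √(n + 1) := by
  induction n with
  | zero => simp [hardyWeight]
  | succ n ih =>
    rw [Finset.sum_range_succ]
    set s := √((n : ℝ) + 1) with hs
    set t := √((n : ℝ) + 1 + 1) with ht
    have hs0 : 0 < s := by positivity
    have ht0 : 0 < t := by positivity
    have hs2 : s ^ 2 = n + 1 := Real.sq_sqrt (by positivity)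
    have ht2 : t ^ 2 = n + 1 + 1 := Real.sq_sqrt (by positivity)
    have hw : hardyWeight (n + 1) = 1 / t := by
      rw [hardyWeight, ht]
      push_cast
      rfl
    rw [hw]
    push_cast
    rw [← ht]
    have : 1 / t ≤ 2 * t - 2 * s := by
      rw [div_le_iff₀ ht0]
      nlinarith [sq_nonneg (t - s)]
    linarith

/-- The weights are chosen so that their partial sums, divided by the corresponding increments, grow
quadratically. -/
theorem hardy_const (n : ℕ) :
    (∑ k ∈ Finset.range (n + 1), hardyWeight k) / (hardyWeight n - hardyWeight (n + 1)) ≤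
      12 * ((n : ℝ) + 1) ^ 2 := by
  rw [div_le_iff₀ (hardyWeight_sub_pos n)]
  refine (sum_hardyWeight_le n).trans ?_
  set s := √((n : ℝ) + 1) with hs
  set t := √((n : ℝ) + 1 + 1) with ht
  have hs0 : 0 < s := by positivity
  have ht0 : 0 < t := by positivity
  have hs2 : s ^ 2 = n + 1 := Real.sq_sqrt (by positivity)
  have ht2 : t ^ 2 = n + 1 + 1 := Real.sq_sqrt (by positivity)
  have hw : hardyWeight (n + 1) = 1 / t := by
    rw [hardyWeight, ht]
    push_cast
    rfl
  have hw' : hardyWeight n = 1 / s := rfl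
  rw [hw, hw', ← hs2]
  have hst : 1 / s - 1 / t = 1 / (s * t * (t + s)) := by
    have : (t - s) * (t + s) = 1 := by nlinarith
    field_simp
    linarith
  rw [hst]
  have hn0 : (0 : ℝ) ≤ n := n.cast_nonneg
  have ht2s : t ≤ 2 * s := by nlinarith
  rw [mul_one_div, le_div_iff₀ (by positivity)]
  have h1 : s * t * (t + s) ≤ s * (2 * s) * (2 * s + s) := by gcongr
  calc 2 * s * (s * t * (t + s)) ≤ 2 * s * (s * (2 * s) * (2 * s + s)) := by gcongr
    _ = 12 * (s ^ 2) ^ 2 := by ring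

/-- A parent map that lowers a nonnegative function by a definite amount at every non-root gives
rise to a depth function. -/
theorem exists_depth {p : ι → ι} {Rt : ι → Prop} {κ : ι → ℝ} (hκ : ∀ i, 0 ≤ κ i) {η : ℝ}
    (hη : 0 < η) (hp : ∀ i, ¬ Rt i → κ (p i) + η ≤ κ i) :
    ∃ dep : ι → ℕ, (∀ i, dep i = 0 → Rt i) ∧ (∀ i, dep i ≠ 0 → dep (p i) + 1 = dep i) ∧
      ∀ i, dep i * η ≤ κ i := by
  classical
  have hdesc : ∀ i (n : ℕ), (∀ m < n, ¬ Rt (p^[m] i)) → κ (p^[n] i) + n * η ≤ κ i := by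
    intro i n
    induction n with
    | zero => intro _; simp
    | succ n ih =>
      intro h
      have h1 := ih fun m hm => h m (by omega)
      have h2 := hp _ (h n (by omega))
      rw [Function.iterate_succ_apply']
      push_cast
      linarith
  have hex : ∀ i, ∃ m, Rt (p^[m] i) := by
    intro i
    by_contra hcon
    push Not at hcon
    obtain ⟨n, hn⟩ := exists_nat_gt (κ i / η)
    rw [div_lt_iff₀ hη] at hn
    have h1 := hdesc i n fun m _ => hcon m
    linarith [hκ (p^[n] i)]
  refine ⟨fun i => Nat.find (hex i), fun i hi => ?_, fun i hi => ?_, fun i => ?_⟩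
  · simpa using (Nat.find_eq_zero (hex i)).1 hi
  · have h0 : ¬ Rt (p^[0] i) := fun h => hi ((Nat.find_eq_zero (hex i)).2 h)
    exact (Nat.find_comp_succ (hex i) (hex (p i)) h0).symm
  · have h1 := hdesc i (Nat.find (hex i)) fun m hm => Nat.find_min (hex i) hm
    linarith [hκ (p^[Nat.find (hex i)] i)]

/-- Hardy's inequality on a forest: the total lengths of descending paths, as functions of the
starting node, are square summable. -/
theorem exists_path_bound (hdep : ∀ i, dep i ≠ 0 → dep (p i) + 1 = dep i) {δ : ι → ℝ}
    (hsum : ∑' i, ENNReal.ofReal (δ i ^ 2 * ((dep i : ℝ) + 1) ^ 2) ≠ ⊤) :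
    ∃ S : ι → ℝ, (∀ i, 0 ≤ S i) ∧ (∑' i, ENNReal.ofReal (S i) ^ 2 ≠ ⊤) ∧
      ∀ i j, IsDesc p dep i j → ∑ m ∈ Finset.range (dep j - dep i), δ (p^[m] j) ≤ S i := by
  classical
  set b : ℕ → ℝ := fun n => hardyWeight n - hardyWeight (n + 1) with hb
  have hb0 : ∀ n, 0 < b n := hardyWeight_sub_pos
  set q : ι → ENNReal := fun l => ENNReal.ofReal (δ l ^ 2 / b (dep l)) with hq
  set Q : ι → ENNReal := fun i =>
    ENNReal.ofReal (hardyWeight (dep i)) * ∑' l, if IsDesc p dep i l then q l else 0 with hQ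
  have hQsum : ∑' i, Q i ≤ 12 * ∑' i, ENNReal.ofReal (δ i ^ 2 * ((dep i : ℝ) + 1) ^ 2) := by
    calc ∑' i, Q i
        = ∑' i, ∑' l, q l * (if IsDesc p dep i l then ENNReal.ofReal (hardyWeight (dep i)) else 0) := by
          refine tsum_congr fun i => ?_
          simp only [hQ]
          rw [← ENNReal.tsum_mul_left]
          refine tsum_congr fun l => ?_
          split_ifs <;> simp [mul_comm]
      _ = ∑' l, q l * ∑ n ∈ Finset.range (dep l + 1), ENNReal.ofReal (hardyWeight n) := by
          rw [ENNReal.tsum_comm]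
          refine tsum_congr fun l => ?_
          rw [ENNReal.tsum_mul_left, tsum_isDesc hdep (fun n => ENNReal.ofReal (hardyWeight n))]
      _ ≤ ∑' l, 12 * ENNReal.ofReal (δ l ^ 2 * ((dep l : ℝ) + 1) ^ 2) := by
          refine ENNReal.tsum_le_tsum fun l => ?_
          rw [← ENNReal.ofReal_sum_of_nonneg (fun n _ => (hardyWeight_pos n).le), hq,
            ← ENNReal.ofReal_mul (by have := hb0 (dep l); positivity)]
          rw [show (12 : ENNReal) = ENNReal.ofReal 12 by simp, ← ENNReal.ofReal_mul (by norm_num)]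
          refine ENNReal.ofReal_le_ofReal ?_
          have h1 := hardy_const (dep l)
          calc δ l ^ 2 / b (dep l) * ∑ n ∈ Finset.range (dep l + 1), hardyWeight n
              = δ l ^ 2 * ((∑ n ∈ Finset.range (dep l + 1), hardyWeight n) / b (dep l)) := by ring
            _ ≤ δ l ^ 2 * (12 * ((dep l : ℝ) + 1) ^ 2) := by gcongr
            _ = 12 * (δ l ^ 2 * ((dep l : ℝ) + 1) ^ 2) := by ring
      _ = _ := ENNReal.tsum_mul_left
  have hQtop : ∑' i, Q i ≠ ⊤ := ne_top_of_le_ne_top (ENNReal.mul_ne_top (by simp) hsum) hQsum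
  have hQi : ∀ i, Q i ≠ ⊤ := fun i => ENNReal.ne_top_of_tsum_ne_top hQtop i
  refine ⟨fun i => √(Q i).toReal, fun i => Real.sqrt_nonneg _, ?_, ?_⟩
  · have : ∀ i, ENNReal.ofReal √(Q i).toReal ^ 2 = Q i := fun i => by
      rw [← ENNReal.ofReal_pow (Real.sqrt_nonneg _), Real.sq_sqrt ENNReal.toReal_nonneg,
        ENNReal.ofReal_toReal (hQi i)]
    simpa only [this] using hQtop
  · intro i j hij
    refine Real.le_sqrt_of_sq_le ?_
    set M := dep j - dep i with hM
    have hM' : dep i + M = dep j := by have := hij.1; omega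
    have hdm : ∀ m ∈ Finset.range M, dep (p^[m] j) = dep j - m := fun m hm =>
      dep_iterate hdep j (by have := Finset.mem_range.1 hm; omega)
    -- Cauchy-Schwarz with the telescoping weights `b`
    have hcs : (∑ m ∈ Finset.range M, δ (p^[m] j)) ^ 2 ≤
        (∑ m ∈ Finset.range M, b (dep (p^[m] j))) *
          ∑ m ∈ Finset.range M, δ (p^[m] j) ^ 2 / b (dep (p^[m] j)) := by
      refine Finset.sum_sq_le_sum_mul_sum_of_sq_le_mul _ (fun m _ => (hb0 _).le)
        (fun m _ => div_nonneg (sq_nonneg _) (hb0 _).le) fun m _ => ?_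
      rw [mul_div_cancel₀ _ (hb0 _).ne']
    have htel : ∑ m ∈ Finset.range M, b (dep (p^[m] j)) ≤ hardyWeight (dep i) := by
      have h1 : ∑ m ∈ Finset.range M, b (dep (p^[m] j)) =
          ∑ m ∈ Finset.range M, b (dep i + 1 + m) := by
        rw [← Finset.sum_range_reflect]
        refine Finset.sum_congr rfl fun m hm => ?_
        have hm' := Finset.mem_range.1 hm
        rw [hdm _ (Finset.mem_range.2 (by omega))]
        congr 1
        omega
      have h2 : ∀ K, ∑ m ∈ Finset.range K, b (dep i + 1 + m) =
          hardyWeight (dep i + 1) - hardyWeight (dep i + 1 + K) := by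
        intro K
        induction K with
        | zero => simp
        | succ K ih =>
          rw [Finset.sum_range_succ, ih, hb]
          simp only
          rw [← add_assoc]
          ring
      rw [h1, h2]
      linarith [hardyWeight_pos (dep i + 1 + M), hardyWeight_sub_pos (dep i)]
    have hpath : ENNReal.ofReal (∑ m ∈ Finset.range M, δ (p^[m] j) ^ 2 / b (dep (p^[m] j))) ≤
        ∑' l, if IsDesc p dep i l then q l else 0 := by
      rw [ENNReal.ofReal_sum_of_nonneg fun m _ => div_nonneg (sq_nonneg _) (hb0 _).le]
      have hinj : Set.InjOn (fun m => p^[m] j) (Finset.range M : Set ℕ) := by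
        intro m hm n hn hmn
        have h1 := hdm m (by simpa using hm)
        have h2 := hdm n (by simpa using hn)
        have h3 : m < M := by simpa using hm
        have h4 : n < M := by simpa using hn
        simp only at hmn
        rw [hmn] at h1
        omega
      calc ∑ m ∈ Finset.range M, ENNReal.ofReal (δ (p^[m] j) ^ 2 / b (dep (p^[m] j)))
          = ∑ l ∈ (Finset.range M).image (fun m => p^[m] j),
              if IsDesc p dep i l then q l else 0 := by
            rw [Finset.sum_image hinj]
            refine Finset.sum_congr rfl fun m hm => ?_
            rw [if_pos (isDesc_iterate hdep hij (by have := Finset.mem_range.1 hm; omega))]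
        _ ≤ _ := ENNReal.sum_le_tsum _
    have hfin : ENNReal.ofReal ((∑ m ∈ Finset.range M, δ (p^[m] j)) ^ 2) ≤ Q i := by
      refine (ENNReal.ofReal_le_ofReal hcs).trans ?_
      rw [ENNReal.ofReal_mul (Finset.sum_nonneg fun m _ => (hb0 _).le), hQ]
      exact mul_le_mul' (ENNReal.ofReal_le_ofReal htel) hpath
    exact (ENNReal.ofReal_le_iff_le_toReal (hQi i)).1 hfin

theorem tendsto_tsum_dep_gt (dep : ι → ℕ) {g : ι → ENNReal} (hg : ∑' i, g i ≠ ⊤) :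
    Tendsto (fun n => ∑' i, if n < dep i then g i else 0) atTop (𝓝 0) := by
  classical
  rw [ENNReal.tendsto_atTop_zero]
  intro ε hε
  have h := ENNReal.tendsto_tsum_compl_atTop_zero hg
  obtain ⟨s, hs⟩ := ((ENNReal.tendsto_nhds_zero.1 h ε hε).exists)
  refine ⟨s.sup dep, fun n hn => le_trans ?_ hs⟩
  have e : ∑' b : { x // x ∉ s }, g b = ∑' i, ({x | x ∉ s}).indicator g i :=
    tsum_subtype {x | x ∉ s} g
  rw [e]
  refine ENNReal.tsum_le_tsum fun i => ?_
  split_ifs with hi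
  · rw [indicator_of_mem]
    intro his
    have := Finset.le_sup (f := dep) his
    omega
  · exact zero_le

/-- Limits of a map `F` along infinite branches of a forest that stay in a set `J` over which the
increments of `F` are summable form a set of linear measure zero. -/
theorem volume_image_branch_limits [Countable ι] {F : ι → ℂ} {J : Set ι}
    (hJ : ∑' i, J.indicator (fun i => edist (F i) (F (p i))) i ≠ ⊤) {Z : Set ℂ}
    (hZ : ∀ z ∈ Z, ∃ c : ℕ → ι, (∀ m, c m ∈ J) ∧ (∀ m, dep (c m) = m) ∧
      (∀ m, p (c (m + 1)) = c m) ∧ Tendsto (fun m => F (c m)) atTop (𝓝 z))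
    {h : ℂ → ℝ} (hh : LipschitzWith 1 h) : volume (h '' Z) = 0 := by
  classical
  set g : ι → ENNReal := J.indicator (fun i => edist (F i) (F (p i))) with hg
  set T : ι → ENNReal := fun i => ∑' j, if dep i < dep j ∧ IsDesc p dep i j then g j else 0 with hT
  -- the limit along a branch is at distance at most `T (c n)` from the value at its node of depth `n`
  have hcover : ∀ n, h '' Z ⊆ ⋃ i, if dep i = n then h '' Metric.closedEBall (F i) (T i) else ∅ := by
    rintro n _ ⟨z, hz, rfl⟩
    obtain ⟨c, hcJ, hcd, hcp, hct⟩ := hZ z hz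
    refine mem_iUnion.2 ⟨c n, ?_⟩
    rw [if_pos (hcd n)]
    refine mem_image_of_mem h (Metric.mem_closedEBall.2 ?_)
    rw [edist_comm]
    have h1 := edist_le_tsum_of_edist_le_of_tendsto₀ (f := fun m => F (c (n + m)))
      (fun m => g (c (n + m + 1))) (fun m => by
        rw [hg, indicator_of_mem (hcJ _), hcp, edist_comm]
        rfl) (hct.comp (tendsto_add_atTop_nat n |>.congr fun m => by rw [add_comm])) 
    refine h1.trans ?_
    have hinj : Function.Injective fun m => c (n + m + 1) := by
      intro m m' hmm
      have := congrArg dep hmm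
      simp only [hcd] at this
      omega
    have hanc : ∀ m, p^[m] (c (n + m)) = c n := by
      intro m
      induction m with
      | zero => rfl
      | succ m ih => rw [Function.iterate_succ_apply, ← add_assoc, hcp, ih]
    refine le_trans (le_of_eq ?_) (ENNReal.tsum_comp_le_tsum_of_injective hinj
      fun j => if dep (c n) < dep j ∧ IsDesc p dep (c n) j then g j else 0)
    refine tsum_congr fun m => ?_
    rw [if_pos]
    simp only [IsDesc, hcd]
    refine ⟨by omega, by omega, ?_⟩
    have : n + m + 1 - n = m + 1 := by omega
    rw [this]
    exact hanc (m + 1)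
  have hbound : ∀ n, volume (h '' Z) ≤ 2 * ∑' j, if n < dep j then g j else 0 := by
    intro n
    calc volume (h '' Z)
        ≤ ∑' i, volume (if dep i = n then h '' Metric.closedEBall (F i) (T i) else ∅) :=
          (measure_mono (hcover n)).trans (measure_iUnion_le _)
      _ ≤ ∑' i, ∑' j, 2 * if n < dep j ∧ (dep i = n ∧ IsDesc p dep i j) then g j else 0 := by
          refine ENNReal.tsum_le_tsum fun i => ?_
          by_cases hi : dep i = n
          · rw [if_pos hi]
            refine (Real.volume_le_diam _).trans ?_
            have h2 : Metric.ediam (h '' Metric.closedEBall (F i) (T i)) ≤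
                Metric.ediam (Metric.closedEBall (F i) (T i)) := by
              simpa using hh.ediam_image_le (Metric.closedEBall (F i) (T i))
            refine h2.trans (Metric.ediam_closedEBall_le.trans ?_)
            rw [ENNReal.tsum_mul_left, hT]
            simp only [hi, true_and, le_refl]
          · rw [if_neg hi]
            simp
      _ = ∑' j, ∑' i, 2 * if n < dep j ∧ (dep i = n ∧ IsDesc p dep i j) then g j else 0 :=
          ENNReal.tsum_comm
      _ ≤ ∑' j, 2 * if n < dep j then g j else 0 := by
          refine ENNReal.tsum_le_tsum fun j => ?_
          rw [ENNReal.tsum_mul_left]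
          gcongr
          by_cases hj : n < dep j
          · rw [tsum_eq_single (p^[dep j - n] j)]
            · split_ifs <;> simp
            · intro i hi
              refine if_neg ?_
              rintro ⟨-, h1, h2⟩
              refine hi ?_
              rw [← h1]
              exact h2.2.symm
          · simp [hj]
      _ = _ := ENNReal.tsum_mul_left
  have hlim := ENNReal.Tendsto.const_mul (a := 2) (tendsto_tsum_dep_gt dep hJ) (Or.inr (by simp))
  rw [mul_zero] at hlim
  exact le_antisymm (ge_of_tendsto' hlim hbound) zero_le

end Tree


/-! ### Discretization of the quasihyperbolic condition -/

section Net

variable {D : Set ℂ}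

/-- A maximal set of points in `D` whose distances are large compared with the scale `δ`. -/
theorem exists_net {δ : ℂ → ℝ} (hδ : ∀ z ∈ D, 0 < δ z) {ε : ℝ} (hε : 0 < ε) :
    ∃ N ⊆ D, (∀ x ∈ N, ∀ y ∈ N, x ≠ y → ε * (δ x + δ y) ≤ dist x y) ∧
      ∀ y ∈ D, ∃ x ∈ N, dist y x < ε * (δ y + δ x) := by
  obtain ⟨N, hN⟩ := zorn_subset
    {N : Set ℂ | N ⊆ D ∧ ∀ x ∈ N, ∀ y ∈ N, x ≠ y → ε * (δ x + δ y) ≤ dist x y} (by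
      intro c hc hchain
      refine ⟨⋃₀ c, ⟨sUnion_subset fun s hs => (hc hs).1, ?_⟩, fun s hs => subset_sUnion_of_mem hs⟩
      rintro x ⟨s, hs, hxs⟩ y ⟨t, ht, hyt⟩ hxy
      rcases hchain.total hs ht with h | h
      · exact (hc ht).2 x (h hxs) y hyt hxy
      · exact (hc hs).2 x hxs y (h hyt) hxy)
  refine ⟨N, hN.prop.1, hN.prop.2, fun y hy => ?_⟩
  by_contra hcon
  push Not at hcon
  have hins : insert y N ∈
      {N : Set ℂ | N ⊆ D ∧ ∀ x ∈ N, ∀ y ∈ N, x ≠ y → ε * (δ x + δ y) ≤ dist x y} := by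
    refine ⟨insert_subset hy hN.prop.1, ?_⟩
    rintro x (rfl | hx) z (rfl | hz) hxz
    · exact absurd rfl hxz
    · exact hcon z hz
    · rw [dist_comm, add_comm]
      exact hcon x hx
    · exact hN.prop.2 x hx z hz hxz
  have hyN : y ∈ N := hN.le_of_ge hins (subset_insert _ _) (mem_insert _ _)
  have := hcon y hyN
  rw [dist_self] at this
  have h2 := hδ y hy
  nlinarith

theorem disjoint_ball_of_separated {N : Set ℂ} {δ : ℂ → ℝ} {ε : ℝ}
    (hsep : ∀ x ∈ N, ∀ y ∈ N, x ≠ y → ε * (δ x + δ y) ≤ dist x y) :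
    Pairwise (Function.onFun Disjoint fun i : N => Metric.ball (i : ℂ) (ε * δ i)) := by
  intro i j hij
  refine Metric.ball_disjoint_ball ?_
  have := hsep i i.2 j j.2 (fun h => hij (Subtype.ext h))
  linarith

theorem countable_of_separated {N : Set ℂ} {δ : ℂ → ℝ} {ε : ℝ} (hε : 0 < ε)
    (hδ : ∀ z ∈ N, 0 < δ z)
    (hsep : ∀ x ∈ N, ∀ y ∈ N, x ≠ y → ε * (δ x + δ y) ≤ dist x y) : Countable N := by
  refine Set.countable_univ_iff.1 (Set.PairwiseDisjoint.countable_of_isOpen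
    (s := fun i : N => Metric.ball (i : ℂ) (ε * δ i)) ?_ (fun _ _ => Metric.isOpen_ball) ?_)
  · exact fun i _ j _ hij => disjoint_ball_of_separated hsep hij
  · exact fun i _ => ⟨i, Metric.mem_ball_self (mul_pos hε (hδ i i.2))⟩

/-- A separated net has only finitely many points far from the boundary. -/
theorem finite_of_separated (hD : Bornology.IsBounded D) {N : Set ℂ} {δ : ℂ → ℝ}
    {ε : ℝ} (hε : 0 < ε) (hball : ∀ z ∈ N, Metric.ball z (ε * δ z) ⊆ D)
    (hsep : ∀ x ∈ N, ∀ y ∈ N, x ≠ y → ε * (δ x + δ y) ≤ dist x y) {η : ℝ} (hη : 0 < η) :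
    {i : N | η ≤ δ i}.Finite := by
  have h := Measure.finite_const_le_meas_of_disjoint_iUnion (volume : Measure ℂ)
    (ε := volume (Metric.ball (0 : ℂ) (ε * η))) (Metric.measure_ball_pos _ _ (mul_pos hε hη))
    (fun i : N => measurableSet_ball (x := (i : ℂ)) (ε := ε * δ i)) (disjoint_ball_of_separated hsep)
    (ne_top_of_le_ne_top hD.measure_lt_top.ne
      (measure_mono (iUnion_subset fun i : N => hball i i.2)))
  refine h.subset fun i hi => ?_
  rw [mem_ofPred_eq, Complex.volume_ball, Complex.volume_ball]
  gcongr
  exact hi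

/-- The disks around the points of a separated net, of radii comparable to the distance to the
boundary, overlap a bounded number of times. -/
theorem tsum_indicator_ball_le (hD : IsOpen D) (hne : (frontier D).Nonempty)
    {N : Set ℂ} (hND : N ⊆ D)
    (hsep : ∀ x ∈ N, ∀ y ∈ N, x ≠ y → 1 / 100 * (bdist D x + bdist D y) ≤ dist x y) (z : ℂ) :
    ∑' i : N, (Metric.ball (i : ℂ) (bdist D i / 4)).indicator (fun _ => (1 : ENNReal)) z ≤
      62500 := by
  classical
  by_cases hz : z ∈ D
  swap
  · have : ∀ i : N, (Metric.ball (i : ℂ) (bdist D i / 4)).indicator (fun _ => (1 : ENNReal)) z = 0 := by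
      intro i
      refine indicator_of_notMem (fun h => hz (ball_bdist_subset hD (hND i.2) ?_)) _
      exact Metric.ball_subset_ball (by linarith [bdist_nonneg D (i : ℂ)]) h
    simp [this]
  have hδ := bdist_pos hD hne hz
  set v := volume (Metric.ball z (1 / 125 * bdist D z)) with hv
  obtain ⟨hv0, hvt⟩ := volume_ball_pos_ne_top z (show 0 < 1 / 125 * bdist D z by positivity)
  -- A point `i` counted here has `3 / 4 ≤ bdist D z / bdist D i ≤ 5 / 4`. The disjoint disks of radius
  -- `bdist D i / 100 ≥ bdist D z / 125` lie in a disk of area `(2 * 125) ^ 2 * v`.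
  have hcoef : volume (Metric.ball z (2 * bdist D z)) = 62500 * v := by
    rw [hv, Complex.volume_ball, Complex.volume_ball, ENNReal.ofReal_mul (by norm_num),
      ENNReal.ofReal_mul (by norm_num), mul_pow, mul_pow, ← mul_assoc, ← mul_assoc]
    congr 2
    rw [← ENNReal.ofReal_pow (by norm_num), ← ENNReal.ofReal_pow (by norm_num),
      show (62500 : ENNReal) = ENNReal.ofReal 62500 by simp, ← ENNReal.ofReal_mul (by norm_num)]
    norm_num
  refine (ENNReal.mul_le_mul_iff_left hv0 hvt).1 ?_
  rw [← hcoef, ← ENNReal.tsum_mul_right]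
  calc ∑' i : N, (Metric.ball (i : ℂ) (bdist D i / 4)).indicator (fun _ => (1 : ENNReal)) z * v
      ≤ ∑' i : N, volume (Metric.ball (i : ℂ) (1 / 100 * bdist D i) ∩
          Metric.ball z (2 * bdist D z)) := by
        refine ENNReal.tsum_le_tsum fun i => ?_
        by_cases hi : z ∈ Metric.ball (i : ℂ) (bdist D i / 4)
        · rw [indicator_of_mem hi, one_mul]
          have hd := Metric.mem_ball.1 hi
          have h1 := bdist_le_add D z i
          have h2 := bdist_le_add D i z
          rw [dist_comm] at h2
          rw [inter_eq_self_of_subset_left]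
          · rw [hv, Complex.volume_ball, Complex.volume_ball]
            gcongr ENNReal.ofReal ?_ ^ 2 * _
            linarith
          · refine Metric.ball_subset_ball' ?_
            rw [dist_comm]
            linarith
        · rw [indicator_of_notMem hi, zero_mul]
          exact zero_le
    _ = volume (⋃ i : N, Metric.ball (i : ℂ) (1 / 100 * bdist D i) ∩
          Metric.ball z (2 * bdist D z)) := by
        have := countable_of_separated (by norm_num) (fun x hx => bdist_pos hD hne (hND hx)) hsep
        rw [measure_iUnion]
        · exact fun i j hij => (disjoint_ball_of_separated hsep hij).mono inter_subset_left
            inter_subset_left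
        · exact fun i => measurableSet_ball.inter measurableSet_ball
    _ ≤ _ := measure_mono (iUnion_subset fun i => inter_subset_right)

theorem add_one_sq_le (a : ENNReal) : (a + 1) ^ 2 ≤ 2 * a ^ 2 + 2 := by
  by_cases ha : a = ⊤
  · simp [ha]
  lift a to NNReal using ha
  have h : (a + 1) ^ 2 ≤ 2 * a ^ 2 + 2 := by
    refine add_sq_le.trans (le_of_eq ?_)
    ring
  exact_mod_cast h

/-- The discrete form of the quasihyperbolic condition: a Whitney net of `D` with a forest structure
in which parents are adjacent, roots are close to `x₀`, and the depth, weighted by the size of the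
Whitney disks, is square summable. -/
theorem exists_forest (hD : IsOpen D) (hbd : Bornology.IsBounded D) (hne : (frontier D).Nonempty)
    {x₀ : ℂ} (hk : ∫⁻ x in D, quasihyperbolicDist D x x₀ ^ 2 ≠ ⊤) :
    ∃ (N : Set ℂ) (p : N → N) (dep : N → ℕ), N ⊆ D ∧
      (∀ x ∈ N, ∀ y ∈ N, x ≠ y → 1 / 100 * (bdist D x + bdist D y) ≤ dist x y) ∧
      (∀ y ∈ D, ∃ x ∈ N, dist y x < 1 / 100 * (bdist D y + bdist D x)) ∧
      (∀ i, dep i ≠ 0 → dep (p i) + 1 = dep i) ∧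
      (∀ i : N, dist (i : ℂ) (p i) ≤ bdist D i / 8) ∧
      (∀ i : N, dep i = 0 → dist (i : ℂ) x₀ ≤ bdist D i / 10) ∧
      ∑' i : N, ENNReal.ofReal (bdist D i ^ 2 * ((dep i : ℝ) + 1) ^ 2) ≠ ⊤ := by
  classical
  obtain ⟨N, hND, hsep, hcov⟩ := exists_net (δ := bdist D) (fun z hz => bdist_pos hD hne hz)
    (show (0 : ℝ) < 1 / 100 by norm_num)
  have hpos : ∀ i : N, 0 < bdist D i := fun i => bdist_pos hD hne (hND i.2)
  have hcount := countable_of_separated (by norm_num) (fun x hx => bdist_pos hD hne (hND hx)) hsep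
  set k : ℂ → ENNReal := fun x => quasihyperbolicDist D x x₀ with hkdef
  have hBD : ∀ i : N, Metric.ball (i : ℂ) (1 / 100 * bdist D i) ⊆ D := fun i =>
    (Metric.ball_subset_ball (by linarith [hpos i])).trans (ball_bdist_subset hD (hND i.2))
  have hkB : ∀ i : N, ∀ x ∈ Metric.ball (i : ℂ) (1 / 100 * bdist D i), k i ≤ k x + 1 := by
    intro i x hx
    refine (quasihyperbolicDist_le_add hD hne (hND i.2) (ε := 1 / 100) (by norm_num)
      (Metric.mem_ball.1 hx).le).trans ?_
    gcongr
    rw [← ENNReal.ofReal_one]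
    exact ENNReal.ofReal_le_ofReal (by norm_num)
  have hfin : ∀ i : N, k i ≠ ⊤ := by
    intro i hi
    refine hk (top_le_iff.1 ?_)
    calc (⊤ : ENNReal) = ∫⁻ _ in Metric.ball (i : ℂ) (1 / 100 * bdist D i), ⊤ := by
          rw [setLIntegral_const, ENNReal.top_mul]
          exact (volume_ball_pos_ne_top _ (by have := hpos i; positivity)).1
      _ ≤ ∫⁻ x in Metric.ball (i : ℂ) (1 / 100 * bdist D i), k x ^ 2 := by
          refine setLIntegral_mono' measurableSet_ball fun x hx => ?_
          have h1 := hkB i x hx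
          rw [hi, top_le_iff, ENNReal.add_eq_top] at h1
          rw [h1.resolve_right ENNReal.one_ne_top]
          simp
      _ ≤ _ := lintegral_mono_set (hBD i)
  -- The parent of a net point is a net point near the end of the step towards `x₀`. Passing to the net
  -- point costs at most `1 / 24` of the gain `1 / 12` in the quasihyperbolic distance.
  have hpar : ∀ i : N, ∃ j : N, dist (i : ℂ) j ≤ bdist D i / 8 ∧
      (dist (i : ℂ) x₀ ≤ bdist D i / 10 ∨ (k j).toReal + 1 / 24 ≤ (k i).toReal) := by
    intro i
    have hi := hpos i
    rcases exists_step_towards hD hne (hND i.2) (hfin i) with h | ⟨y, hyD, hy, hky⟩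
    · exact ⟨i, by rw [dist_self]; positivity, Or.inl h⟩
    obtain ⟨x, hxN, hx⟩ := hcov y hyD
    have h1 := bdist_le_add D y i
    have h2 := bdist_le_add D x y
    have h3 := bdist_le_add D y x
    rw [dist_comm] at h1 h2
    have hkx : k x ≤ k y + ENNReal.ofReal (1 / 24) := by
      have := quasihyperbolicDist_le_add (x₀ := x₀) (x := y) hD hne (hND hxN) (ε := 1 / 48)
        (by norm_num) (by linarith)
      refine this.trans (le_of_eq ?_)
      norm_num [hkdef]
    refine ⟨⟨x, hxN⟩, ?_, Or.inr ?_⟩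
    · have := dist_triangle (i : ℂ) y x
      linarith
    · have h4 : k x + ENNReal.ofReal (1 / 24) ≤ k i := by
        calc k x + ENNReal.ofReal (1 / 24)
            ≤ k y + ENNReal.ofReal (1 / 24) + ENNReal.ofReal (1 / 24) := by gcongr
          _ = k y + ENNReal.ofReal (1 / 12) := by
              rw [add_assoc, ← ENNReal.ofReal_add (by norm_num) (by norm_num)]
              norm_num
          _ ≤ k i := hky
      have h5 := ENNReal.toReal_mono (hfin i) h4
      rwa [ENNReal.toReal_add (hfin ⟨x, hxN⟩) ENNReal.ofReal_ne_top,
        ENNReal.toReal_ofReal (by norm_num)] at h5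
  choose p hp1 hp2 using hpar
  obtain ⟨dep, hd0, hd1, hd2⟩ := exists_depth (p := p)
    (Rt := fun i : N => dist (i : ℂ) x₀ ≤ bdist D i / 10) (κ := fun i => (k i).toReal)
    (fun i => ENNReal.toReal_nonneg) (show (0 : ℝ) < 1 / 24 by norm_num)
    (fun i hi => (hp2 i).resolve_left hi)
  refine ⟨N, p, dep, hND, hsep, hcov, hd1, hp1, hd0, ?_⟩
  have hterm : ∀ i : N, ENNReal.ofReal (bdist D i ^ 2 * ((dep i : ℝ) + 1) ^ 2) ≤
      10000 * ∫⁻ x in Metric.ball (i : ℂ) (1 / 100 * bdist D i), 625 * (2 * k x ^ 2 + 2) := by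
    intro i
    have hi := hpos i
    have hdepk : ∀ x ∈ Metric.ball (i : ℂ) (1 / 100 * bdist D i),
        ENNReal.ofReal ((dep i : ℝ) + 1) ^ 2 ≤ 625 * (2 * k x ^ 2 + 2) := by
      intro x hx
      have h1 : ENNReal.ofReal ((dep i : ℝ) + 1) ≤ 25 * (k x + 1) := by
        calc ENNReal.ofReal ((dep i : ℝ) + 1) ≤ ENNReal.ofReal (24 * (k i).toReal + 1) :=
              ENNReal.ofReal_le_ofReal (by have := hd2 i; linarith)
          _ = 24 * k i + 1 := by
              rw [ENNReal.ofReal_add (by positivity) (by norm_num), ENNReal.ofReal_mul (by norm_num),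
                ENNReal.ofReal_toReal (hfin i)]
              simp
          _ ≤ 24 * (k x + 1) + 1 * (k x + 1) := by
              rw [one_mul]
              gcongr
              · exact hkB i x hx
              · exact le_add_self
          _ = 25 * (k x + 1) := by
              rw [← add_mul]
              norm_num
      calc ENNReal.ofReal ((dep i : ℝ) + 1) ^ 2 ≤ (25 * (k x + 1)) ^ 2 := by gcongr
        _ = 625 * (k x + 1) ^ 2 := by
            rw [mul_pow]
            norm_num
        _ ≤ _ := by
            gcongr
            exact add_one_sq_le _
    calc ENNReal.ofReal (bdist D i ^ 2 * ((dep i : ℝ) + 1) ^ 2)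
        = 10000 * (ENNReal.ofReal ((dep i : ℝ) + 1) ^ 2 * ENNReal.ofReal (1 / 100 * bdist D i) ^ 2) := by
          rw [← ENNReal.ofReal_pow (by positivity), ← ENNReal.ofReal_pow (by positivity),
            show (10000 : ENNReal) = ENNReal.ofReal 10000 by simp,
            ← ENNReal.ofReal_mul (by positivity), ← ENNReal.ofReal_mul (by positivity)]
          congr 1
          ring
      _ ≤ 10000 * (ENNReal.ofReal ((dep i : ℝ) + 1) ^ 2 *
            volume (Metric.ball (i : ℂ) (1 / 100 * bdist D i))) := by
          rw [Complex.volume_ball]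
          gcongr
          refine le_mul_of_one_le_right' ?_
          rw [ENNReal.one_le_coe_iff, ← NNReal.coe_le_coe, NNReal.coe_real_pi]
          simpa using by linarith [Real.pi_gt_three]
      _ = 10000 * ∫⁻ _ in Metric.ball (i : ℂ) (1 / 100 * bdist D i),
            ENNReal.ofReal ((dep i : ℝ) + 1) ^ 2 := by rw [setLIntegral_const]
      _ ≤ _ := by
          gcongr 10000 * ?_
          exact setLIntegral_mono' measurableSet_ball hdepk
  have hsum : ∑' i : N, ENNReal.ofReal (bdist D i ^ 2 * ((dep i : ℝ) + 1) ^ 2) ≤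
      10000 * (625 * (2 * (∫⁻ x in D, k x ^ 2) + 2 * volume D)) := by
    calc _ ≤ ∑' i : N, 10000 *
          ∫⁻ x in Metric.ball (i : ℂ) (1 / 100 * bdist D i), 625 * (2 * k x ^ 2 + 2) :=
          ENNReal.tsum_le_tsum hterm
      _ = 10000 * ∫⁻ x in ⋃ i : N, Metric.ball (i : ℂ) (1 / 100 * bdist D i),
            625 * (2 * k x ^ 2 + 2) := by
          rw [ENNReal.tsum_mul_left, lintegral_iUnion (fun i => measurableSet_ball)
            (disjoint_ball_of_separated hsep)]
      _ ≤ 10000 * ∫⁻ x in D, 625 * (2 * k x ^ 2 + 2) := by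
          gcongr 10000 * ?_
          exact lintegral_mono_set (iUnion_subset hBD)
      _ = _ := by
          rw [lintegral_const_mul' _ _ (by simp), lintegral_add_right _ measurable_const,
            lintegral_const_mul' _ _ (by simp), setLIntegral_const]
  refine ne_top_of_le_ne_top ?_ hsum
  have hvol : volume D ≠ ⊤ := hbd.measure_lt_top.ne
  finiteness

end Net


/-! ### Limits at boundary points on almost every line -/

section Branch

variable {D N : Set ℂ} {p : N → N} {dep : N → ℕ} {x₀ : ℂ}

/-- Every boundary point is reached by an infinite branch of a Whitney forest. -/
theorem exists_branch (hD : IsOpen D) (hne : (frontier D).Nonempty) (hbd : Bornology.IsBounded D)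
    (hx₀ : x₀ ∈ D) (hND : N ⊆ D)
    (hsep : ∀ x ∈ N, ∀ y ∈ N, x ≠ y → 1 / 100 * (bdist D x + bdist D y) ≤ dist x y)
    (hcov : ∀ y ∈ D, ∃ x ∈ N, dist y x < 1 / 100 * (bdist D y + bdist D x))
    (hdep : ∀ i, dep i ≠ 0 → dep (p i) + 1 = dep i)
    (hp : ∀ i : N, dist (i : ℂ) (p i) ≤ bdist D i / 8)
    (hroot : ∀ i : N, dep i = 0 → dist (i : ℂ) x₀ ≤ bdist D i / 10) {x : ℂ}
    (hx : x ∈ frontier D) :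
    ∃ c : ℕ → N, (∀ m, dep (c m) = m) ∧ (∀ m, p (c (m + 1)) = c m) ∧
      ∀ m, x ∈ closure ((fun i : N => (i : ℂ)) '' {j | IsDesc p dep (c m) j}) := by
  classical
  have hpos : ∀ i : N, 0 < bdist D i := fun i => bdist_pos hD hne (hND i.2)
  have hfinite : ∀ η : ℝ, 0 < η → {i : N | η ≤ bdist D i}.Finite := fun η hη =>
    finite_of_separated hbd (by norm_num) (fun z hz => (Metric.ball_subset_ball (by
      have := bdist_nonneg D z
      linarith)).trans (ball_bdist_subset hD (hND hz))) hsep hη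
  have hxD : x ∉ D := (hD.frontier_eq ▸ hx : x ∈ closure D \ D).2
  have hxcl : x ∈ closure D := frontier_subset_closure hx
  -- net points accumulate at `x`
  have hxN : x ∈ closure N := by
    rw [Metric.mem_closure_iff] at hxcl ⊢
    intro ε hε
    obtain ⟨y, hyD, hy⟩ := hxcl (ε / 2) (by positivity)
    obtain ⟨z, hzN, hz⟩ := hcov y hyD
    refine ⟨z, hzN, ?_⟩
    have h1 : bdist D y ≤ dist y x := Metric.infDist_le_dist_of_mem hx
    have h2 := bdist_le_add D z y
    rw [dist_comm] at h1 h2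
    have h3 := dist_triangle x y z
    linarith
  have hroots : {i : N | dep i = 0}.Finite := by
    refine (hfinite (bdist D x₀ / 2) (by have := bdist_pos hD hne hx₀; positivity)).subset ?_
    intro i hi
    have h1 := hroot i hi
    have h2 := bdist_le_add D x₀ i
    rw [dist_comm] at h2
    have h3 := hpos i
    change bdist D x₀ / 2 ≤ bdist D i
    linarith
  have hstart : ∃ c : N, dep c = 0 ∧
      x ∈ closure ((fun i : N => (i : ℂ)) '' {j | IsDesc p dep c j}) := by
    have hsub : N ⊆ ⋃ c ∈ {i : N | dep i = 0},
        (fun i : N => (i : ℂ)) '' {j | IsDesc p dep c j} := by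
      intro z hz
      refine mem_iUnion₂.2 ⟨p^[dep ⟨z, hz⟩] ⟨z, hz⟩, ?_, ⟨z, hz⟩, ?_, rfl⟩
      · change dep _ = 0
        rw [dep_iterate hdep _ le_rfl, Nat.sub_self]
      · change _ ≤ _ ∧ _
        rw [dep_iterate hdep _ le_rfl, Nat.sub_self]
        exact ⟨Nat.zero_le _, rfl⟩
    have h1 := closure_mono hsub hxN
    rw [hroots.closure_biUnion] at h1
    obtain ⟨c, hc, hxc⟩ := mem_iUnion₂.1 h1
    exact ⟨c, hc, hxc⟩
  have hstep : ∀ i : N, x ∈ closure ((fun i : N => (i : ℂ)) '' {j | IsDesc p dep i j}) →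
      ∃ c : N, p c = i ∧ dep c = dep i + 1 ∧
        x ∈ closure ((fun i : N => (i : ℂ)) '' {j | IsDesc p dep c j}) := by
    intro i hi
    have hch : {c : N | p c = i ∧ dep c = dep i + 1}.Finite := by
      refine (hfinite (bdist D i / 2) (by have := hpos i; positivity)).subset ?_
      rintro c ⟨hc, -⟩
      have h1 := hp c
      rw [hc] at h1
      have h2 := bdist_le_add D i c
      rw [dist_comm] at h2
      have h3 := hpos c
      change bdist D i / 2 ≤ bdist D c
      linarith
    have hsub : (fun i : N => (i : ℂ)) '' {j | IsDesc p dep i j} ⊆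
        {(i : ℂ)} ∪ ⋃ c ∈ {c : N | p c = i ∧ dep c = dep i + 1},
          (fun i : N => (i : ℂ)) '' {j | IsDesc p dep c j} := by
      rintro _ ⟨j, hj, rfl⟩
      by_cases hij : i = j
      · exact Or.inl (by rw [hij]; rfl)
      · obtain ⟨c, hc1, hc2, hc3⟩ := isDesc_child hdep hj hij
        exact Or.inr (mem_iUnion₂.2 ⟨c, ⟨hc1, hc2⟩, j, hc3, rfl⟩)
    have h1 := closure_mono hsub hi
    rw [closure_union, closure_singleton, hch.closure_biUnion] at h1
    rcases h1 with h1 | h1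
    · exact absurd (hND i.2) (h1 ▸ hxD)
    · obtain ⟨c, hc, hxc⟩ := mem_iUnion₂.1 h1
      exact ⟨c, hc.1, hc.2, hxc⟩
  obtain ⟨c₀, hc₀, hxc₀⟩ := hstart
  choose! nxt hn1 hn2 hn3 using hstep
  set c : ℕ → N := fun m => Nat.rec c₀ (fun _ i => nxt i) m with hc
  have hmem : ∀ m, x ∈ closure ((fun i : N => (i : ℂ)) '' {j | IsDesc p dep (c m) j}) := by
    intro m
    induction m with
    | zero => exact hxc₀
    | succ m ih => exact hn3 _ ih
  refine ⟨c, fun m => ?_, fun m => hn1 _ (hmem m), hmem⟩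
  induction m with
  | zero => exact hc₀
  | succ m ih => exact (hn2 _ (hmem m)).trans (by rw [ih])

end Branch

theorem two_mul_le_add_sq_ennreal (a b : ENNReal) : 2 * (a * b) ≤ a ^ 2 + b ^ 2 := by
  by_cases ha : a = ⊤
  · simp [ha]
  by_cases hb : b = ⊤
  · simp [hb]
  lift a to NNReal using ha
  lift b to NNReal using hb
  have h : 2 * (a * b) ≤ a ^ 2 + b ^ 2 := by
    rw [← mul_assoc]
    exact two_mul_le_add_sq a b
  exact_mod_cast h

/-- Under the quasihyperbolic condition, the boundary limits of a conformal map at the points of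
almost every line form a set of linear measure zero. -/
theorem ae_volume_boundary_limits_eq_zero {D : Set ℂ} (hD : IsOpen D)
    (hbd : Bornology.IsBounded D) (hne : (frontier D).Nonempty) {x₀ : ℂ} (hx₀ : x₀ ∈ D)
    (hk : ∫⁻ x in D, quasihyperbolicDist D x x₀ ^ 2 ≠ ⊤) {f : ℂ → ℂ} (hf : DifferentiableOn ℂ f D)
    (hinj : InjOn f D) (harea : volume (f '' D) ≠ ⊤) {π : ℂ → ℝ} (hπ : LipschitzWith 1 π)
    {h : ℂ → ℝ} (hh : LipschitzWith 1 h) :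
    ∀ᵐ t : ℝ, volume (h '' {z | ∃ x ∈ frontier D, π x = t ∧ Tendsto f (𝓝[D] x) (𝓝 z)}) = 0 := by
  classical
  obtain ⟨N, p, dep, hND, hsep, hcov, hdep, hp, hroot, hsum⟩ := exists_forest hD hbd hne hk
  have hpos : ∀ i : N, 0 < bdist D i := fun i => bdist_pos hD hne (hND i.2)
  have hcount := countable_of_separated (by norm_num) (fun x hx => bdist_pos hD hne (hND hx)) hsep
  obtain ⟨S, hS0, hSsum, hSpath⟩ := exists_path_bound hdep (δ := fun i : N => bdist D i) hsum
  have hdesc : ∀ i j : N, IsDesc p dep i j → dist (j : ℂ) i ≤ S i := by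
    intro i j hij
    have h1 := dist_le_range_sum_dist (fun m => ((p^[m] j : N) : ℂ)) (dep j - dep i)
    simp only [Function.iterate_zero, id, hij.2] at h1
    refine h1.trans (le_trans (Finset.sum_le_sum fun m _ => ?_) (hSpath i j hij))
    rw [Function.iterate_succ_apply']
    have := hp (p^[m] j)
    have := hpos (p^[m] j)
    linarith
  set d : N → ENNReal := fun i => edist (f i) (f (p i)) with hd
  have hdsum : ∑' i, d i ^ 2 ≠ ⊤ := by
    set g : ℂ → ENNReal := fun z => ‖deriv f z‖ₑ ^ 2 with hg
    have hgm : Measurable g := (measurable_deriv f).enorm.pow_const 2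
    have hBD : ∀ i : N, Metric.ball (i : ℂ) (bdist D i / 4) ⊆ D := fun i =>
      (Metric.ball_subset_ball (by linarith [hpos i])).trans (ball_bdist_subset hD (hND i.2))
    have hle : ∑' i, d i ^ 2 ≤ 62500 * volume (f '' D) := by
      calc ∑' i, d i ^ 2 ≤ ∑' i : N, ∫⁻ z in Metric.ball (i : ℂ) (bdist D i / 4), g z := by
            refine ENNReal.tsum_le_tsum fun i => ?_
            simp only [hd]
            rw [edist_comm]
            refine edist_sq_le_lintegral_deriv (by have := hpos i; positivity)
              (hf.mono (hBD i)) ?_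
            rw [dist_comm]
            have := hp i
            linarith
        _ = ∑' i : N, ∫⁻ z in D,
              (Metric.ball (i : ℂ) (bdist D i / 4)).indicator (fun _ => (1 : ENNReal)) z * g z := by
            refine tsum_congr fun i => ?_
            have : ∀ z, (Metric.ball (i : ℂ) (bdist D i / 4)).indicator (fun _ => (1 : ENNReal)) z *
                g z = (Metric.ball (i : ℂ) (bdist D i / 4)).indicator g z := by
              intro z
              by_cases hz : z ∈ Metric.ball (i : ℂ) (bdist D i / 4) <;> simp [hz]
            simp only [this]
            rw [setLIntegral_indicator measurableSet_ball, inter_eq_self_of_subset_left (hBD i)]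
        _ = ∫⁻ z in D, ∑' i : N,
              (Metric.ball (i : ℂ) (bdist D i / 4)).indicator (fun _ => (1 : ENNReal)) z * g z := by
            rw [lintegral_tsum]
            exact fun i => ((measurable_const.indicator measurableSet_ball).mul hgm).aemeasurable
        _ ≤ ∫⁻ z in D, 62500 * g z := by
            refine lintegral_mono fun z => ?_
            rw [ENNReal.tsum_mul_right]
            gcongr
            exact tsum_indicator_ball_le hD hne hND hsep z
        _ = 62500 * volume (f '' D) := by
            rw [lintegral_const_mul' _ _ (by simp),
              lintegral_deriv_sq_eq_volume_image hD hf hinj hD.measurableSet Subset.rfl]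
    exact ne_top_of_le_ne_top (ENNReal.mul_ne_top (by simp) harea) hle
  -- on almost every line the increments over the shadows meeting it are summable
  have hae : ∀ᵐ t : ℝ, ∑' i, {i : N | t ∈ Metric.closedBall (π i) (S i)}.indicator d i < ⊤ := by
    have hswap : ∀ (i : N) (t : ℝ), {i : N | t ∈ Metric.closedBall (π i) (S i)}.indicator d i =
        (Metric.closedBall (π i) (S i)).indicator (fun _ => d i) t := by
      intro i t
      by_cases ht : t ∈ Metric.closedBall (π i) (S i)
      · rw [indicator_of_mem ht, indicator_of_mem (by exact ht)]
      · rw [indicator_of_notMem ht, indicator_of_notMem (by exact ht)]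
    simp only [hswap]
    have hm : ∀ i : N, Measurable fun t =>
        (Metric.closedBall (π i) (S i)).indicator (fun _ => d i) t := fun i =>
      measurable_const.indicator measurableSet_closedBall
    refine ae_lt_top (Measurable.tsum hm) ?_
    rw [lintegral_tsum fun i => (hm i).aemeasurable]
    refine ne_top_of_le_ne_top (ENNReal.add_ne_top.2 ⟨hdsum, hSsum⟩) ?_
    rw [← ENNReal.tsum_add]
    refine ENNReal.tsum_le_tsum fun i => ?_
    rw [lintegral_indicator measurableSet_closedBall, setLIntegral_const, Real.volume_closedBall,
      ENNReal.ofReal_mul (by norm_num), ENNReal.ofReal_ofNat]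
    calc d i * (2 * ENNReal.ofReal (S i)) = 2 * (d i * ENNReal.ofReal (S i)) := by ring
      _ ≤ _ := two_mul_le_add_sq_ennreal _ _
  filter_upwards [hae] with t ht
  refine volume_image_branch_limits (p := p) (dep := dep) (F := fun i : N => f i)
    (J := {i : N | t ∈ Metric.closedBall (π i) (S i)}) ht.ne ?_ hh
  rintro z ⟨x, hx, hxt, hz⟩
  obtain ⟨c, hcd, hcp, hcx⟩ := exists_branch hD hne hbd hx₀ hND hsep hcov hdep hp hroot hx
  have hdist : ∀ m, dist x (c m) ≤ S (c m) := by
    intro m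
    have hsub : (fun i : N => (i : ℂ)) '' {j | IsDesc p dep (c m) j} ⊆
        Metric.closedBall (c m : ℂ) (S (c m)) := by
      rintro _ ⟨j, hj, rfl⟩
      exact Metric.mem_closedBall.2 (hdesc _ _ hj)
    exact Metric.mem_closedBall.1 (closure_minimal hsub Metric.isClosed_closedBall (hcx m))
  refine ⟨c, fun m => ?_, hcd, hcp, ?_⟩
  · change t ∈ Metric.closedBall _ _
    rw [Metric.mem_closedBall, ← hxt]
    exact (hπ.dist_le_mul x (c m)).trans (by simpa using hdist m)
  · have hinj : Function.Injective c := fun m m' hmm => by rw [← hcd m, hmm, hcd m']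
    have hSc : ∑' m, ENNReal.ofReal (S (c m)) ^ 2 ≠ ⊤ :=
      ne_top_of_le_ne_top hSsum (ENNReal.tsum_comp_le_tsum_of_injective hinj
        fun i => ENNReal.ofReal (S i) ^ 2)
    have hlim := ENNReal.tendsto_atTop_zero_of_tsum_ne_top hSc
    have hlim2 : Tendsto (fun m => S (c m) ^ 2) atTop (𝓝 0) := by
      have h1 := (ENNReal.tendsto_toReal ENNReal.zero_ne_top).comp hlim
      refine h1.congr fun m => ?_
      simp [ENNReal.toReal_pow, ENNReal.toReal_ofReal (hS0 _)]
    have hlim3 : Tendsto (fun m => S (c m)) atTop (𝓝 0) := by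
      have := hlim2.sqrt
      simp only [Real.sqrt_zero, Real.sqrt_sq (hS0 _)] at this
      exact this
    have hcx' : Tendsto (fun m => (c m : ℂ)) atTop (𝓝 x) := by
      rw [tendsto_iff_dist_tendsto_zero]
      refine squeeze_zero (fun _ => dist_nonneg) (fun m => ?_) hlim3
      rw [dist_comm]
      exact hdist m
    exact hz.comp (tendsto_nhdsWithin_iff.2 ⟨hcx', Eventually.of_forall fun m => hND (c m).2⟩)


/-! ### Complementary components along a ray -/

/-- The connected components of the complement of a plane set. -/
def complComponents (U : Set ℂ) : Set (Set ℂ) :=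
  {q | ∃ x, x ∉ U ∧ q = connectedComponentIn Uᶜ x}

/-- `K` sends each complementary component `q` of `U` to the complementary component of `U'` at
which `F` accumulates near `q`. -/
structure IsComponentMap (F : ℂ → ℂ) (U U' : Set ℂ) (K : Set ℂ → Set ℂ) : Prop where
  mem : ∀ q ∈ complComponents U, K q ∈ complComponents U'
  injOn : InjOn K (complComponents U)
  mapsTo : ∀ q ∈ complComponents U, ∀ V, IsOpen V → K q ⊆ V →
    ∃ N, IsOpen N ∧ q ⊆ N ∧ MapsTo F (N ∩ U) V

theorem ProperHomeo.exists_componentMap {F G : ℂ → ℂ} {U U' : Set ℂ}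
    (h : ProperHomeo F G U U') : ∃ K, IsComponentMap F U U' K := by
  have key : ∀ q ∈ complComponents U, ∃ y, y ∉ U' ∧ ∀ V, IsOpen V →
      connectedComponentIn U'ᶜ y ⊆ V → ∃ N, IsOpen N ∧ q ⊆ N ∧ MapsTo F (N ∩ U) V := by
    rintro _ ⟨x, hx, rfl⟩
    exact h.exists_component hx
  choose! y hy hyV using key
  refine ⟨fun q => connectedComponentIn U'ᶜ (y q), fun q hq => ⟨y q, hy q hq, rfl⟩, ?_, hyV⟩
  intro q hq q' hq' hqq
  change connectedComponentIn U'ᶜ (y q) = connectedComponentIn U'ᶜ (y q') at hqq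
  have h1 := hyV q hq
  have h2 := hyV q' hq'
  rw [← hqq] at h2
  have hyq := hy q hq
  obtain ⟨x, hx, rfl⟩ := hq
  obtain ⟨x', hx', rfl⟩ := hq'
  exact h.component_injective hx hx' hyq h1 h2

section Components

variable {U : Set ℂ}

theorem exists_mem_complComponents {x : ℂ} (hx : x ∉ U) : ∃ q ∈ complComponents U, x ∈ q :=
  ⟨_, ⟨x, hx, rfl⟩, mem_connectedComponentIn hx⟩

theorem subset_compl_of_mem_complComponents {q : Set ℂ} (hq : q ∈ complComponents U) :
    q ⊆ Uᶜ := by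
  obtain ⟨x, -, rfl⟩ := hq
  exact connectedComponentIn_subset _ _

theorem eq_of_mem_complComponents {q q' : Set ℂ} (hq : q ∈ complComponents U)
    (hq' : q' ∈ complComponents U) {x : ℂ} (hx : x ∈ q) (hx' : x ∈ q') : q = q' := by
  obtain ⟨y, -, rfl⟩ := hq
  obtain ⟨y', -, rfl⟩ := hq'
  rw [connectedComponentIn_eq hx, connectedComponentIn_eq hx']

theorem isClosed_of_mem_complComponents (hU : IsOpen U) {q : Set ℂ}
    (hq : q ∈ complComponents U) : IsClosed q := by
  obtain ⟨x, -, rfl⟩ := hq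
  exact isClosed_connectedComponentIn hU.isClosed_compl x

theorem isPreconnected_of_mem_complComponents {q : Set ℂ} (hq : q ∈ complComponents U) :
    IsPreconnected q := by
  obtain ⟨x, -, rfl⟩ := hq
  exact isPreconnected_connectedComponentIn

theorem nonempty_of_mem_complComponents {q : Set ℂ} (hq : q ∈ complComponents U) :
    q.Nonempty := by
  obtain ⟨x, hx, rfl⟩ := hq
  exact ⟨x, mem_connectedComponentIn hx⟩

theorem frontier_subset_of_mem_complComponents (hU : IsOpen U) {q : Set ℂ}
    (hq : q ∈ complComponents U) : frontier q ⊆ frontier U := by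
  obtain ⟨x, -, rfl⟩ := hq
  exact frontier_component_subset hU x

end Components

theorem inter_frontier_nonempty_of_isPreconnected {S q : Set ℂ} (hS : IsPreconnected S)
    (h1 : (S ∩ q).Nonempty) (h2 : (S \ q).Nonempty) : (S ∩ frontier q).Nonempty := by
  by_contra hcon
  have hfr : ∀ x ∈ S, x ∉ frontier q := fun x hx hx' => hcon ⟨x, hx, hx'⟩
  have hin : ∀ x ∈ S, x ∈ q → x ∈ interior q := fun x hx hxq => by
    by_contra h'
    exact hfr x hx ⟨subset_closure hxq, h'⟩
  have hout : ∀ x ∈ S, x ∉ q → x ∈ (closure q)ᶜ := fun x hx hxq h' =>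
    hfr x hx ⟨h', fun h'' => hxq (interior_subset h'')⟩
  obtain ⟨x, hx, hxq⟩ := h1
  obtain ⟨y, hy, hyq⟩ := h2
  obtain ⟨z, -, hz1, hz2⟩ := hS _ _ isOpen_interior isClosed_closure.isOpen_compl
    (fun z hz => (em (z ∈ q)).imp (hin z hz) (hout z hz)) ⟨x, hx, hin x hx hxq⟩
    ⟨y, hy, hout y hy hyq⟩
  exact hz2 (interior_subset_closure hz1)

section Ray

variable {U U' : Set ℂ} {F : ℂ → ℂ} {K : Set ℂ → Set ℂ}

/-- If `F` maps the part of a ball in `U` into `O₁`, then no component that the ball meets without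
containing its centre can be sent to an open set disjoint from `O₁`. -/
theorem IsComponentMap.not_subset_of_ball (hK : IsComponentMap F U U' K) (hU : IsOpen U)
    {O₁ O₂ : Set ℂ} (hO₂ : IsOpen O₂) (hd : Disjoint O₁ O₂) {x x' : ℂ} {ε : ℝ}
    (hball : MapsTo F (Metric.ball x ε ∩ U) O₁) {q : Set ℂ} (hq : q ∈ complComponents U)
    (hxq : x ∉ q) (hx' : x' ∈ Metric.ball x ε) (hx'q : x' ∈ q) : ¬ K q ⊆ O₂ := by
  intro hsub
  have hε : 0 < ε := dist_nonneg.trans_lt (Metric.mem_ball.1 hx')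
  obtain ⟨z, hz, hzq⟩ := inter_frontier_nonempty_of_isPreconnected
    (convex_ball x ε).isPreconnected ⟨x', hx', hx'q⟩ ⟨x, Metric.mem_ball_self hε, hxq⟩
  obtain ⟨N, hN, hqN, hmap⟩ := hK.mapsTo q hq O₂ hO₂ hsub
  have hzN : z ∈ N := hqN ((isClosed_of_mem_complComponents hU hq).frontier_subset hzq)
  have hzcl : z ∈ closure U :=
    frontier_subset_closure (frontier_subset_of_mem_complComponents hU hq hzq)
  obtain ⟨t, ⟨ht1, ht2⟩, htU⟩ :=
    mem_closure_iff.1 hzcl _ (hN.inter Metric.isOpen_ball) ⟨hzN, hz⟩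
  exact disjoint_left.1 hd (hball ⟨ht2, htU⟩) (hmap ⟨ht1, htU⟩)

/-- Let a ray leave a component `q₀` at a boundary point where `F` tends to `w`, and let `F` be large
far out on the ray. Then every distance `y > 0` from `w` is attained on the image of the ray, or on
the image of a complementary component other than `q₀` that the ray meets. -/
theorem IsComponentMap.exists_mem_ray (hK : IsComponentMap F U U' K) (hU : IsOpen U)
    (hF : ContinuousOn F U) {w : ℂ} {ℓ : ℝ → ℂ} (hℓ : Continuous ℓ) {s₀ : ℝ}
    {q₀ : Set ℂ} (hq₀ : q₀ ∈ complComponents U) (hs₀ : ℓ s₀ ∈ q₀) (hleave : ∀ s > s₀, ℓ s ∉ q₀)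
    (hw : Tendsto F (𝓝[U] (ℓ s₀)) (𝓝 w)) {y : ℝ} (hy : 0 < y)
    (hfar : ∃ s > s₀, ℓ s ∈ U ∧ y < ‖F (ℓ s) - w‖) :
    (∃ s > s₀, ℓ s ∈ U ∧ ‖F (ℓ s) - w‖ = y) ∨
      ∃ q ∈ complComponents U, q ≠ q₀ ∧ (∃ s > s₀, ℓ s ∈ q) ∧ ∃ k ∈ K q, ‖k - w‖ = y := by
  by_contra! hcon
  obtain ⟨hcon1, hcon2⟩ := hcon
  set O₁ : Set ℂ := {z | ‖z - w‖ < y} with hO₁def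
  set O₂ : Set ℂ := {z | y < ‖z - w‖} with hO₂def
  have hO₁ : IsOpen O₁ := isOpen_lt (by fun_prop) continuous_const
  have hO₂ : IsOpen O₂ := isOpen_lt continuous_const (by fun_prop)
  have hd : Disjoint O₁ O₂ := disjoint_left.2 fun z (h1 : _ < y) (h2 : y < _) => lt_asymm h1 h2
  have hside : ∀ q ∈ complComponents U, (∃ s > s₀, ℓ s ∈ q) → K q ⊆ O₁ ∨ K q ⊆ O₂ := by
    rintro q hq ⟨s, hs, hsq⟩
    have hne : q ≠ q₀ := fun h => hleave s hs (h ▸ hsq)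
    refine (isPreconnected_of_mem_complComponents (hK.mem q hq)).subset_or_subset hO₁ hO₂ hd
      fun k hk => ?_
    exact lt_or_gt_of_ne (hcon2 q hq hne ⟨s, hs, hsq⟩ k hk)
  -- the points of the ray lying on a given side
  set A : Set ℂ → Set ℝ := fun O =>
    {s | s₀ < s ∧ ((ℓ s ∈ U ∧ F (ℓ s) ∈ O) ∨ ∃ q ∈ complComponents U, ℓ s ∈ q ∧ K q ⊆ O)}
    with hA
  have hstep : ∀ O O' : Set ℂ, IsOpen O' → Disjoint O O' →
      (∀ q ∈ complComponents U, (∃ s > s₀, ℓ s ∈ q) → K q ⊆ O ∨ K q ⊆ O') →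
      ∀ x ε, MapsTo F (Metric.ball x ε ∩ U) O →
      ∀ s > s₀, ℓ s ∈ Metric.ball x ε → (∀ q ∈ complComponents U, x ∈ q → ℓ s ∈ q → K q ⊆ O) →
      s ∈ A O := by
    intro O O' hO' hdO hsd x ε hball s hs hsx hsame
    refine ⟨hs, ?_⟩
    by_cases hsU : ℓ s ∈ U
    · exact Or.inl ⟨hsU, hball ⟨hsx, hsU⟩⟩
    · obtain ⟨q, hq, hsq⟩ := exists_mem_complComponents hsU
      refine Or.inr ⟨q, hq, hsq, ?_⟩
      by_cases hxq : x ∈ q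
      · exact hsame q hq hxq hsq
      · exact (hsd q hq ⟨s, hs, hsq⟩).resolve_right
          (hK.not_subset_of_ball hU hO' hdO hball hq hxq hsx hsq)
  have hopen : ∀ O O' : Set ℂ, IsOpen O → IsOpen O' → Disjoint O O' →
      (∀ q ∈ complComponents U, (∃ s > s₀, ℓ s ∈ q) → K q ⊆ O ∨ K q ⊆ O') → IsOpen (A O) := by
    intro O O' hO hO' hdO hsd
    rw [isOpen_iff_mem_nhds]
    rintro s ⟨hs, hsU | ⟨q, hq, hsq, hqO⟩⟩
    · have h1 : U ∩ F ⁻¹' O ∈ 𝓝 (ℓ s) := (hF.isOpen_inter_preimage hU hO).mem_nhds hsU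
      filter_upwards [Ioi_mem_nhds hs, hℓ.continuousAt h1] with s' hs' hs'U
      exact ⟨hs', Or.inl hs'U⟩
    · obtain ⟨N, hN, hqN, hmap⟩ := hK.mapsTo q hq O hO hqO
      obtain ⟨ε, hε, hball⟩ := Metric.isOpen_iff.1 hN _ (hqN hsq)
      filter_upwards [Ioi_mem_nhds hs, hℓ.continuousAt (Metric.ball_mem_nhds _ hε)] with s' hs' hs'b
      refine hstep O O' hO' hdO hsd (ℓ s) ε (hmap.mono_left (inter_subset_inter_left _ hball)) s' hs'
        hs'b fun q' hq' hsq' _ => ?_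
      rwa [eq_of_mem_complComponents hq' hq hsq' hsq]
  have hcov : Ioi s₀ ⊆ A O₁ ∪ A O₂ := by
    intro s hs
    by_cases hsU : ℓ s ∈ U
    · exact (lt_or_gt_of_ne (hcon1 s hs hsU)).imp (fun h => ⟨hs, Or.inl ⟨hsU, h⟩⟩)
        fun h => ⟨hs, Or.inl ⟨hsU, h⟩⟩
    · obtain ⟨q, hq, hsq⟩ := exists_mem_complComponents hsU
      exact (hside q hq ⟨s, hs, hsq⟩).imp (fun h => ⟨hs, Or.inr ⟨q, hq, hsq, h⟩⟩)
        fun h => ⟨hs, Or.inr ⟨q, hq, hsq, h⟩⟩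
  have hnear : (Ioi s₀ ∩ A O₁).Nonempty := by
    have h1 : F ⁻¹' O₁ ∈ 𝓝[U] (ℓ s₀) := hw (hO₁.mem_nhds (by simpa [O₁] using hy))
    obtain ⟨ε, hε, hball⟩ := Metric.mem_nhdsWithin_iff.1 h1
    have h2 : ∀ᶠ s in 𝓝[>] s₀, ℓ s ∈ Metric.ball (ℓ s₀) ε :=
      nhdsWithin_le_nhds (hℓ.continuousAt (Metric.ball_mem_nhds _ hε))
    obtain ⟨s, hsb, hs⟩ := (h2.and self_mem_nhdsWithin).exists
    refine ⟨s, hs, hstep O₁ O₂ hO₂ hd hside (ℓ s₀) ε hball s hs hsb fun q hq h1 h2 => ?_⟩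
    exact absurd h2 (eq_of_mem_complComponents hq hq₀ h1 hs₀ ▸ hleave s hs)
  obtain ⟨s₁, hs₁, hs₁U, hs₁y⟩ := hfar
  obtain ⟨s, hs, ⟨-, h1⟩, ⟨-, h2⟩⟩ := isPreconnected_Ioi (a := s₀) _ _
    (hopen O₁ O₂ hO₁ hO₂ hd hside) (hopen O₂ O₁ hO₂ hO₁ hd.symm fun q hq h => (hside q hq h).symm)
    hcov hnear ⟨s₁, hs₁, hs₁, Or.inl ⟨hs₁U, hs₁y⟩⟩
  rcases h1 with ⟨hsU, h1⟩ | ⟨q, hq, hsq, h1⟩ <;> rcases h2 with ⟨hsU', h2⟩ | ⟨q', hq', hsq', h2⟩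
  · exact disjoint_left.1 hd h1 h2
  · exact subset_compl_of_mem_complComponents hq' hsq' hsU
  · exact subset_compl_of_mem_complComponents hq hsq hsU'
  · rw [eq_of_mem_complComponents hq' hq hsq' hsq] at h2
    obtain ⟨k, hk⟩ := nonempty_of_mem_complComponents (hK.mem q hq)
    exact disjoint_left.1 hd (h1 hk) (h2 hk)

/-- At the boundary points of a component that is sent to a point, `F` tends to this point. -/
theorem IsComponentMap.tendsto_of_eq_singleton (hK : IsComponentMap F U U' K)
    {q : Set ℂ} (hq : q ∈ complComponents U) {k : ℂ} (hk : K q = {k}) {x : ℂ}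
    (hx : x ∈ q) : Tendsto F (𝓝[U] x) (𝓝 k) := by
  intro V hV
  obtain ⟨V', hV', hV'o, hkV'⟩ := mem_nhds_iff.1 hV
  obtain ⟨N, hN, hqN, hmap⟩ := hK.mapsTo q hq V' hV'o (by rw [hk]; simpa using hkV')
  rw [mem_map]
  filter_upwards [self_mem_nhdsWithin, nhdsWithin_le_nhds (hN.mem_nhds (hqN hx))] with t ht1 ht2
  exact hV' (hmap ⟨ht2, ht1⟩)

end Ray


/-! ### Integration over parallel lines -/

/-- The point with coordinates `s` along the unit vector `u` and `t` across it, relative to `a`. -/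
noncomputable def linePoint (a u : ℂ) (t s : ℝ) : ℂ := a + t * Complex.I * u + s * u

theorem continuous_linePoint (a u : ℂ) (t : ℝ) : Continuous (linePoint a u t) := by
  unfold linePoint
  fun_prop

theorem lintegral_eq_lintegral_linePoint (a : ℂ) {u : ℂ} (hu : ‖u‖ = 1) {g : ℂ → ENNReal}
    (hg : Measurable g) : ∫⁻ z, g z = ∫⁻ t : ℝ, ∫⁻ s : ℝ, g (linePoint a u t s) := by
  have h1 := (rotation ⟨u, mem_sphere_zero_iff_norm.2 hu⟩).measurePreserving
  have h2 : ∫⁻ z, g z = ∫⁻ z, g (a + u * z) := by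
    rw [← lintegral_add_left_eq_self _ a]
    exact (h1.lintegral_comp (f := fun z => g (a + z)) (by fun_prop)).symm
  have h3 := Complex.volume_preserving_equiv_real_prod.symm.lintegral_comp
    (f := fun z => g (a + u * z)) (by fun_prop)
  rw [h2, ← h3, Measure.volume_eq_prod, lintegral_prod_symm']
  · refine lintegral_congr fun t => lintegral_congr fun s => ?_
    congr 1
    rw [Complex.measurableEquivRealProd_symm_apply, Complex.mk_eq_add_mul_I, linePoint]
    ring
  · have : Measurable fun z => g (a + u * z) := by fun_prop
    exact this.comp Complex.measurableEquivRealProd.symm.measurable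

theorem im_linePoint (a : ℂ) {u : ℂ} (hu : ‖u‖ = 1) (t s : ℝ) :
    ((linePoint a u t s - a) * (starRingEnd ℂ) u).im = t := by
  have h : u * (starRingEnd ℂ) u = 1 := by
    rw [Complex.mul_conj, Complex.normSq_eq_norm_sq, hu]
    simp
  have : (linePoint a u t s - a) * (starRingEnd ℂ) u = t * Complex.I + s := by
    rw [linePoint]
    linear_combination (t * Complex.I + s) * h
  rw [this]
  simp

theorem linePoint_of_coord (a : ℂ) {u : ℂ} (hu : ‖u‖ = 1) (x : ℂ) :
    linePoint a u ((x - a) * (starRingEnd ℂ) u).im ((x - a) * (starRingEnd ℂ) u).re = x := by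
  have h : u * (starRingEnd ℂ) u = 1 := by
    rw [Complex.mul_conj, Complex.normSq_eq_norm_sq, hu]
    simp
  have h2 := Complex.re_add_im ((x - a) * (starRingEnd ℂ) u)
  rw [linePoint]
  linear_combination u * h2 + (x - a) * h

theorem norm_linePoint_sub (a : ℂ) {u : ℂ} (hu : ‖u‖ = 1) (t s : ℝ) :
    ‖linePoint a u t s - a‖ ^ 2 = t ^ 2 + s ^ 2 := by
  have : linePoint a u t s - a = (t * Complex.I + s) * u := by
    rw [linePoint]
    ring
  rw [this, norm_mul, hu, mul_one, ← Complex.normSq_eq_norm_sq, Complex.normSq_apply]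
  simp
  ring

theorem lipschitzWith_im_mul_conj (a : ℂ) {u : ℂ} (hu : ‖u‖ = 1) :
    LipschitzWith 1 fun x : ℂ => ((x - a) * (starRingEnd ℂ) u).im := by
  refine LipschitzWith.of_dist_le_mul fun x y => ?_
  rw [Real.dist_eq, ← Complex.sub_im, NNReal.coe_one, one_mul]
  refine (Complex.abs_im_le_norm _).trans (le_of_eq ?_)
  rw [← sub_mul, norm_mul, RCLike.norm_conj, hu, mul_one, dist_eq_norm]
  congr 1
  ring

theorem lipschitzWith_norm_sub (w : ℂ) : LipschitzWith 1 fun z : ℂ => ‖z - w‖ := by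
  refine LipschitzWith.of_dist_le_mul fun x y => ?_
  rw [Real.dist_eq, NNReal.coe_one, one_mul, dist_eq_norm]
  refine (abs_norm_sub_norm_le _ _).trans (le_of_eq ?_)
  congr 1
  ring

/-! ### The length–area estimate near a collapsing arc -/

/-- The measure of the set of distances in `(r / 2, r)` from `w` that are attained on `A`. -/
noncomputable def shellMeasure (w : ℂ) (r : ℝ) (A : Set ℂ) : ENNReal :=
  volume ((fun z => ‖z - w‖) '' A ∩ Ioo (r / 2) r)

theorem shellMeasure_le (w : ℂ) (r : ℝ) (A : Set ℂ) :
    shellMeasure w r A ≤ ENNReal.ofReal (r / 2) := by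
  refine (measure_mono inter_subset_right).trans ?_
  rw [Real.volume_Ioo]
  exact ENNReal.ofReal_le_ofReal (by linarith)

theorem shellMeasure_eq_zero {w : ℂ} {r : ℝ} {A : Set ℂ}
    (h : ¬ (A ∩ Metric.ball w r).Nonempty) : shellMeasure w r A = 0 := by
  have : (fun z => ‖z - w‖) '' A ∩ Ioo (r / 2) r = ∅ := by
    refine eq_empty_of_forall_notMem ?_
    rintro _ ⟨⟨z, hz, rfl⟩, hz2⟩
    exact h ⟨z, hz, mem_ball_iff_norm.2 hz2.2⟩
  rw [shellMeasure, this, measure_empty]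

/-- A fat set attaining many distances near `w` has large area near `w`. -/
theorem IsFat.mul_shellMeasure_sq_le {c : ℝ} (hc : 0 < c) {A : Set ℂ} (hA : IsFat c A) (w : ℂ)
    (r : ℝ) : ENNReal.ofReal c * shellMeasure w r A ^ 2 ≤ volume (A ∩ Metric.ball w (2 * r)) := by
  by_cases h0 : shellMeasure w r A = 0
  · simp [h0]
  obtain ⟨z, hzA, hz⟩ : (A ∩ Metric.ball w r).Nonempty := by
    by_contra h
    exact h0 (shellMeasure_eq_zero h)
  have hle := shellMeasure_le w r A
  have htop : shellMeasure w r A ≠ ⊤ := ne_top_of_le_ne_top ENNReal.ofReal_ne_top hle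
  have hr : 0 < r := dist_nonneg.trans_lt (Metric.mem_ball.1 hz)
  have hm : 0 < (shellMeasure w r A).toReal := ENNReal.toReal_pos h0 htop
  have hmr : (shellMeasure w r A).toReal ≤ r / 2 := ENNReal.toReal_le_of_le_ofReal (by linarith) hle
  have hdiam : ENNReal.ofReal (shellMeasure w r A).toReal ≤ Metric.ediam A := by
    rw [ENNReal.ofReal_toReal htop]
    refine (measure_mono inter_subset_left).trans ((Real.volume_le_diam _).trans ?_)
    simpa using (lipschitzWith_norm_sub w).ediam_image_le A
  have h := hA.2 z hzA _ hm hdiam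
  rw [ENNReal.ofReal_mul hc.le, ENNReal.ofReal_pow hm.le, ENNReal.ofReal_toReal htop] at h
  refine h.trans (measure_mono (inter_subset_inter_right _ ?_))
  refine Metric.ball_subset_ball' ?_
  have := Metric.mem_ball.1 hz
  linarith

theorem IsFat.volume_pos {c : ℝ} (hc : 0 < c) {A : Set ℂ} (hA : IsFat c A) (hn : A.Nontrivial) :
    0 < volume A := by
  obtain ⟨z, hz, z', hz', hne⟩ := hn
  have hd : 0 < dist z z' := dist_pos.2 hne
  have h := hA.2 z hz (dist z z') hd (by rw [← edist_dist]; exact Metric.edist_le_ediam_of_mem hz hz')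
  refine lt_of_lt_of_le ?_ (h.trans (measure_mono inter_subset_left))
  exact ENNReal.ofReal_pos.2 (by positivity)

theorem two_mul_le_scaled {μ ρ : ENNReal} (hμ : μ ≠ 0) (hμ' : μ ≠ ⊤) (hρ : ρ ≠ 0) (hρ' : ρ ≠ ⊤)
    (a b : ENNReal) :
    2 * (a * b) ≤ ρ * (μ ^ 2 * (ρ⁻¹ ^ 2 * a ^ 2) + μ⁻¹ ^ 2 * b ^ 2) := by
  have h := two_mul_le_add_sq_ennreal (μ * (ρ⁻¹ * a)) (μ⁻¹ * b)
  have e : 2 * (a * b) = ρ * (2 * (μ * (ρ⁻¹ * a) * (μ⁻¹ * b))) := by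
    calc 2 * (a * b) = 2 * ((ρ * ρ⁻¹) * (μ * μ⁻¹) * (a * b)) := by
          rw [ENNReal.mul_inv_cancel hρ hρ', ENNReal.mul_inv_cancel hμ hμ', one_mul, one_mul]
      _ = _ := by ring
  rw [e]
  gcongr
  calc _ ≤ _ := h
    _ = _ := by ring

section Collapse

variable {U U' : Set ℂ} {F : ℂ → ℂ} {K : Set ℂ → Set ℂ}

/-- The complementary components other than `q₀` that are sent to sets with more than one point. -/
def fatComponents (U : Set ℂ) (K : Set ℂ → Set ℂ) (q₀ : Set ℂ) : Set (Set ℂ) :=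
  {q | q ∈ complComponents U ∧ q ≠ q₀ ∧ (K q).Nontrivial}

theorem IsComponentMap.disjoint (hK : IsComponentMap F U U' K) {q q' : Set ℂ}
    (hq : q ∈ complComponents U) (hq' : q' ∈ complComponents U) (hne : q ≠ q') :
    Disjoint (K q) (K q') := disjoint_left.2 fun _ hk hk' =>
  hne (hK.injOn hq hq' (eq_of_mem_complComponents (hK.mem q hq) (hK.mem q' hq') hk hk'))

theorem pairwise_disjoint_fatComponents {q₀ : Set ℂ} :
    Pairwise (Function.onFun Disjoint fun q : fatComponents U K q₀ => (q : Set ℂ)) :=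
  fun q q' hne => disjoint_left.2 fun _ hx hx' =>
    hne (Subtype.ext (eq_of_mem_complComponents q.2.1 q'.2.1 hx hx'))

theorem IsComponentMap.pairwise_disjoint_image (hK : IsComponentMap F U U' K) {q₀ : Set ℂ} :
    Pairwise (Function.onFun Disjoint fun q : fatComponents U K q₀ => K q) :=
  fun q q' hne => hK.disjoint q.2.1 q'.2.1 fun h => hne (Subtype.ext h)

theorem IsComponentMap.countable_fatComponents (hK : IsComponentMap F U U' K) {c : ℝ}
    (hc : 0 < c) (hfat : ∀ k ∈ complComponents U', IsFat c k) {q₀ : Set ℂ} :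
    Countable (fatComponents U K q₀) := by
  have h := Measure.countable_meas_pos_of_disjoint_iUnion (μ := (volume : Measure ℂ))
    (As := fun q : fatComponents U K q₀ => K q) (fun q => (hfat _ (hK.mem q q.2.1)).1)
    hK.pairwise_disjoint_image
  have hall : {q : fatComponents U K q₀ | 0 < volume (K q)} = univ :=
    eq_univ_of_forall fun q => (hfat _ (hK.mem q q.2.1)).volume_pos hc q.2.2.2
  rw [hall] at h
  exact countable_univ_iff.1 h

theorem IsComponentMap.tsum_shellMeasure_sq_le (hK : IsComponentMap F U U' K) {c : ℝ}
    (hc : 0 < c) (hfat : ∀ k ∈ complComponents U', IsFat c k) {q₀ : Set ℂ} (w : ℂ) (r : ℝ) :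
    ∑' q : fatComponents U K q₀, shellMeasure w r (K q) ^ 2 ≤
      (ENNReal.ofReal c)⁻¹ * (4 * ENNReal.ofReal r ^ 2 * NNReal.pi) := by
  have hcount := hK.countable_fatComponents hc hfat (q₀ := q₀)
  have hc0 : ENNReal.ofReal c ≠ 0 := (ENNReal.ofReal_pos.2 hc).ne'
  have hvol : volume (Metric.ball w (2 * r)) = 4 * ENNReal.ofReal r ^ 2 * NNReal.pi := by
    rw [Complex.volume_ball, ENNReal.ofReal_mul (by norm_num), mul_pow, ENNReal.ofReal_ofNat]
    norm_num
  rw [← hvol, ← ENNReal.mul_le_iff_le_inv hc0 ENNReal.ofReal_ne_top, ← ENNReal.tsum_mul_left]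
  calc ∑' q : fatComponents U K q₀, ENNReal.ofReal c * shellMeasure w r (K q) ^ 2
      ≤ ∑' q : fatComponents U K q₀, volume (K q ∩ Metric.ball w (2 * r)) :=
        ENNReal.tsum_le_tsum fun q => (hfat _ (hK.mem q q.2.1)).mul_shellMeasure_sq_le hc w r
    _ = volume (⋃ q : fatComponents U K q₀, K q ∩ Metric.ball w (2 * r)) := by
        rw [measure_iUnion]
        · intro q q' hne
          exact (hK.pairwise_disjoint_image hne).mono inter_subset_left inter_subset_left
        · exact fun q => (hfat _ (hK.mem q q.2.1)).1.inter measurableSet_ball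
    _ ≤ volume (Metric.ball w (2 * r)) :=
        measure_mono (iUnion_subset fun q => inter_subset_right)

/-- The distances `y` from `w` with `r / 2 < y < r` are attained along a ray that starts where `F`
tends to `w`: on the image of the ray, which costs the integral of `|F'|`, on the images of the
components that the ray meets, or at the boundary limits on the ray. -/
theorem IsComponentMap.volume_Ioo_le (hK : IsComponentMap F U U' K) (hU : IsOpen U)
    (hF : DifferentiableOn ℂ F U) (hbd : Bornology.IsBounded Uᶜ) {w : ℂ} (hw : ∀ z ∈ U, F z ≠ w)
    (hfar : ∀ M : ℝ, ∃ R : ℝ, 0 < R ∧ ∀ z : ℂ, R < ‖z‖ → z ∈ U ∧ M < ‖F z‖) {q₀ : Set ℂ}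
    (hq₀ : q₀ ∈ complComponents U) (hcount : Countable (fatComponents U K q₀)) {a u : ℂ}
    (hu : ‖u‖ = 1) {t s₀ : ℝ} (hs₀ : linePoint a u t s₀ ∈ q₀)
    (hleave : ∀ s > s₀, linePoint a u t s ∉ q₀)
    (hwt : Tendsto F (𝓝[U] (linePoint a u t s₀)) (𝓝 w))
    (hnull : volume ((fun z => ‖z - w‖) '' {z | ∃ x ∈ frontier U,
      ((x - a) * (starRingEnd ℂ) u).im = t ∧ Tendsto F (𝓝[U] x) (𝓝 z)}) = 0) {r : ℝ}
    (hr : 0 < r) :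
    ENNReal.ofReal (r / 2) ≤
      (∫⁻ s : ℝ, (U ∩ F ⁻¹' Metric.ball w r).indicator (fun z => ‖deriv F z‖ₑ)
        (linePoint a u t s)) +
      ∑' q : fatComponents U K q₀,
        ((fun x : ℂ => ((x - a) * (starRingEnd ℂ) u).im) '' (q : Set ℂ)).indicator
          (fun _ => shellMeasure w r (K q)) t := by
  set h : ℂ → ℝ := fun z => ‖z - w‖ with hh
  set ℓ := linePoint a u t with hℓ
  have hℓc : Continuous ℓ := continuous_linePoint a u t
  set π : ℂ → ℝ := fun x => ((x - a) * (starRingEnd ℂ) u).im with hπ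
  have hπℓ : ∀ s, π (ℓ s) = t := im_linePoint a hu t
  set S := U ∩ F ⁻¹' Metric.ball w r with hS
  have hSo : IsOpen S := hF.continuousOn.isOpen_inter_preimage hU Metric.isOpen_ball
  set P : Set ℝ := ℓ ⁻¹' S with hP
  have hPo : IsOpen P := hSo.preimage hℓc
  set Z : Set ℂ := {z | ∃ x ∈ frontier U, π x = t ∧ Tendsto F (𝓝[U] x) (𝓝 z)} with hZ
  -- the ray runs off to infinity
  have hout : ∀ R : ℝ, ∃ s > s₀, R < ‖ℓ s‖ := by
    intro R
    refine ⟨max (s₀ + 1) (R + ‖a + t * Complex.I * u‖ + 1),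
      lt_of_lt_of_le (by linarith) (le_max_left _ _), ?_⟩
    set s := max (s₀ + 1) (R + ‖a + t * Complex.I * u‖ + 1)
    have h1 : R + ‖a + t * Complex.I * u‖ + 1 ≤ s := le_max_right _ _
    have h2 : ‖(s : ℂ) * u‖ = |s| := by simp [hu]
    have h3 : ‖(s : ℂ) * u‖ ≤ ‖ℓ s‖ + ‖a + t * Complex.I * u‖ := by
      have : (s : ℂ) * u = ℓ s - (a + t * Complex.I * u) := by
        rw [hℓ, linePoint]
        ring
      rw [this]
      exact norm_sub_le _ _
    have h4 := le_abs_self s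
    linarith
  have hcov : Ioo (r / 2) r ⊆ ((fun s : ℝ => ‖F (ℓ s) - w‖) '' P) ∪
      (⋃ q : fatComponents U K q₀, {y | t ∈ π '' (q : Set ℂ) ∧ y ∈ h '' K q ∩ Ioo (r / 2) r}) ∪
      h '' Z := by
    intro y hy
    have hy0 : 0 < y := by linarith [hy.1]
    have hfar' : ∃ s > s₀, ℓ s ∈ U ∧ y < ‖F (ℓ s) - w‖ := by
      obtain ⟨R, -, hR⟩ := hfar (y + ‖w‖)
      obtain ⟨s, hs, hsR⟩ := hout R
      refine ⟨s, hs, (hR _ hsR).1, ?_⟩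
      have := (hR _ hsR).2
      have := norm_sub_norm_le (F (ℓ s)) w
      linarith
    rcases hK.exists_mem_ray hU hF.continuousOn hℓc hq₀ hs₀ hleave hwt hy0 hfar' with
      ⟨s, -, hsU, hs⟩ | ⟨q, hq, hne, ⟨s, hs, hsq⟩, k, hk, hky⟩
    · exact Or.inl (Or.inl ⟨s, ⟨hsU, mem_ball_iff_norm.2 (hs ▸ hy.2)⟩, hs⟩)
    · by_cases hn : (K q).Nontrivial
      · refine Or.inl (Or.inr (mem_iUnion.2 ⟨⟨q, hq, hne, hn⟩, ?_⟩))
        exact ⟨⟨_, hsq, hπℓ s⟩, ⟨k, hk, hky⟩, hy⟩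
      · -- a component sent to a single point: the ray leaves it through its boundary
        obtain ⟨R, hR⟩ := (Metric.isBounded_iff_subset_closedBall 0).1 hbd
        obtain ⟨s', hs', hs'R⟩ := hout R
        have hs'q : ℓ s' ∉ q := fun h' => by
          have := mem_closedBall_zero_iff.1 (hR (subset_compl_of_mem_complComponents hq h'))
          linarith
        obtain ⟨_, ⟨s'', -, rfl⟩, hx⟩ := inter_frontier_nonempty_of_isPreconnected
          ((isPreconnected_univ (α := ℝ)).image ℓ hℓc.continuousOn)
          ⟨ℓ s, ⟨s, mem_univ _, rfl⟩, hsq⟩ ⟨ℓ s', ⟨s', mem_univ _, rfl⟩, hs'q⟩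
        have hKq : K q = {k} := (not_nontrivial_iff.1 hn).eq_singleton_of_mem hk
        exact Or.inr ⟨k, ⟨ℓ s'', frontier_subset_of_mem_complComponents hU hq hx, hπℓ _,
          hK.tendsto_of_eq_singleton hq hKq
            ((isClosed_of_mem_complComponents hU hq).frontier_subset hx)⟩, hky⟩
  have hA : volume ((fun s : ℝ => ‖F (ℓ s) - w‖) '' P) ≤
      ∫⁻ s : ℝ, S.indicator (fun z => ‖deriv F z‖ₑ) (ℓ s) := by
    refine (volume_image_norm_line_le hU hF hw hu hPo.measurableSet fun s hs => hs.1).trans ?_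
    rw [← lintegral_indicator hPo.measurableSet]
    refine le_of_eq (lintegral_congr fun s => ?_)
    by_cases hs : s ∈ P
    · rw [indicator_of_mem hs, indicator_of_mem (by exact hs)]
      rfl
    · rw [indicator_of_notMem hs, indicator_of_notMem (by exact hs)]
  have hB : volume (⋃ q : fatComponents U K q₀,
      {y | t ∈ π '' (q : Set ℂ) ∧ y ∈ h '' K q ∩ Ioo (r / 2) r}) ≤ ∑' q : fatComponents U K q₀,
        (π '' (q : Set ℂ)).indicator (fun _ => shellMeasure w r (K q)) t := by
    refine (measure_iUnion_le _).trans (ENNReal.tsum_le_tsum fun q => ?_)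
    by_cases hq : t ∈ π '' (q : Set ℂ)
    · rw [indicator_of_mem hq]
      exact measure_mono fun y hy => hy.2
    · have : {y | t ∈ π '' (q : Set ℂ) ∧ y ∈ h '' K q ∩ Ioo (r / 2) r} = ∅ :=
        eq_empty_of_forall_notMem fun y hy => hq hy.1
      rw [this, measure_empty]
      exact zero_le
  calc ENNReal.ofReal (r / 2) = volume (Ioo (r / 2) r) := by
        rw [Real.volume_Ioo]
        congr 1
        ring
    _ ≤ _ := measure_mono hcov
    _ ≤ volume _ + volume _ + volume (h '' Z) :=
        (measure_union_le _ _).trans (add_le_add_left (measure_union_le _ _) _)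
    _ ≤ _ := by
        rw [hnull, add_zero]
        exact add_le_add hA hB

end Collapse


section Collapse

variable {U U' : Set ℂ} {F : ℂ → ℂ} {K : Set ℂ → Set ℂ}

/-- The part of the plane covered by the components, other than `q₀`, that are sent to sets with
more than one point and with points at distance less than `r` from `w`. -/
def nearComponents (U : Set ℂ) (K : Set ℂ → Set ℂ) (q₀ : Set ℂ) (w : ℂ) (r : ℝ) : Set ℂ :=
  ⋃ q : fatComponents U K q₀, {x | x ∈ (q : Set ℂ) ∧ (K q ∩ Metric.ball w r).Nonempty}

theorem measurableSet_near (hU : IsOpen U) {q₀ : Set ℂ} (w : ℂ) (r : ℝ)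
    (q : fatComponents U K q₀) :
    MeasurableSet {x | x ∈ (q : Set ℂ) ∧ (K q ∩ Metric.ball w r).Nonempty} := by
  by_cases h : (K q ∩ Metric.ball w r).Nonempty
  · simpa [h] using (isClosed_of_mem_complComponents hU q.2.1).measurableSet
  · simp [h]

theorem nearComponents_subset {q₀ : Set ℂ} {w : ℂ} {r : ℝ} : nearComponents U K q₀ w r ⊆ Uᶜ :=
  iUnion_subset fun q _ hx => subset_compl_of_mem_complComponents q.2.1 hx.1

theorem ediam_sq_le_of_closedBall {a : ℂ} {r : ℝ} :
    Metric.ediam (Metric.closedBall a r) ^ 2 ≤ 2 * volume (Metric.closedBall a r) := by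
  have h1 : Metric.ediam (Metric.closedBall a r) ≤ 2 * ENNReal.ofReal r := by
    refine Metric.ediam_le fun x hx y hy => ?_
    rw [edist_dist, ← ENNReal.ofReal_ofNat 2, ← ENNReal.ofReal_mul (by norm_num)]
    refine ENNReal.ofReal_le_ofReal ?_
    have h1 := Metric.mem_closedBall.1 hx
    have h2 := Metric.mem_closedBall.1 hy
    have h3 := dist_triangle_right x y a
    linarith
  have hpi : (2 : ENNReal) ≤ NNReal.pi := by
    have : (2 : NNReal) ≤ NNReal.pi := by
      rw [← NNReal.coe_le_coe]
      exact Real.two_le_pi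
    exact_mod_cast this
  calc Metric.ediam (Metric.closedBall a r) ^ 2 ≤ (2 * ENNReal.ofReal r) ^ 2 := by gcongr
    _ = 2 * (ENNReal.ofReal r ^ 2 * 2) := by ring
    _ ≤ 2 * (ENNReal.ofReal r ^ 2 * NNReal.pi) := by gcongr
    _ = _ := by rw [Complex.volume_closedBall]

/-- The length–area estimate, with a free weight `μ` coming from `2ab ≤ (μ a) ^ 2 + (b / μ) ^ 2`. -/
theorem IsComponentMap.volume_le (hK : IsComponentMap F U U' K) (hU : IsOpen U)
    (hF : DifferentiableOn ℂ F U) (hinj : InjOn F U)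
    (hball : ∀ q ∈ complComponents U, ∃ (a : ℂ) (r : ℝ), q = Metric.closedBall a r) {c : ℝ}
    (hc : 0 < c) (hfat : ∀ k ∈ complComponents U', IsFat c k) {w : ℂ} {q₀ : Set ℂ}
    {a u : ℂ} (hu : ‖u‖ = 1) {T : Set ℝ} {r : ℝ} (hr : 0 < r)
    (hT : ∀ᵐ t, t ∈ T → ENNReal.ofReal (r / 2) ≤
      (∫⁻ s : ℝ, (U ∩ F ⁻¹' Metric.ball w r).indicator (fun z => ‖deriv F z‖ₑ)
        (linePoint a u t s)) +
      ∑' q : fatComponents U K q₀,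
        ((fun x : ℂ => ((x - a) * (starRingEnd ℂ) u).im) '' (q : Set ℂ)).indicator
          (fun _ => shellMeasure w r (K q)) t) (hTm : MeasurableSet T) {μ : ENNReal}
    (hμ : μ ≠ 0) (hμ' : μ ≠ ⊤) :
    volume T ≤ μ ^ 2 * (NNReal.pi + (ENNReal.ofReal c)⁻¹ * (4 * NNReal.pi)) +
      μ⁻¹ ^ 2 * (volume (U ∩ F ⁻¹' Metric.ball w r) +
        2 * volume (nearComponents U K q₀ w r)) := by
  have hcount := hK.countable_fatComponents hc hfat (q₀ := q₀)
  set S := U ∩ F ⁻¹' Metric.ball w r with hS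
  have hSm : MeasurableSet S :=
    (hF.continuousOn.isOpen_inter_preimage hU Metric.isOpen_ball).measurableSet
  set π : ℂ → ℝ := fun x => ((x - a) * (starRingEnd ℂ) u).im with hπ
  have hπL : LipschitzWith 1 π := lipschitzWith_im_mul_conj a hu
  set m : fatComponents U K q₀ → ENNReal := fun q => shellMeasure w r (K q) with hm
  set ρ := ENNReal.ofReal r with hρ
  have hρ0 : ρ ≠ 0 := (ENNReal.ofReal_pos.2 hr).ne'
  have hρt : ρ ≠ ⊤ := ENNReal.ofReal_ne_top
  have hρρ : ρ⁻¹ ^ 2 * ρ ^ 2 = 1 := by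
    rw [← mul_pow, ENNReal.inv_mul_cancel hρ0 hρt, one_pow]
  have hρ2 : ρ = 2 * ENNReal.ofReal (r / 2) := by
    rw [← ENNReal.ofReal_ofNat 2, ← ENNReal.ofReal_mul (by norm_num), hρ]
    congr 1
    ring
  have hderm : Measurable fun z => ‖deriv F z‖ₑ := (measurable_deriv F).enorm
  have hqm : ∀ q : fatComponents U K q₀, MeasurableSet (π '' (q : Set ℂ)) := by
    intro q
    obtain ⟨b, s, hbs⟩ := hball q q.2.1
    rw [hbs]
    exact ((isCompact_closedBall b s).image hπL.continuous).measurableSet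
  -- integration over `T`
  have h1 : ENNReal.ofReal (r / 2) * volume T ≤
      (∫⁻ z in S, ‖deriv F z‖ₑ) + ∑' q : fatComponents U K q₀, m q * volume (π '' (q : Set ℂ)) := by
    have hmeas : Measurable fun t : ℝ => ∑' q : fatComponents U K q₀,
        (π '' (q : Set ℂ)).indicator (fun _ => m q) t :=
      Measurable.tsum fun q => measurable_const.indicator (hqm q)
    calc ENNReal.ofReal (r / 2) * volume T = ∫⁻ t in T, ENNReal.ofReal (r / 2) := by
          rw [setLIntegral_const]
      _ ≤ ∫⁻ t in T, ((∫⁻ s : ℝ, S.indicator (fun z => ‖deriv F z‖ₑ) (linePoint a u t s)) +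
            ∑' q : fatComponents U K q₀, (π '' (q : Set ℂ)).indicator (fun _ => m q) t) :=
          lintegral_mono_ae ((ae_restrict_iff' hTm).2 hT)
      _ ≤ ∫⁻ t : ℝ, ((∫⁻ s : ℝ, S.indicator (fun z => ‖deriv F z‖ₑ) (linePoint a u t s)) +
            ∑' q : fatComponents U K q₀, (π '' (q : Set ℂ)).indicator (fun _ => m q) t) :=
          setLIntegral_le_lintegral _ _
      _ = _ := by
          rw [lintegral_add_right _ hmeas,
            ← lintegral_eq_lintegral_linePoint a hu (hderm.indicator hSm),
            lintegral_indicator hSm,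
            lintegral_tsum fun q => (measurable_const.indicator (hqm q)).aemeasurable]
          congr 1
          refine tsum_congr fun q => ?_
          rw [lintegral_indicator (hqm q), setLIntegral_const]
  have h2 : 2 * ∫⁻ z in S, ‖deriv F z‖ₑ ≤
      ρ * (μ ^ 2 * NNReal.pi + μ⁻¹ ^ 2 * volume S) := by
    have hpt : ∀ z, 2 * ‖deriv F z‖ₑ ≤
        ρ * (μ ^ 2 * (ρ⁻¹ ^ 2 * ‖deriv F z‖ₑ ^ 2) + μ⁻¹ ^ 2) := fun z => by
      simpa using two_mul_le_scaled hμ hμ' hρ0 hρt ‖deriv F z‖ₑ 1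
    have himg : F '' S ⊆ Metric.ball w r := by
      rintro _ ⟨z, hz, rfl⟩
      exact hz.2
    calc 2 * ∫⁻ z in S, ‖deriv F z‖ₑ = ∫⁻ z in S, 2 * ‖deriv F z‖ₑ :=
          (lintegral_const_mul _ hderm).symm
      _ ≤ ∫⁻ z in S, ρ * (μ ^ 2 * (ρ⁻¹ ^ 2 * ‖deriv F z‖ₑ ^ 2) + μ⁻¹ ^ 2) :=
          lintegral_mono fun z => hpt z
      _ = ρ * (μ ^ 2 * (ρ⁻¹ ^ 2 * volume (F '' S)) + μ⁻¹ ^ 2 * volume S) := by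
          rw [lintegral_const_mul' _ _ hρt, lintegral_add_right _ measurable_const,
            lintegral_const_mul _ ((hderm.pow_const 2).const_mul _),
            lintegral_const_mul _ (hderm.pow_const 2), setLIntegral_const,
            lintegral_deriv_sq_eq_volume_image hU hF hinj hSm inter_subset_left]
      _ ≤ ρ * (μ ^ 2 * (ρ⁻¹ ^ 2 * (ρ ^ 2 * NNReal.pi)) + μ⁻¹ ^ 2 * volume S) := by
          gcongr
          exact (measure_mono himg).trans (Complex.volume_ball w r).le
      _ = ρ * (μ ^ 2 * ((ρ⁻¹ ^ 2 * ρ ^ 2) * NNReal.pi) + μ⁻¹ ^ 2 * volume S) := by ring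
      _ = _ := by rw [hρρ, one_mul]
  have h3 : 2 * ∑' q : fatComponents U K q₀, m q * volume (π '' (q : Set ℂ)) ≤
      ρ * (μ ^ 2 * ((ENNReal.ofReal c)⁻¹ * (4 * NNReal.pi)) +
        μ⁻¹ ^ 2 * (2 * volume (nearComponents U K q₀ w r))) := by
    have hq : ∀ q : fatComponents U K q₀, 2 * (m q * volume (π '' (q : Set ℂ))) ≤
        ρ * (μ ^ 2 * (ρ⁻¹ ^ 2 * m q ^ 2) + μ⁻¹ ^ 2 *
          (2 * volume {x | x ∈ (q : Set ℂ) ∧ (K q ∩ Metric.ball w r).Nonempty})) := by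
      intro q
      by_cases hne : (K q ∩ Metric.ball w r).Nonempty
      · refine (two_mul_le_scaled hμ hμ' hρ0 hρt _ _).trans ?_
        gcongr
        have hset : {x | x ∈ (q : Set ℂ) ∧ (K q ∩ Metric.ball w r).Nonempty} = q := by
          ext x
          simp [hne]
        rw [hset]
        have hd : volume (π '' (q : Set ℂ)) ≤ Metric.ediam (q : Set ℂ) :=
          (Real.volume_le_diam _).trans (by simpa using hπL.ediam_image_le (q : Set ℂ))
        obtain ⟨b, s, hbs⟩ := hball q q.2.1
        calc volume (π '' (q : Set ℂ)) ^ 2 ≤ Metric.ediam (q : Set ℂ) ^ 2 := by gcongr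
          _ ≤ _ := by
            rw [hbs]
            exact ediam_sq_le_of_closedBall
      · have : m q = 0 := shellMeasure_eq_zero hne
        simp [this]
    rw [← ENNReal.tsum_mul_left]
    refine (ENNReal.tsum_le_tsum hq).trans ?_
    rw [ENNReal.tsum_mul_left, ENNReal.tsum_add, ENNReal.tsum_mul_left, ENNReal.tsum_mul_left,
      ENNReal.tsum_mul_left, ENNReal.tsum_mul_left, nearComponents, measure_iUnion]
    · gcongr ρ * (μ ^ 2 * ?_ + _)
      calc ρ⁻¹ ^ 2 * ∑' q : fatComponents U K q₀, m q ^ 2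
          ≤ ρ⁻¹ ^ 2 * ((ENNReal.ofReal c)⁻¹ * (4 * ρ ^ 2 * NNReal.pi)) := by
            gcongr
            exact hK.tsum_shellMeasure_sq_le hc hfat w r
        _ = (ρ⁻¹ ^ 2 * ρ ^ 2) * ((ENNReal.ofReal c)⁻¹ * (4 * NNReal.pi)) := by ring
        _ = _ := by rw [hρρ, one_mul]
    · exact fun q q' hne => (pairwise_disjoint_fatComponents hne).mono (fun _ h => h.1) fun _ h => h.1
    · exact measurableSet_near hU w r
  rw [← ENNReal.mul_le_mul_iff_right hρ0 hρt]
  calc ρ * volume T = 2 * (ENNReal.ofReal (r / 2) * volume T) := by rw [← mul_assoc, ← hρ2]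
    _ ≤ 2 * ((∫⁻ z in S, ‖deriv F z‖ₑ) +
          ∑' q : fatComponents U K q₀, m q * volume (π '' (q : Set ℂ))) := by gcongr
    _ = 2 * (∫⁻ z in S, ‖deriv F z‖ₑ) +
          2 * ∑' q : fatComponents U K q₀, m q * volume (π '' (q : Set ℂ)) := mul_add _ _ _
    _ ≤ _ := add_le_add h2 h3
    _ = _ := by ring

/-- Under the uniform fatness of the image components, the lines on which `F` tends to one and the
same point `w` at a point of a boundary circle form a null set. -/
theorem IsComponentMap.volume_eq_zero (hK : IsComponentMap F U U' K) (hU : IsOpen U)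
    (hU' : IsOpen U') (hF : DifferentiableOn ℂ F U) (hinj : InjOn F U)
    (hbd : Bornology.IsBounded Uᶜ) (hw : ∀ z ∈ U, F z ≠ w)
    (hfar : ∀ M : ℝ, ∃ R : ℝ, 0 < R ∧ ∀ z : ℂ, R < ‖z‖ → z ∈ U ∧ M < ‖F z‖)
    (hball : ∀ q ∈ complComponents U, ∃ (a : ℂ) (r : ℝ), q = Metric.closedBall a r) {c : ℝ}
    (hc : 0 < c) (hfat : ∀ k ∈ complComponents U', IsFat c k) {q₀ : Set ℂ}
    (hq₀ : q₀ ∈ complComponents U) (hwq₀ : w ∈ K q₀) {a u : ℂ} (hu : ‖u‖ = 1) {T : Set ℝ}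
    (hTm : MeasurableSet T)
    (hray : ∀ t ∈ T, ∃ s₀, linePoint a u t s₀ ∈ q₀ ∧ (∀ s > s₀, linePoint a u t s ∉ q₀) ∧
      Tendsto F (𝓝[U] (linePoint a u t s₀)) (𝓝 w))
    (hnull : ∀ᵐ t : ℝ, volume ((fun z => ‖z - w‖) '' {z | ∃ x ∈ frontier U,
      ((x - a) * (starRingEnd ℂ) u).im = t ∧ Tendsto F (𝓝[U] x) (𝓝 z)}) = 0) :
    volume T = 0 := by
  have hcount := hK.countable_fatComponents hc hfat (q₀ := q₀)
  set rr : ℕ → ℝ := fun n => 1 / ((n : ℝ) + 1) with hrr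
  have hrr0 : ∀ n, 0 < rr n := fun n => by positivity
  have hrranti : Antitone rr := fun m n hmn => one_div_le_one_div_of_le (by positivity) (by
    have : (m : ℝ) ≤ n := by exact_mod_cast hmn
    linarith)
  have hrrlim : Tendsto rr atTop (𝓝 0) := tendsto_one_div_add_atTop_nhds_zero_nat
  have hsmall : ∀ x : ℂ, (∀ n, x ∈ Metric.ball w (rr n)) → x = w := fun x hx => by
    have h1 : dist x w ≤ 0 := ge_of_tendsto' hrrlim fun n => (Metric.mem_ball.1 (hx n)).le
    exact dist_le_zero.1 h1
  have hball1 : ∀ n, Metric.ball w (rr n) ⊆ Metric.ball w 1 := fun n =>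
    Metric.ball_subset_ball (by simpa [hrr] using hrranti (Nat.zero_le n))
  have hS : Tendsto (fun n => volume (U ∩ F ⁻¹' Metric.ball w (rr n))) atTop (𝓝 0) := by
    have h := tendsto_measure_iInter_atTop (μ := (volume : Measure ℂ))
      (s := fun n => U ∩ F ⁻¹' Metric.ball w (rr n))
      (fun n => (hF.continuousOn.isOpen_inter_preimage hU
        Metric.isOpen_ball).measurableSet.nullMeasurableSet)
      (fun m n hmn => inter_subset_inter_right _ (preimage_mono
        (Metric.ball_subset_ball (hrranti hmn)))) ⟨0, by
        obtain ⟨R, -, hR⟩ := hfar (‖w‖ + 1)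
        refine ne_top_of_le_ne_top (measure_closedBall_lt_top (x := (0 : ℂ)) (r := R)).ne
          (measure_mono fun z hz => ?_)
        by_contra hz'
        have h1 := (hR z (by simpa using hz')).2
        have h2 := mem_ball_iff_norm.1 (hball1 0 hz.2)
        have h3 := norm_le_norm_add_norm_sub' (F z) w
        linarith⟩
    have hempty : (⋂ n, U ∩ F ⁻¹' Metric.ball w (rr n)) = ∅ := by
      refine eq_empty_of_forall_notMem fun z hz => ?_
      rw [mem_iInter] at hz
      exact hw z (hz 0).1 (hsmall _ fun n => (hz n).2)
    rw [hempty, measure_empty] at h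
    exact h
  have hV : Tendsto (fun n => volume (nearComponents U K q₀ w (rr n))) atTop (𝓝 0) := by
    have h := tendsto_measure_iInter_atTop (μ := (volume : Measure ℂ))
      (s := fun n => nearComponents U K q₀ w (rr n))
      (fun n => (MeasurableSet.iUnion fun q => measurableSet_near hU w _ q).nullMeasurableSet)
      (fun m n hmn => iUnion_mono fun q x hx => ⟨hx.1, hx.2.mono (inter_subset_inter_right _
        (Metric.ball_subset_ball (hrranti hmn)))⟩)
      ⟨0, ne_top_of_le_ne_top hbd.measure_lt_top.ne (measure_mono nearComponents_subset)⟩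
    have hempty : (⋂ n, nearComponents U K q₀ w (rr n)) = ∅ := by
      refine eq_empty_of_forall_notMem fun x hx => ?_
      rw [mem_iInter] at hx
      obtain ⟨q, hxq, -⟩ := mem_iUnion.1 (hx 0)
      have hqn : ∀ n, (K q ∩ Metric.ball w (rr n)).Nonempty := fun n => by
        obtain ⟨q', hxq', hne⟩ := mem_iUnion.1 (hx n)
        rwa [eq_of_mem_complComponents q.2.1 q'.2.1 hxq hxq']
      have hwq : w ∈ K q := by
        rw [← (isClosed_of_mem_complComponents hU' (hK.mem q q.2.1)).closure_eq,
          Metric.mem_closure_iff]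
        intro ε hε
        obtain ⟨n, hn⟩ := (hrrlim.eventually_lt_const hε).exists
        obtain ⟨k, hk, hkn⟩ := hqn n
        exact ⟨k, hk, (dist_comm w k ▸ Metric.mem_ball.1 hkn).trans hn⟩
      exact disjoint_left.1 (hK.disjoint q.2.1 hq₀ q.2.2.1) hwq hwq₀
    rw [hempty, measure_empty] at h
    exact h
  set C : ENNReal := NNReal.pi + (ENNReal.ofReal c)⁻¹ * (4 * NNReal.pi) with hC
  have hCt : C ≠ ⊤ := by
    refine ENNReal.add_ne_top.2 ⟨ENNReal.coe_ne_top, ENNReal.mul_ne_top ?_ ?_⟩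
    · exact ENNReal.inv_ne_top.2 (ENNReal.ofReal_pos.2 hc).ne'
    · exact ENNReal.mul_ne_top (by simp) ENNReal.coe_ne_top
  have hbound : ∀ μ : ENNReal, μ ≠ 0 → μ ≠ ⊤ → volume T ≤ μ ^ 2 * C := by
    intro μ hμ hμ'
    have hlim : Tendsto (fun n => μ ^ 2 * C + μ⁻¹ ^ 2 *
        (volume (U ∩ F ⁻¹' Metric.ball w (rr n)) + 2 * volume (nearComponents U K q₀ w (rr n))))
        atTop (𝓝 (μ ^ 2 * C + μ⁻¹ ^ 2 * (0 + 2 * 0))) :=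
      tendsto_const_nhds.add (ENNReal.Tendsto.const_mul
        (hS.add (ENNReal.Tendsto.const_mul hV (Or.inr (by simp))))
        (Or.inr (ENNReal.pow_ne_top (ENNReal.inv_ne_top.2 hμ))))
    have h := ge_of_tendsto' hlim fun n => hK.volume_le hU hF hinj hball hc hfat (q₀ := q₀) hu
      (hrr0 n) (a := a) (T := T) (by
        filter_upwards [hnull] with t ht htT
        obtain ⟨s₀, hs₀, hleave, hwt⟩ := hray t htT
        exact hK.volume_Ioo_le hU hF hbd hw hfar hq₀ hcount hu hs₀ hleave hwt ht (hrr0 n))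
      hTm hμ hμ'
    simpa using h
  have hlim : Tendsto (fun n : ℕ => ((n : ENNReal)⁻¹) ^ 2 * C) atTop (𝓝 (0 ^ 2 * C)) :=
    ENNReal.Tendsto.mul_const (ENNReal.Tendsto.pow ENNReal.tendsto_inv_nat_nhds_zero) (Or.inr hCt)
  have h := ge_of_tendsto hlim (by
    filter_upwards [eventually_ge_atTop 1] with n hn
    exact hbound _ (by simp) (by simp; omega))
  simpa using h

end Collapse


/-! ### Arcs do not collapse -/

section Arc

/-- A non-degenerate connected set `E` on a circle has a projection of positive length in a suitable
direction `u`, already when only the half of `E` facing the direction `u` is projected. -/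
theorem exists_projection_pos {a : ℂ} {ρ : ℝ} {E : Set ℂ} (hE : IsPreconnected E)
    (hEs : E ⊆ Metric.sphere a ρ) (hn : E.Nontrivial) :
    ∃ u : ℂ, ‖u‖ = 1 ∧ 0 < volume ((fun x : ℂ => ((x - a) * (starRingEnd ℂ) u).im) ''
      {x | x ∈ E ∧ 0 ≤ ((x - a) * (starRingEnd ℂ) u).re}) := by
  obtain ⟨e, he, e', he', hne⟩ := hn
  have hea : ‖e - a‖ = ρ := mem_sphere_iff_norm.1 (hEs he)
  have hea' : ‖e' - a‖ = ρ := mem_sphere_iff_norm.1 (hEs he')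
  have hρ : 0 < ρ := by
    rcases (hea ▸ norm_nonneg _ : 0 ≤ ρ).eq_or_lt with h | h
    · rw [← h, norm_eq_zero, sub_eq_zero] at hea hea'
      exact absurd (hea.trans hea'.symm) hne
    · exact h
  have hρc : (ρ : ℂ) ≠ 0 := by exact_mod_cast hρ.ne'
  set u : ℂ := (e - a) / ρ with hu_def
  have hu : ‖u‖ = 1 := by
    rw [hu_def, norm_div, hea, Complex.norm_real, Real.norm_of_nonneg hρ.le, div_self hρ.ne']
  refine ⟨u, hu, ?_⟩
  set σ : ℂ → ℝ := fun x => ((x - a) * (starRingEnd ℂ) u).re with hσ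
  set π : ℂ → ℝ := fun x => ((x - a) * (starRingEnd ℂ) u).im with hπ
  have hsq : ∀ x ∈ E, π x ^ 2 + σ x ^ 2 = ρ ^ 2 := fun x hx => by
    have h := norm_linePoint_sub a hu (π x) (σ x)
    rw [linePoint_of_coord a hu x, mem_sphere_iff_norm.1 (hEs hx)] at h
    exact h.symm
  have hσe : σ e = ρ := by
    have h : (e - a) = ρ * u := by
      rw [hu_def]
      field_simp
    have h2 : u * (starRingEnd ℂ) u = 1 := by
      rw [Complex.mul_conj, Complex.normSq_eq_norm_sq, hu]
      simp
    change ((e - a) * (starRingEnd ℂ) u).re = ρ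
    rw [h, mul_assoc, h2, mul_one, Complex.ofReal_re]
  have hπe : π e = 0 := by
    have := hsq e he
    rw [hσe] at this
    exact pow_eq_zero_iff two_ne_zero |>.1 (by linarith)
  have hσe' : σ e' < ρ := by
    refine lt_of_le_of_ne (by nlinarith [hsq e' he', sq_nonneg (π e')]) fun h => hne ?_
    have hπe' : π e' = 0 := by
      have := hsq e' he'
      rw [h] at this
      exact pow_eq_zero_iff two_ne_zero |>.1 (by linarith)
    rw [← linePoint_of_coord a hu e, ← linePoint_of_coord a hu e']
    change linePoint a u (π e) (σ e) = linePoint a u (π e') (σ e')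
    rw [hσe, hπe, h, hπe']
  set σ₁ := max (σ e') 0 with hσ₁
  have hσ₁ρ : σ₁ < ρ := max_lt hσe' hρ
  have hσ₁0 : 0 ≤ σ₁ := le_max_right _ _
  set τ := √(ρ ^ 2 - σ₁ ^ 2) with hτ
  have hτ0 : 0 < τ := Real.sqrt_pos.2 (by nlinarith)
  have hτsq : τ ^ 2 = ρ ^ 2 - σ₁ ^ 2 := Real.sq_sqrt (by nlinarith)
  set T := π '' {x | x ∈ E ∧ 0 ≤ σ x} with hT
  -- up to sign, every small number is the projection of a point of `E`
  have hsub : Icc 0 τ ⊆ T ∪ -T := by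
    intro y hy
    have hyτ : y ^ 2 ≤ τ ^ 2 := pow_le_pow_left₀ hy.1 hy.2 2
    set s := √(ρ ^ 2 - y ^ 2) with hs
    have hs0 : 0 ≤ s := Real.sqrt_nonneg _
    have hssq : s ^ 2 = ρ ^ 2 - y ^ 2 := Real.sq_sqrt (by nlinarith)
    have hσs : σ₁ ≤ s := by
      refine abs_le_of_sq_le_sq' (by linarith) hs0 |>.2
    have hsρ : s ≤ ρ := by
      refine abs_le_of_sq_le_sq' (by nlinarith [sq_nonneg y]) hρ.le |>.2
    have himg : Icc (σ e') (σ e) ⊆ σ '' E :=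
      (hE.image σ (by fun_prop)).Icc_subset ⟨e', he', rfl⟩ ⟨e, he, rfl⟩
    obtain ⟨x, hx, hxs⟩ := himg ⟨(le_max_left _ _).trans hσs, hσe ▸ hsρ⟩
    have hxy : π x ^ 2 = y ^ 2 := by
      have := hsq x hx
      rw [hxs] at this
      linarith
    have hxT : π x ∈ T := ⟨x, ⟨hx, hxs ▸ hs0⟩, rfl⟩
    rcases sq_eq_sq_iff_eq_or_eq_neg.1 hxy with h | h
    · exact Or.inl (h ▸ hxT)
    · refine Or.inr ?_
      rw [Set.mem_neg, ← h]
      exact hxT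
  by_contra hcon
  have h0 : volume T = 0 := le_antisymm (not_lt.1 hcon) zero_le
  have h1 : volume (Icc 0 τ) ≤ 0 :=
    (measure_mono hsub).trans ((measure_union_le _ _).trans (by
      rw [Measure.measure_neg, h0, add_zero]))
  rw [Real.volume_Icc, sub_zero] at h1
  exact absurd h1 (not_le.2 (ENNReal.ofReal_pos.2 hτ0))

variable {U U' : Set ℂ} {F G : ℂ → ℂ}

/-- A proper conformal map satisfying the hypotheses of fatness and of null boundary limits on
almost all lines does not tend to a single point along an arc of a boundary circle. -/
theorem ProperHomeo.not_tendsto_on_arc (h : ProperHomeo F G U U') (hF : DifferentiableOn ℂ F U)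
    (hfar : ∀ M : ℝ, ∃ R : ℝ, 0 < R ∧ ∀ z : ℂ, R < ‖z‖ → z ∈ U ∧ M < ‖F z‖)
    (hball : ∀ q ∈ complComponents U, ∃ (a : ℂ) (r : ℝ), q = Metric.closedBall a r) {c : ℝ}
    (hc : 0 < c) (hfat : ∀ k ∈ complComponents U', IsFat c k) {w : ℂ}
    (hnull : ∀ a u : ℂ, ‖u‖ = 1 → ∀ᵐ t : ℝ, volume ((fun z => ‖z - w‖) '' {z | ∃ x ∈ frontier U,
      ((x - a) * (starRingEnd ℂ) u).im = t ∧ Tendsto F (𝓝[U] x) (𝓝 z)}) = 0)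
    {a : ℂ} {ρ : ℝ} (hq₀ : Metric.closedBall a ρ ∈ complComponents U) {E : Set ℂ}
    (hE : IsCompact E) (hEc : IsPreconnected E) (hEn : E.Nontrivial)
    (hEs : E ⊆ Metric.sphere a ρ) (hEU : E ⊆ frontier U)
    (hw : ∀ e ∈ E, Tendsto F (𝓝[U] e) (𝓝 w)) : False := by
  obtain ⟨K, hK⟩ := h.exists_componentMap
  have hU := h.isOpen_left
  -- the point `w` belongs to the component corresponding to the disk
  have hwq : w ∈ K (Metric.closedBall a ρ) := by
    by_contra hcon
    obtain ⟨e, he⟩ := hEn.nonempty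
    have hkc := isClosed_of_mem_complComponents h.isOpen_right (hK.mem _ hq₀)
    obtain ⟨δ, hδ, hδK⟩ := Metric.isOpen_iff.1 hkc.isOpen_compl w hcon
    obtain ⟨N, hN, hqN, hmap⟩ := hK.mapsTo _ hq₀ (Metric.closedBall w (δ / 2))ᶜ
      Metric.isClosed_closedBall.isOpen_compl fun k hk hk' => hδK
        (Metric.closedBall_subset_ball (by linarith) hk') hk
    have : (𝓝[U] e).NeBot := mem_closure_iff_nhdsWithin_neBot.1 (frontier_subset_closure (hEU he))
    have hwe : ∀ᶠ z in 𝓝[U] e, F z ∈ Metric.closedBall w (δ / 2) :=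
      hw e he (Metric.closedBall_mem_nhds w (half_pos hδ))
    obtain ⟨z, hz, hzU, hzN⟩ := (hwe.and (eventually_mem_nhdsWithin.and (nhdsWithin_le_nhds
        (hN.mem_nhds (hqN (Metric.sphere_subset_closedBall (hEs he))))))).exists
    exact hmap ⟨hzN, hzU⟩ hz
  have hwU : ∀ z ∈ U, F z ≠ w := fun z hz hzw =>
    subset_compl_of_mem_complComponents (hK.mem _ hq₀) hwq (hzw ▸ h.mapsTo_left hz)
  have hinj : InjOn F U := fun x hx y hy hxy => by
    rw [← h.leftInv x hx, ← h.leftInv y hy, hxy]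
  obtain ⟨u, hu, hpos⟩ := exists_projection_pos hEc hEs hEn
  have hT : IsCompact ((fun x : ℂ => ((x - a) * (starRingEnd ℂ) u).im) ''
      {x | x ∈ E ∧ 0 ≤ ((x - a) * (starRingEnd ℂ) u).re}) :=
    (hE.inter_right (t := {x | 0 ≤ ((x - a) * (starRingEnd ℂ) u).re})
      (isClosed_le continuous_const (by fun_prop))).image (by fun_prop)
  refine hpos.ne' (hK.volume_eq_zero hU h.isOpen_right hF hinj h.compl_left hwU hfar hball hc hfat
    hq₀ hwq hu hT.measurableSet ?_ (hnull a u hu))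
  rintro _ ⟨x, ⟨hxE, hx0⟩, rfl⟩
  refine ⟨((x - a) * (starRingEnd ℂ) u).re, ?_, ?_, ?_⟩
  · rw [linePoint_of_coord a hu]
    exact Metric.sphere_subset_closedBall (hEs hxE)
  · intro s hs hsq
    have h1 := norm_linePoint_sub a hu ((x - a) * (starRingEnd ℂ) u).im s
    have h2 := norm_linePoint_sub a hu ((x - a) * (starRingEnd ℂ) u).im
      ((x - a) * (starRingEnd ℂ) u).re
    rw [linePoint_of_coord a hu, mem_sphere_iff_norm.1 (hEs hxE)] at h2
    have h3 := pow_le_pow_left₀ (norm_nonneg _) (mem_closedBall_iff_norm.1 hsq) 2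
    have h4 := pow_lt_pow_left₀ hs hx0 two_ne_zero
    linarith
  · rw [linePoint_of_coord a hu]
    exact hw x hxE

end Arc

/-! ### Cluster sets -/

section Cluster

/-- The cluster set at `E` of a map of the plane domain `U`. -/
def planeClusterSet (F : ℂ → ℂ) (U E : Set ℂ) : Set ℂ :=
  ⋂ (ε : ℝ) (_ : 0 < ε), closure (F '' (Metric.thickening ε E ∩ U))

theorem mem_planeClusterSet_of_mapClusterPt {F : ℂ → ℂ} {U E : Set ℂ} {e y : ℂ} (he : e ∈ E)
    (hy : MapClusterPt y (𝓝[U] e) F) : y ∈ planeClusterSet F U E := by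
  refine mem_iInter₂.2 fun ε hε => ?_
  refine mem_closure_iff_clusterPt.2 (ClusterPt.mono hy.clusterPt (le_principal_iff.2 ?_))
  rw [mem_map]
  filter_upwards [self_mem_nhdsWithin, nhdsWithin_le_nhds
    (Metric.isOpen_thickening.mem_nhds (Metric.self_subset_thickening hε E he))] with t ht1 ht2
  exact mem_image_of_mem F ⟨ht2, ht1⟩

theorem closure_image_coe {B : Set ℂ} (hB : Bornology.IsBounded B) :
    closure ((fun z : ℂ => (z : Sphere)) '' B) = (fun z : ℂ => (z : Sphere)) '' closure B :=
  Subset.antisymm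
    (closure_minimal (image_mono subset_closure)
      (hB.isCompact_closure.image OnePoint.continuous_coe).isClosed)
    (image_closure_subset_closure_image OnePoint.continuous_coe)

variable {f : Sphere → Sphere} {Ω Ω' E : Set Sphere}

theorem clusterSet_eq (hf : IsConformalMapOnto f Ω Ω') (hinf : OnePoint.infty ∈ Ω)
    (hΩ : IsOpen Ω) (hfinf : f OnePoint.infty = OnePoint.infty)
    (hE : Bornology.IsBounded ((fun z : ℂ => (z : Sphere)) ⁻¹' E)) :
    clusterSet f Ω E = (fun z : ℂ => (z : Sphere)) '' planeClusterSet (planeMap f) (finitePart Ω)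
      ((fun z : ℂ => (z : Sphere)) ⁻¹' E) := by
  set E₀ := (fun z : ℂ => (z : Sphere)) ⁻¹' E
  have himg : ∀ ε, f '' (openNeighbourhood ε E ∩ Ω) = (fun z : ℂ => (z : Sphere)) ''
      (planeMap f '' (Metric.thickening ε E₀ ∩ finitePart Ω)) := by
    intro ε
    ext p
    constructor
    · rintro ⟨_, ⟨⟨z, hz, rfl⟩, hzΩ⟩, rfl⟩
      exact ⟨_, ⟨z, ⟨hz, hzΩ⟩, rfl⟩, coe_planeMap hf hinf hfinf hzΩ⟩
    · rintro ⟨_, ⟨z, ⟨hz, hzΩ⟩, rfl⟩, rfl⟩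
      exact ⟨z, ⟨⟨z, hz, rfl⟩, hzΩ⟩, (coe_planeMap hf hinf hfinf hzΩ).symm⟩
  have hcl : ∀ ε, closure (f '' (openNeighbourhood ε E ∩ Ω)) = (fun z : ℂ => (z : Sphere)) ''
      closure (planeMap f '' (Metric.thickening ε E₀ ∩ finitePart Ω)) := fun ε => by
    rw [himg, closure_image_coe (isBounded_image_planeMap hf hinf hΩ hfinf hE.thickening)]
  simp only [clusterSet, hcl]
  refine Subset.antisymm (fun p hp => ?_) ?_
  · obtain ⟨z, -, rfl⟩ := mem_iInter₂.1 hp 1 one_pos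
    refine ⟨z, mem_iInter₂.2 fun ε hε => ?_, rfl⟩
    exact (OnePoint.coe_injective.mem_set_image).1 (mem_iInter₂.1 hp ε hε)
  · rintro _ ⟨z, hz, rfl⟩
    exact mem_iInter₂.2 fun ε hε => ⟨z, mem_iInter₂.1 hz ε hε, rfl⟩

/-- The cluster set of a proper homeomorphism at a compact set of boundary points consists of
boundary points. -/
theorem ProperHomeo.planeClusterSet_subset {F G : ℂ → ℂ} {U U' E : Set ℂ}
    (h : ProperHomeo F G U U') (hE : IsCompact E) (hEU : E ⊆ frontier U) :
    planeClusterSet F U E ⊆ frontier U' := by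
  intro z hz
  rw [h.isOpen_right.frontier_eq]
  refine ⟨closure_mono ?_ (mem_iInter₂.1 hz 1 one_pos), fun hzU' => ?_⟩
  · rintro _ ⟨x, hx, rfl⟩
    exact h.mapsTo_left hx.2
  · have hGE : Disjoint {G z} E := by
      rw [disjoint_singleton_left]
      intro hGE
      exact (h.isOpen_left.frontier_eq ▸ hEU hGE : G z ∈ closure U \ U).2 (h.mapsTo_right hzU')
    obtain ⟨ε, hε, hd⟩ := hGE.exists_thickenings isCompact_singleton hE.isClosed
    rw [Metric.thickening_singleton] at hd
    have hnhds : G ⁻¹' Metric.ball (G z) ε ∈ 𝓝 z :=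
      (h.continuousOn_right.continuousAt (h.isOpen_right.mem_nhds hzU')).preimage_mem_nhds
        (Metric.ball_mem_nhds _ hε)
    obtain ⟨_, hx1, x, ⟨hxE, hxU⟩, rfl⟩ :=
      mem_closure_iff_nhds.1 (mem_iInter₂.1 hz ε hε) _ hnhds
    rw [mem_preimage, h.leftInv x hxU] at hx1
    exact disjoint_left.1 hd hx1 hxE

end Cluster


/-! ### The theorem on the sphere -/

section Sphere

variable {f : Sphere → Sphere} {Ω Ω' E : Set Sphere}

theorem image_coe_preimage_frontier (hΩ : IsOpen Ω) (hinf : OnePoint.infty ∈ Ω)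
    (hE : E ⊆ frontier Ω) :
    (fun z : ℂ => (z : Sphere)) '' ((fun z : ℂ => (z : Sphere)) ⁻¹' E) = E :=
  image_preimage_eq_of_subset fun _ hp => by
    refine ⟨finiteCoord _, coe_finiteCoord fun h => infty_notMem_frontier hΩ hinf (hE (h ▸ hp))⟩

theorem isCompact_preimage_coe (hΩ : IsOpen Ω) (hinf : OnePoint.infty ∈ Ω)
    (hE : E ⊆ frontier Ω) (hEc : IsCompact E) :
    IsCompact ((fun z : ℂ => (z : Sphere)) ⁻¹' E) := by
  rwa [OnePoint.isOpenEmbedding_coe.isInducing.isCompact_iff,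
    image_coe_preimage_frontier hΩ hinf hE]

theorem preimage_subset_frontier (hE : E ⊆ frontier Ω) :
    (fun z : ℂ => (z : Sphere)) ⁻¹' E ⊆ frontier (finitePart Ω) := by
  rw [finitePart, ← preimage_frontier]
  exact preimage_mono hE

theorem HasUniformlyFatComplement.exists_isFat (h : HasUniformlyFatComplement Ω)
    (hinf : OnePoint.infty ∈ Ω) :
    ∃ c : ℝ, 0 < c ∧ ∀ k ∈ complComponents (finitePart Ω), IsFat c k := by
  obtain ⟨c, hc, hfat⟩ := h
  refine ⟨c, hc, ?_⟩
  rintro _ ⟨y, hy, rfl⟩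
  have := hfat _ ⟨(y : Sphere), hy, rfl⟩
  have hinf' : OnePoint.infty ∉ Ωᶜ := fun h' => h' hinf
  rwa [preimage_component hinf'] at this

/-- The quasihyperbolic condition on the truncated domain makes the boundary limits on almost every
line negligible. -/
theorem QuasihyperbolicCondition.ae_volume_boundary_limits_eq_zero
    (hqh : QuasihyperbolicCondition Ω) (hf : IsConformalMapOnto f Ω Ω')
    (hinf : OnePoint.infty ∈ Ω) (hΩ : IsOpen Ω) (hfinf : f OnePoint.infty = OnePoint.infty)
    (w a : ℂ) {u : ℂ} (hu : ‖u‖ = 1) :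
    ∀ᵐ t : ℝ, volume ((fun z => ‖z - w‖) '' {z | ∃ x ∈ frontier (finitePart Ω),
      ((x - a) * (starRingEnd ℂ) u).im = t ∧
        Tendsto (planeMap f) (𝓝[finitePart Ω] x) (𝓝 z)}) = 0 := by
  obtain ⟨R, x₀, hR, hx₀, hk⟩ := hqh
  have hU : IsOpen (finitePart Ω) := isOpen_preimage_coe hΩ
  have hD : IsOpen (truncation Ω R) := Metric.isOpen_ball.inter hU
  have hDU : truncation Ω R ⊆ finitePart Ω := inter_subset_right
  have hbd : Bornology.IsBounded (truncation Ω R) := Metric.isBounded_ball.subset inter_subset_left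
  have hfr : frontier (finitePart Ω) ⊆ frontier (truncation Ω R) := by
    intro x hx
    rw [hU.frontier_eq] at hx
    rw [hD.frontier_eq]
    refine ⟨?_, fun h => hx.2 (hDU h)⟩
    have hxR : x ∈ Metric.ball (0 : ℂ) R := by
      obtain ⟨z, hz, hzx⟩ := hR (show (x : Sphere) ∈ Ωᶜ from hx.2)
      rwa [← OnePoint.coe_injective hzx]
    exact Metric.isOpen_ball.inter_closure ⟨hxR, hx.1⟩
  have hne : (frontier (truncation Ω R)).Nonempty := by
    refine nonempty_frontier_iff.2 ⟨⟨x₀, hx₀⟩, fun h => ?_⟩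
    exact NormedSpace.unbounded_univ ℝ ℂ (h ▸ hbd)
  have hdiff : DifferentiableOn ℂ (planeMap f) (truncation Ω R) := fun z hz =>
    (differentiableAt_planeMap hf hinf hfinf (hDU hz)).differentiableWithinAt
  have harea : volume (planeMap f '' truncation Ω R) ≠ ⊤ :=
    (isBounded_image_planeMap hf hinf hΩ hfinf Metric.isBounded_ball).measure_lt_top.ne
  filter_upwards [CircleDomain.ae_volume_boundary_limits_eq_zero hD hbd hne hx₀ hk.ne hdiff
    ((injOn_planeMap hf hinf hfinf).mono hDU) harea (lipschitzWith_im_mul_conj a hu)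
    (lipschitzWith_norm_sub w)] with t ht
  refine measure_mono_null (image_mono ?_) ht
  rintro z ⟨x, hx, hxt, hz⟩
  exact ⟨x, hfr hx, hxt, hz.mono_left (nhdsWithin_mono _ hDU)⟩

/-- The disks bounded by the boundary circles of a circle domain are its complementary
components. -/
theorem IsCircleDomain.exists_closedBall (hΩ : IsCircleDomain Ω) (hinf : OnePoint.infty ∈ Ω)
    {q : Set ℂ} (hq : q ∈ complComponents (finitePart Ω)) :
    ∃ (a : ℂ) (r : ℝ), q = Metric.closedBall a r := by
  obtain ⟨x, hx, rfl⟩ := hq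
  obtain ⟨a, r, -, h⟩ := exists_component_eq_closedBall (isOpen_preimage_coe hΩ.1.1)
    (isConnected_preimage_coe hΩ.1 hinf) (isCompact_compl_preimage_coe hΩ.1.1 hinf)
    (fun z hz => hΩ.component_frontier hinf hz) hx
  exact ⟨a, r, h⟩

theorem clusterSet_subset_frontier (hΩ : IsSphereDomain Ω) (hinf : OnePoint.infty ∈ Ω)
    (hΩ' : IsSphereDomain Ω') (hinf' : OnePoint.infty ∈ Ω') (hf : IsConformalMapOnto f Ω Ω')
    (hfinf : f OnePoint.infty = OnePoint.infty) (hE : E ⊆ frontier Ω) (hEc : IsCompact E) :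
    clusterSet f Ω E ⊆ frontier Ω' := by
  have hE₀ := isCompact_preimage_coe hΩ.1 hinf hE hEc
  rw [clusterSet_eq hf hinf hΩ.1 hfinf hE₀.isBounded, image_subset_iff, preimage_frontier]
  exact (properHomeo_planeMap hΩ hinf hΩ' hinf' hf hfinf).planeClusterSet_subset hE₀
    (preimage_subset_frontier hE)

theorem clusterSet_ne_singleton (hΩ : IsCircleDomain Ω) (hinf : OnePoint.infty ∈ Ω)
    (hΩ' : IsSphereDomain Ω') (hinf' : OnePoint.infty ∈ Ω') (hf : IsConformalMapOnto f Ω Ω')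
    (hfinf : f OnePoint.infty = OnePoint.infty) (hqh : QuasihyperbolicCondition Ω)
    (hfat : HasUniformlyFatComplement Ω') (hE : E ⊆ frontier Ω) (hEc : IsCompact E)
    (hEp : IsPreconnected E) (hEn : E.Nontrivial) (w : Sphere) : clusterSet f Ω E ≠ {w} := by
  intro hw
  have hE₀ := isCompact_preimage_coe hΩ.1.1 hinf hE hEc
  set E₀ := (fun z : ℂ => (z : Sphere)) ⁻¹' E with hE₀def
  have hE₀U : E₀ ⊆ frontier (finitePart Ω) := preimage_subset_frontier hE
  have himg : (fun z : ℂ => (z : Sphere)) '' E₀ = E := image_coe_preimage_frontier hΩ.1.1 hinf hE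
  rw [clusterSet_eq hf hinf hΩ.1.1 hfinf hE₀.isBounded] at hw
  obtain ⟨v, hv, rfl⟩ : w ∈ (fun z : ℂ => (z : Sphere)) '' planeClusterSet (planeMap f)
    (finitePart Ω) E₀ := hw ▸ mem_singleton w
  have huniq : ∀ y ∈ planeClusterSet (planeMap f) (finitePart Ω) E₀, y = v := fun y hy =>
    OnePoint.coe_injective (mem_singleton_iff.1 (hw ▸ mem_image_of_mem _ hy))
  have htend : ∀ e ∈ E₀, Tendsto (planeMap f) (𝓝[finitePart Ω] e) (𝓝 v) := by
    intro e he
    refine (isBounded_image_planeMap hf hinf hΩ.1.1 hfinf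
      (Metric.isBounded_ball (x := e) (r := 1))).isCompact_closure.tendsto_nhds_of_unique_mapClusterPt
      ?_ fun y _ hy => huniq y (mem_planeClusterSet_of_mapClusterPt he hy)
    filter_upwards [self_mem_nhdsWithin, nhdsWithin_le_nhds (Metric.ball_mem_nhds e one_pos)]
      with t ht1 ht2
    exact subset_closure (mem_image_of_mem _ ⟨ht2, ht1⟩)
  have hE₀p : IsPreconnected E₀ := by
    rwa [← OnePoint.isOpenEmbedding_coe.isInducing.isPreconnected_image, himg]
  have hE₀n : E₀.Nontrivial := by
    rw [← himg] at hEn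
    exact nontrivial_of_image _ _ hEn
  obtain ⟨e, he⟩ := hE₀n.nonempty
  have heU := hE₀U he
  obtain ⟨a, r, hr, har⟩ := hΩ.component_frontier hinf heU
  have hU : IsOpen (finitePart Ω) := isOpen_preimage_coe hΩ.1.1
  have hdisk : Metric.closedBall a r ∈ complComponents (finitePart Ω) :=
    ⟨e, (hU.frontier_eq ▸ heU : e ∈ closure _ \ _).2,
      (component_eq_closedBall hU (isConnected_preimage_coe hΩ.1 hinf)
        (isCompact_compl_preimage_coe hΩ.1.1 hinf) hr heU har).symm⟩
  obtain ⟨c, hc, hcfat⟩ := hfat.exists_isFat hinf'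
  exact (properHomeo_planeMap hΩ.1 hinf hΩ' hinf' hf hfinf).not_tendsto_on_arc
    (fun z hz => (differentiableAt_planeMap hf hinf hfinf hz).differentiableWithinAt)
    (exists_norm_planeMap_gt hf hinf hΩ.1.1 hfinf) (fun q hq => hΩ.exists_closedBall hinf hq) hc
    hcfat (fun a u hu => hqh.ae_volume_boundary_limits_eq_zero hf hinf hΩ.1.1 hfinf v a hu) hdisk
    hE₀ hE₀p hE₀n (har ▸ hE₀p.subset_connectedComponentIn he hE₀U) hE₀U htend

theorem clusterSet_nonempty (hf : IsConformalMapOnto f Ω Ω') (hΩ : IsOpen Ω)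
    (hinf : OnePoint.infty ∈ Ω) (hfinf : f OnePoint.infty = OnePoint.infty) (hE : E ⊆ frontier Ω)
    (hEc : IsCompact E) (hne : E.Nonempty) : (clusterSet f Ω E).Nonempty := by
  have hE₀ := isCompact_preimage_coe hΩ hinf hE hEc
  rw [clusterSet_eq hf hinf hΩ hfinf hE₀.isBounded]
  rw [← image_coe_preimage_frontier hΩ hinf hE] at hne
  obtain ⟨e, he⟩ := hne.of_image
  have : (𝓝[finitePart Ω] e).NeBot := mem_closure_iff_nhdsWithin_neBot.1
    (frontier_subset_closure (preimage_subset_frontier hE he))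
  obtain ⟨y, -, hy⟩ := (isBounded_image_planeMap hf hinf hΩ hfinf
    (Metric.isBounded_ball (x := e) (r := 1))).isCompact_closure.exists_mapClusterPt
    (f := 𝓝[finitePart Ω] e) (u := planeMap f) (by
      rw [le_principal_iff, mem_map]
      filter_upwards [self_mem_nhdsWithin, nhdsWithin_le_nhds (Metric.ball_mem_nhds e one_pos)]
        with t ht1 ht2
      exact subset_closure (mem_image_of_mem _ ⟨ht2, ht1⟩))
  exact ⟨_, mem_image_of_mem _ (mem_planeClusterSet_of_mapClusterPt he hy)⟩

/-- If a boundary component corresponds to a point, the cluster set reduces to this point. -/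
theorem BoundaryCorrespondence.clusterSet_subset_singleton {b : Set Sphere} {p : Sphere}
    (h : BoundaryCorrespondence f Ω Ω' b {p}) (hf : IsConformalMapOnto f Ω Ω') (hΩ : IsOpen Ω)
    (hinf : OnePoint.infty ∈ Ω) (hfinf : f OnePoint.infty = OnePoint.infty)
    (hb : b ⊆ frontier Ω) (hbc : IsCompact b) : clusterSet f Ω b ⊆ {p} := by
  have hb₀ := isCompact_preimage_coe hΩ hinf hb hbc
  rw [clusterSet_eq hf hinf hΩ hfinf hb₀.isBounded]
  rintro _ ⟨z, hz, rfl⟩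
  have hseq : ∀ n : ℕ, ∃ x, x ∈ Metric.thickening (1 / ((n : ℝ) + 1))
      ((fun z : ℂ => (z : Sphere)) ⁻¹' b) ∧ x ∈ finitePart Ω ∧
      dist (planeMap f x) z < 1 / ((n : ℝ) + 1) := by
    intro n
    obtain ⟨_, ⟨x, ⟨hx, hxU⟩, rfl⟩, hxz⟩ :=
      Metric.mem_closure_iff.1 (mem_iInter₂.1 hz _ (Nat.one_div_pos_of_nat (n := n))) _
        (Nat.one_div_pos_of_nat (n := n))
    exact ⟨x, hx, hxU, by rwa [dist_comm]⟩
  choose x hxb hxU hxz using hseq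
  have hlim1 : Tendsto (fun n => (x n : Sphere)) atTop (𝓝ˢ b) := by
    intro O hO
    obtain ⟨V, hV, hbV, hVO⟩ := mem_nhdsSet_iff_exists.1 hO
    obtain ⟨δ, hδ, hδV⟩ := hb₀.exists_thickening_subset_open (isOpen_preimage_coe hV)
      (preimage_mono hbV)
    rw [mem_map]
    filter_upwards [(tendsto_one_div_add_atTop_nhds_zero_nat (𝕜 := ℝ)).eventually_lt_const hδ]
      with n hn
    exact hVO (hδV (Metric.thickening_mono hn.le _ (hxb n)))
  have hlim2 := h.accumulates (fun n => (x n : Sphere)) hxU hlim1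
  rw [nhdsSet_singleton] at hlim2
  have hlim3 : Tendsto (fun n => planeMap f (x n)) atTop (𝓝 z) :=
    tendsto_iff_dist_tendsto_zero.2 (squeeze_zero (fun _ => dist_nonneg) (fun n => (hxz n).le)
      tendsto_one_div_add_atTop_nhds_zero_nat)
  have hlim4 : Tendsto (fun n => f (x n)) atTop (𝓝 (z : Sphere)) :=
    ((OnePoint.continuous_coe.tendsto z).comp hlim3).congr fun n =>
      coe_planeMap hf hinf hfinf (hxU n)
  exact tendsto_nhds_unique hlim4 hlim2

/-- The properties, as a boundary set, of a circle that is a boundary component. -/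
theorem isCompact_and_nontrivial_of_isGeometricCircle {b : Set Sphere} (hΩ : IsOpen Ω)
    (hinf : OnePoint.infty ∈ Ω) (hb : b ⊆ frontier Ω) (h : IsGeometricCircle b) :
    IsCompact b ∧ b.Nontrivial := by
  rcases h with ⟨a, r, hr, rfl⟩ | ⟨a, v, -, rfl⟩
  · refine ⟨(isCompact_sphere a r).image OnePoint.continuous_coe, ?_⟩
    refine ((nontrivial_of_mem_mem_ne (x := a + r) (y := a - r) ?_ ?_ fun h => ?_)).image
      OnePoint.coe_injective
    · simp [abs_of_pos hr]
    · simp [abs_of_pos hr]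
    · have h2 : (r : ℂ) = 0 := by linear_combination h / 2
      exact hr.ne' (by exact_mod_cast h2)
  · exact absurd (hb (mem_insert _ _)) (infty_notMem_frontier hΩ hinf)

end Sphere

end CircleDomain

theorem mainTheorem5 (Ω Ω' : Set CircleDomain.Sphere)
    (f : CircleDomain.Sphere → CircleDomain.Sphere)
    (hΩ : CircleDomain.IsCircleDomain Ω) (hΩinf : OnePoint.infty ∈ Ω)
    (hΩ' : CircleDomain.IsSphereDomain Ω') (hΩ'inf : OnePoint.infty ∈ Ω')
    (hf : CircleDomain.IsConformalMapOnto f Ω Ω')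
    (hfinf : f OnePoint.infty = OnePoint.infty)
    (hqh : CircleDomain.QuasihyperbolicCondition Ω)
    (hfat : CircleDomain.HasUniformlyFatComplement Ω') :
    (∀ E : Set CircleDomain.Sphere, E ⊆ frontier Ω → IsCompact E → IsConnected E → E.Nontrivial →
      CircleDomain.clusterSet f Ω E ⊆ frontier Ω' ∧
        ¬ ∃ w, CircleDomain.clusterSet f Ω E = {w}) ∧
    (∀ b b' : Set CircleDomain.Sphere, CircleDomain.BoundaryCorrespondence f Ω Ω' b b' →
      CircleDomain.IsGeometricCircle b → ¬ ∃ w, b' = {w}) := by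
  refine ⟨fun E hE hEc hEp hEn =>
    ⟨CircleDomain.clusterSet_subset_frontier hΩ.1 hΩinf hΩ' hΩ'inf hf hfinf hE hEc, ?_⟩, ?_⟩
  · rintro ⟨w, hw⟩
    exact CircleDomain.clusterSet_ne_singleton hΩ hΩinf hΩ' hΩ'inf hf hfinf hqh hfat hE hEc
      hEp.isPreconnected hEn w hw
  · rintro b _ hbb hcirc ⟨w, rfl⟩
    have hb : b ⊆ frontier Ω ∧ IsPreconnected b := by
      obtain ⟨x, -, rfl⟩ := hbb.source
      exact ⟨connectedComponentIn_subset _ _, isPreconnected_connectedComponentIn⟩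
    obtain ⟨hbc, hbn⟩ :=
      CircleDomain.isCompact_and_nontrivial_of_isGeometricCircle hΩ.1.1 hΩinf hb.1 hcirc
    refine CircleDomain.clusterSet_ne_singleton hΩ hΩinf hΩ' hΩ'inf hf hfinf hqh hfat hb.1 hbc
      hb.2 hbn w (Subset.antisymm ?_ ?_)
    · exact hbb.clusterSet_subset_singleton hf hΩ.1.1 hΩinf hfinf hb.1 hbc
    · obtain ⟨p, hp⟩ :=
        CircleDomain.clusterSet_nonempty hf hΩ.1.1 hΩinf hfinf hb.1 hbc hbn.nonempty
      have := hbb.clusterSet_subset_singleton hf hΩ.1.1 hΩinf hfinf hb.1 hbc hp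
      rw [mem_singleton_iff] at this
      exact singleton_subset_iff.2 (this ▸ hp)
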